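/- Conventions. Let $(M,g)$ be a non-empty smooth 3-dimensional manifold with a smooth Lorentzian metric of signature $(+,+,-)$, oriented by a volume form $e_{abc}$ with $e_{abc}e^{abc}=-6$, and let $\nabla$ be its Levi-Civita connection. The curvature is defined by $R_{abd}{}^{c}V^d=(\nabla_a\nabla_b-\nabla_b\nabla_a)V^c$, $R_{ab}=R_{acb}{}^{c}$, $R=g^{ab}R_{ab}$; the tracefree Ricci tensor is $\Phi_{ab}=R_{ab}-\tfrac13 R g_{ab}$, the Schouten tensor is $P_{ab}=-\Phi_{ab}-\tfrac1{12}Rg_{ab}$, the Cotton tensor is $A_{abc}=\nabla_bP_{ca}-\nabla_cP_{ba}$, and $(*A)_{ab}=\tfrac12 e_b{}^{cd}A_{acd}$. The equations of topological massive gravity (TMG) are $$R_{ab}-\tfrac12 R\,g_{ab}+\Lambda\,g_{ab}=\tfrac1m(*A)_{ab},\qquad m\neq0,\ \Lambda\in\mathbb R .$$ Petrov types. Let $(k,\ell,u)$ be a real null frame at a point, i.e. $g_{ab}=2k_{(a}\ell_{b)}+u_au_b$. The complex null vectors are, up to scale, $\xi=s^2k+\sqrt2\,st\,u-t^2\ell$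 with $(s:t)\in\mathbb{CP}^1$, and $\tfrac12\Phi_{ab}\xi^a\xi^b$ is a real binary quartic in $(s,t)$. The Petrov type of $\Phi$ at the point is its root pattern: G (two distinct complex conjugate pairs), SG (two distinct real roots and a conjugate pair), II (a double real root and a conjugate pair), D (a conjugate pair of double roots), G$_r$, II$_r$, III$_r$, N$_r$, D$_r$ (only real roots, with multiplicities $1111$, $211$, $31$, $4$, $22$ respectively), O ($\Phi=0$). Congruences (smooth fields of tangent lines on an open set). A divergence-free congruence of null geodesics is a field of lines locally spanned by a smooth nowhere zero null vector field $k^a$ with $k^a\nabla_bk^b-k^b\nabla_bk^a=0$. A shear-free congruence of timelike geodesics is a field of lines locally spanned by a smooth vector field $u^a$ with $u_au^a=-1$, $u^b\nabla_bu^a=0$ and $\nabla_{(a}u_{b)}-\tfrac12h_{ab}\nabla^cu_c+(u^c\nabla_cu_{(a})u_{b)}=0$, where $h_{ab}=g_{ab}+u_au_b$. $(M,g)$ is Kundt if it admits a divergence-free congruence of null geodesics on all of $M$. Theorem (Lorentzian Goldberg–Sachs theorem for TMG). Suppose $(M,g)$ solves the TMG equations. (A) On any open set $U\subseteq M$: if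 $U$ admits a divergence-free congruence of null geodesics, then at every point of $U$ the type of $\Phi$ is II, II$_r$, D$_r$, III$_r$, N$_r$ or O. At every point of $U$ where two such congruences have different tangent lines, the type is D$_r$ or O. If $U$ admits a shear-free congruence of timelike geodesics, then at every point of $U$ the type is D or O. (B) Suppose that the Petrov type of $\Phi$ is the same at all points of $M$, and is not O. Then: 1. every point of $M$ has an open neighbourhood that admits a divergence-free congruence of null geodesics if and only if $\Phi$ is of type II, II$_r$, D$_r$, III$_r$ or N$_r$; 2. every point of $M$ has an open neighbourhood that admits two divergence-free congruences of null geodesics which are distinct at each of its points if and only if $\Phi$ is of type D$_r$; 3. $(M,g)$ admits a shear-free congruence of timelike geodesics on all of $M$ if and only if $\Phi$ is of type D; 4. assume in addition, when $\Phi$ is of type D$_r$, that there is on all of $M$ a continuous field of real null lines each of which is one of the two multiple principal null directions of $\Phi$, i.e. is spanned by some $k\neq0$ with $k_{[a}\Phi_{b]c}k^c=0$ (for the other types nothing is assumed). Then $(M,g)$ is Kundt if and only if $\Phi$ is of type II, II$_r$, D$_r$, III$_r$ or N$_r$; and $(M,g)$ admits two divergence-free congruences of null geodesics on all of $M$ that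 are distinct at every point if and only if $\Phi$ is of type D$_r$. -/

import Mathlib

open Bundle VectorField FiberBundle Module
open scoped Manifold ContDiff Topology Matrix

/-- The model space `ℝ³` of the manifolds considered. -/
abbrev E3 : Type := EuclideanSpace ℝ (Fin 3)

/-- The vector field `X` is of class `C^n` on `U`. -/
abbrev SmoothFieldOn {M : Type*} [TopologicalSpace M] [ChartedSpace E3 M]
    [IsManifold 𝓘(ℝ, E3) ∞ M] (n : WithTop ℕ∞) (X : ∀ p : M, TangentSpace 𝓘(ℝ, E3) p)
    (U : Set M) : Prop :=
  ContMDiffOn 𝓘(ℝ, E3) (𝓘(ℝ, E3)).tangent n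
    (fun q => (⟨q, X q⟩ : TangentBundle 𝓘(ℝ, E3) M)) U

/-- The vector field `X` is differentiable at `p`. -/
abbrev DiffFieldAt {M : Type*} [TopologicalSpace M] [ChartedSpace E3 M]
    [IsManifold 𝓘(ℝ, E3) ∞ M] (X : ∀ p : M, TangentSpace 𝓘(ℝ, E3) p) (p : M) : Prop :=
  MDifferentiableAt 𝓘(ℝ, E3) (𝓘(ℝ, E3)).tangent
    (fun q => (⟨q, X q⟩ : TangentBundle 𝓘(ℝ, E3) M)) p

/-- A smooth Lorentzian metric, of signature `(+, +, -)`, on a smooth 3-manifold. -/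
structure LorentzMetric (M : Type*) [TopologicalSpace M] [ChartedSpace E3 M]
    [IsManifold 𝓘(ℝ, E3) ∞ M] where
  val : ∀ p : M, TangentSpace 𝓘(ℝ, E3) p →L[ℝ] TangentSpace 𝓘(ℝ, E3) p →L[ℝ] ℝ
  symm : ∀ (p : M) (v w : TangentSpace 𝓘(ℝ, E3) p), val p v w = val p w v
  signature : ∀ p : M, ∃ e : Basis (Fin 3) ℝ (TangentSpace 𝓘(ℝ, E3) p),
    ∀ i j, val p (e i) (e j) = Matrix.diagonal ![1, 1, -1] i j
  contMDiff : ContMDiff 𝓘(ℝ, E3) (𝓘(ℝ, E3).prod 𝓘(ℝ, E3 →L[ℝ] E3 →L[ℝ] ℝ)) ∞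
    (fun p ↦ TotalSpace.mk' (E3 →L[ℝ] E3 →L[ℝ] ℝ)
      (E := fun p : M => TangentSpace 𝓘(ℝ, E3) p →L[ℝ] TangentSpace 𝓘(ℝ, E3) p →L[ℝ] ℝ) p (val p))

namespace LorentzMetric

variable {M : Type*} [TopologicalSpace M] [ChartedSpace E3 M] [IsManifold 𝓘(ℝ, E3) ∞ M]

lemma nondegenerate (g : LorentzMetric M) (p : M) (v : TangentSpace 𝓘(ℝ, E3) p)
    (h : ∀ w, g.val p v w = 0) : v = 0 := by
  obtain ⟨e, he⟩ := g.signature p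
  have hv := e.sum_repr v
  have key : ∀ j, e.repr v j = 0 := by
    intro j
    have h1 := h (e j)
    rw [← hv] at h1
    simp only [map_sum, map_smul, _root_.sum_apply, _root_.smul_apply,
      he, Matrix.diagonal_apply] at h1
    fin_cases j <;> simpa [Fin.sum_univ_three] using h1
  rw [← hv]; simp [key]

lemma mdiffAt_val (g : LorentzMetric M) {X Y : ∀ p : M, TangentSpace 𝓘(ℝ, E3) p} {x : M}
    (hX : DiffFieldAt X x) (hY : DiffFieldAt Y x) :
    MDifferentiableAt 𝓘(ℝ, E3) 𝓘(ℝ) (fun p => g.val p (X p) (Y p)) x := by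
  have : MDifferentiableAt 𝓘(ℝ, E3) (𝓘(ℝ, E3).prod 𝓘(ℝ))
      (fun m ↦ TotalSpace.mk' ℝ (E := Bundle.Trivial M ℝ) m (g.val m (X m) (Y m))) x := by
    apply MDifferentiableAt.clm_bundle_apply₂ (F₁ := E3) (F₂ := E3)
    · exact (g.contMDiff x).mdifferentiableAt (by simp)
    · exact hX
    · exact hY
  simp only [mdifferentiableAt_totalSpace] at this
  exact this.2

/-- The Koszul expression, to become `2 g (∇_X Y, Z)`. -/
noncomputable def koszul (g : LorentzMetric M) (Y X Z : ∀ p : M, TangentSpace 𝓘(ℝ, E3) p) (p : M) : ℝ :=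
  mvfderiv 𝓘(ℝ, E3) (fun q => g.val q (Y q) (Z q)) p (X p)
    + mvfderiv 𝓘(ℝ, E3) (fun q => g.val q (X q) (Z q)) p (Y p)
    - mvfderiv 𝓘(ℝ, E3) (fun q => g.val q (X q) (Y q)) p (Z p)
    + g.val p (mlieBracket 𝓘(ℝ, E3) X Y p) (Z p)
    - g.val p (mlieBracket 𝓘(ℝ, E3) X Z p) (Y p)
    - g.val p (mlieBracket 𝓘(ℝ, E3) Y Z p) (X p)

lemma koszul_tensorial_left (g : LorentzMetric M) {Y Z : ∀ p : M, TangentSpace 𝓘(ℝ, E3) p} {x : M}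
    (hY : DiffFieldAt Y x) (hZ : DiffFieldAt Z x) :
    TensorialAt 𝓘(ℝ, E3) E3 (fun X => g.koszul Y X Z x) x where
  smul {f X} hf hX := by
    have h1 := g.mdiffAt_val hX hZ
    have h2 := g.mdiffAt_val hX hY
    simp only [koszul, Pi.smul_apply', map_smul, _root_.smul_apply, smul_eq_mul]
    rw [mvfderiv_fun_mul hf h1, mvfderiv_fun_mul hf h2, mlieBracket_smul_left hf hX,
      mlieBracket_smul_left hf hX]
    simp
    ring
  add {X X'} hX hX' := by
    simp only [koszul, Pi.add_apply, map_add, _root_.add_apply]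
    rw [mvfderiv_fun_add (g.mdiffAt_val hX hZ) (g.mdiffAt_val hX' hZ),
      mvfderiv_fun_add (g.mdiffAt_val hX hY) (g.mdiffAt_val hX' hY),
      mlieBracket_add_left hX hX', mlieBracket_add_left hX hX']
    simp
    ring

lemma koszul_tensorial_right (g : LorentzMetric M) {Y X : ∀ p : M, TangentSpace 𝓘(ℝ, E3) p} {x : M}
    (hY : DiffFieldAt Y x) (hX : DiffFieldAt X x) :
    TensorialAt 𝓘(ℝ, E3) E3 (fun Z => g.koszul Y X Z x) x where
  smul {f Z} hf hZ := by
    simp only [koszul, Pi.smul_apply', map_smul, smul_eq_mul]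
    rw [mvfderiv_fun_mul hf (g.mdiffAt_val hX hZ), mvfderiv_fun_mul hf (g.mdiffAt_val hY hZ),
      mlieBracket_smul_right hf hZ, mlieBracket_smul_right hf hZ]
    simp [g.symm x (Z x) (Y x), g.symm x (Z x) (X x)]
    ring
  add {Z Z'} hZ hZ' := by
    simp only [koszul, Pi.add_apply, map_add]
    rw [mvfderiv_fun_add (g.mdiffAt_val hX hZ) (g.mdiffAt_val hX hZ'),
      mvfderiv_fun_add (g.mdiffAt_val hY hZ) (g.mdiffAt_val hY hZ'),
      mlieBracket_add_right hZ hZ', mlieBracket_add_right hZ hZ']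
    simp
    ring

lemma koszul_add (g : LorentzMetric M) {Y Y' X Z : ∀ p : M, TangentSpace 𝓘(ℝ, E3) p} {x : M}
    (hY : DiffFieldAt Y x) (hY' : DiffFieldAt Y' x)
    (hX : DiffFieldAt X x) (hZ : DiffFieldAt Z x) :
    g.koszul (Y + Y') X Z x = g.koszul Y X Z x + g.koszul Y' X Z x := by
  simp only [koszul, Pi.add_apply, map_add, _root_.add_apply]
  rw [mvfderiv_fun_add (g.mdiffAt_val hY hZ) (g.mdiffAt_val hY' hZ),
    mvfderiv_fun_add (g.mdiffAt_val hX hY) (g.mdiffAt_val hX hY'),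
    mlieBracket_add_right hY hY', mlieBracket_add_left hY hY']
  simp
  ring

lemma koszul_smul (g : LorentzMetric M) {f : M → ℝ} {Y X Z : ∀ p : M, TangentSpace 𝓘(ℝ, E3) p} {x : M}
    (hf : MDifferentiableAt 𝓘(ℝ, E3) 𝓘(ℝ) f x) (hY : DiffFieldAt Y x)
    (hX : DiffFieldAt X x) (hZ : DiffFieldAt Z x) :
    g.koszul (f • Y) X Z x = f x * g.koszul Y X Z x
      + 2 * (mvfderiv 𝓘(ℝ, E3) f x (X x) * g.val x (Y x) (Z x)) := by
  simp only [koszul, Pi.smul_apply', map_smul, _root_.smul_apply, smul_eq_mul]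
  rw [mvfderiv_fun_mul hf (g.mdiffAt_val hY hZ), mvfderiv_fun_mul hf (g.mdiffAt_val hX hY),
    mlieBracket_smul_right hf hY, mlieBracket_smul_left hf hY]
  simp [g.symm x (Y x) (X x)]
  ring

/-- Lowering an index with the metric. -/
noncomputable def flat (g : LorentzMetric M) (p : M) : TangentSpace 𝓘(ℝ, E3) p →ₗ[ℝ] Module.Dual ℝ (TangentSpace 𝓘(ℝ, E3) p) where
  toFun v := (g.val p v : TangentSpace 𝓘(ℝ, E3) p →ₗ[ℝ] ℝ)
  map_add' v w := by ext; simp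
  map_smul' c v := by ext; simp

/-- Raising an index with the metric. -/
noncomputable def sharp (g : LorentzMetric M) (p : M) : Module.Dual ℝ (TangentSpace 𝓘(ℝ, E3) p) ≃ₗ[ℝ] TangentSpace 𝓘(ℝ, E3) p :=
  haveI : FiniteDimensional ℝ (TangentSpace 𝓘(ℝ, E3) p) := inferInstanceAs (FiniteDimensional ℝ E3)
  (LinearEquiv.ofInjectiveOfFinrankEq (g.flat p)
    (by
      rw [injective_iff_map_eq_zero]
      intro v hv
      exact g.nondegenerate p v fun w => congrArg (fun φ => φ w) hv)
    (Subspace.dual_finrank_eq).symm).symm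


lemma val_sharp (g : LorentzMetric M) (p : M) (φ : Module.Dual ℝ (TangentSpace 𝓘(ℝ, E3) p))
    (w : TangentSpace 𝓘(ℝ, E3) p) : g.val p (g.sharp p φ) w = φ w :=
  congrArg (fun ψ => ψ w) ((g.sharp p).symm_apply_apply φ)

open Classical in
/-- The covariant derivative `∇ Y` at `p`, determined by the Koszul formula
(with the value `0` where `Y` is not differentiable). -/
noncomputable def leviCivitaFun (g : LorentzMetric M) (Y : ∀ p : M, TangentSpace 𝓘(ℝ, E3) p)
    (p : M) : TangentSpace 𝓘(ℝ, E3) p →L[ℝ] TangentSpace 𝓘(ℝ, E3) p :=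
  if hY : DiffFieldAt Y p then
    haveI : FiniteDimensional ℝ (TangentSpace 𝓘(ℝ, E3) p) :=
      inferInstanceAs (FiniteDimensional ℝ E3)
    haveI : T2Space (TangentSpace 𝓘(ℝ, E3) p) := inferInstanceAs (T2Space E3)
    LinearMap.toContinuousLinearMap
      { toFun := fun u => g.sharp p ((1 / 2 : ℝ) •
          ((TensorialAt.mkHom₂ (fun X Z => g.koszul Y X Z p) p
            (fun _ hZ => g.koszul_tensorial_left hY hZ)
            (fun _ hX => g.koszul_tensorial_right hY hX) u :
              TangentSpace 𝓘(ℝ, E3) p →L[ℝ] ℝ) : TangentSpace 𝓘(ℝ, E3) p →ₗ[ℝ] ℝ))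
        map_add' := fun u v => by
          rw [← map_add, ← smul_add]; congr 2; ext w; simp
        map_smul' := fun c u => by
          rw [RingHom.id_apply, ← map_smul, smul_comm c]; congr 2; ext w; simp }
  else 0

lemma leviCivitaFun_spec (g : LorentzMetric M) {X Y Z : ∀ p : M, TangentSpace 𝓘(ℝ, E3) p} {x : M}
    (hX : DiffFieldAt X x) (hY : DiffFieldAt Y x) (hZ : DiffFieldAt Z x) :
    2 * g.val x (g.leviCivitaFun Y x (X x)) (Z x) = g.koszul Y X Z x := by
  have h := TensorialAt.mkHom₂_apply (Φ := fun X Z => g.koszul Y X Z x) (x := x)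
    (fun _ hZ => g.koszul_tensorial_left hY hZ)
    (fun _ hX => g.koszul_tensorial_right hY hX) hX hZ
  simp only [leviCivitaFun, dif_pos hY]
  rw [← h]
  simp [val_sharp]

lemma ext_of_koszul (g : LorentzMetric M) {x : M}
    {A B : TangentSpace 𝓘(ℝ, E3) x →L[ℝ] TangentSpace 𝓘(ℝ, E3) x}
    (h : ∀ X Z : ∀ p : M, TangentSpace 𝓘(ℝ, E3) p, DiffFieldAt X x → DiffFieldAt Z x →
      2 * g.val x (A (X x)) (Z x) = 2 * g.val x (B (X x)) (Z x)) : A = B := by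
  ext1 u
  rw [← sub_eq_zero]
  apply g.nondegenerate x
  intro w
  have := h (extend E3 u) (extend E3 w) (mdifferentiableAt_extend ..) (mdifferentiableAt_extend ..)
  simp only [extend_apply_self] at this
  rw [map_sub, _root_.sub_apply]
  linarith

/-- The Levi-Civita connection of `g`; `g.leviCivita Y p u` is `∇_u Y` at `p`. It is torsion-free
and preserves `g` by the two theorems that follow. -/
noncomputable def leviCivita (g : LorentzMetric M) :
    CovariantDerivative 𝓘(ℝ, E3) E3 (fun p : M => TangentSpace 𝓘(ℝ, E3) p) where
  toFun := g.leviCivitaFun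
  isCovariantDerivativeOnUniv :=
    { add := fun {Y Y' x} hY hY' _ => by
        apply g.ext_of_koszul
        intro X Z hX hZ
        rw [g.leviCivitaFun_spec hX (mdifferentiableAt_add_section hY hY') hZ,
          g.koszul_add hY hY' hX hZ, ← g.leviCivitaFun_spec hX hY hZ,
          ← g.leviCivitaFun_spec hX hY' hZ]
        simp
        ring
      leibniz := fun {Y f x} hY hf _ => by
        apply g.ext_of_koszul
        intro X Z hX hZ
        rw [g.leviCivitaFun_spec hX (hf.smul_section hY) hZ,
          g.koszul_smul hf hY hX hZ, ← g.leviCivitaFun_spec hX hY hZ]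
        simp
        ring }

theorem leviCivita_torsion (g : LorentzMetric M) {X Y : ∀ p : M, TangentSpace 𝓘(ℝ, E3) p} {x : M}
    (hX : DiffFieldAt X x) (hY : DiffFieldAt Y x) :
    g.leviCivita Y x (X x) - g.leviCivita X x (Y x) = mlieBracket 𝓘(ℝ, E3) X Y x := by
  rw [← sub_eq_zero]
  apply g.nondegenerate x
  intro w
  have hw : DiffFieldAt (extend E3 w : ∀ p : M, TangentSpace 𝓘(ℝ, E3) p) x :=
    mdifferentiableAt_extend ..
  have h1 := g.leviCivitaFun_spec hX hY hw
  have h2 := g.leviCivitaFun_spec hY hX hw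
  have e1 : (fun q => g.val q (Y q) (X q)) = fun q => g.val q (X q) (Y q) :=
    funext fun q => g.symm q _ _
  have e2 : mlieBracket 𝓘(ℝ, E3) Y X x = - mlieBracket 𝓘(ℝ, E3) X Y x := by
    rw [mlieBracket_swap, Pi.neg_apply]
  simp only [koszul, extend_apply_self, e1, e2] at h1 h2
  simp only [map_neg, _root_.neg_apply] at h2
  simp only [map_sub, _root_.sub_apply]
  change g.val x (g.leviCivitaFun Y x (X x)) w - g.val x (g.leviCivitaFun X x (Y x)) w - _ = 0
  linarith

theorem leviCivita_metric (g : LorentzMetric M) {X Y Z : ∀ p : M, TangentSpace 𝓘(ℝ, E3) p} {x : M}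
    (hX : DiffFieldAt X x) (hY : DiffFieldAt Y x) (hZ : DiffFieldAt Z x) :
    mvfderiv 𝓘(ℝ, E3) (fun q => g.val q (Y q) (Z q)) x (X x)
      = g.val x (g.leviCivita Y x (X x)) (Z x) + g.val x (Y x) (g.leviCivita Z x (X x)) := by
  have h1 := g.leviCivitaFun_spec hX hY hZ
  have h2 := g.leviCivitaFun_spec hX hZ hY
  have e1 : (fun q => g.val q (Z q) (Y q)) = fun q => g.val q (Y q) (Z q) :=
    funext fun q => g.symm q _ _
  have e2 : mlieBracket 𝓘(ℝ, E3) Z Y x = - mlieBracket 𝓘(ℝ, E3) Y Z x := by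
    rw [mlieBracket_swap, Pi.neg_apply]
  simp only [koszul, e1, e2] at h1 h2
  simp only [map_neg, _root_.neg_apply] at h2
  rw [g.symm x (Y x)]
  change _ = g.val x (g.leviCivitaFun Y x (X x)) (Z x) + g.val x (g.leviCivitaFun Z x (X x)) (Y x)
  linarith

/-- The Riemann tensor, `curvature p u v w = R_{abd}^c u^a v^b w^d` with
`R_{abd}^c W^d = (∇_a ∇_b - ∇_b ∇_a) W^c`, computed from smooth local extensions of `u, v, w`. -/
noncomputable def curvature (g : LorentzMetric M) (p : M) (u v w : TangentSpace 𝓘(ℝ, E3) p) :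
    TangentSpace 𝓘(ℝ, E3) p :=
  let U : ∀ q : M, TangentSpace 𝓘(ℝ, E3) q := extend E3 u
  let V : ∀ q : M, TangentSpace 𝓘(ℝ, E3) q := extend E3 v
  let W : ∀ q : M, TangentSpace 𝓘(ℝ, E3) q := extend E3 w
  g.leviCivita (fun q => g.leviCivita W q (V q)) p u
    - g.leviCivita (fun q => g.leviCivita W q (U q)) p v
    - g.leviCivita W p (mlieBracket 𝓘(ℝ, E3) U V p)

/-- A basis of the tangent space at `p`, used to compute traces (which do not depend on it). -/
noncomputable def frame (p : M) : Basis (Fin 3) ℝ (TangentSpace 𝓘(ℝ, E3) p) :=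
  (EuclideanSpace.basisFun (Fin 3) ℝ).toBasis

/-- The components `g^{ab}` of the inverse metric in the basis `frame p`. -/
noncomputable def inv (g : LorentzMetric M) (p : M) : Matrix (Fin 3) (Fin 3) ℝ :=
  (Matrix.of fun i j => g.val p (frame p i) (frame p j))⁻¹

/-- The Ricci tensor `R_{ab} = R_{acb}^c`. -/
noncomputable def ricci (g : LorentzMetric M) (p : M) (u w : TangentSpace 𝓘(ℝ, E3) p) : ℝ :=
  ∑ i, (frame p).coord i (g.curvature p u (frame p i) w)

/-- The Ricci scalar `R = g^{ab} R_{ab}`. -/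
noncomputable def scalar (g : LorentzMetric M) (p : M) : ℝ :=
  ∑ i, ∑ j, g.inv p i j * g.ricci p (frame p i) (frame p j)

/-- The tracefree Ricci tensor `Φ_{ab} = R_{ab} - R g_{ab} / 3`. -/
noncomputable def tracefreeRicci (g : LorentzMetric M) (p : M)
    (u v : TangentSpace 𝓘(ℝ, E3) p) : ℝ :=
  g.ricci p u v - 1 / 3 * g.scalar p * g.val p u v

/-- The Schouten tensor `P_{ab} = - Φ_{ab} - R g_{ab} / 12`. -/
noncomputable def schouten (g : LorentzMetric M) (p : M) (u v : TangentSpace 𝓘(ℝ, E3) p) : ℝ :=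
  - g.tracefreeRicci p u v - 1 / 12 * g.scalar p * g.val p u v

/-- The covariant derivative `x^c u^a v^b ∇_c P_{ab}` of the Schouten tensor. -/
noncomputable def nablaSchouten (g : LorentzMetric M) (p : M)
    (x u v : TangentSpace 𝓘(ℝ, E3) p) : ℝ :=
  let U : ∀ q : M, TangentSpace 𝓘(ℝ, E3) q := extend E3 u
  let V : ∀ q : M, TangentSpace 𝓘(ℝ, E3) q := extend E3 v
  mvfderiv 𝓘(ℝ, E3) (fun q => g.schouten q (U q) (V q)) p x
    - g.schouten p (g.leviCivita U p x) v - g.schouten p u (g.leviCivita V p x)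

/-- The Cotton tensor `A_{abc} = ∇_b P_{ca} - ∇_c P_{ba}`. -/
noncomputable def cotton (g : LorentzMetric M) (p : M) (u v w : TangentSpace 𝓘(ℝ, E3) p) : ℝ :=
  g.nablaSchouten p v w u - g.nablaSchouten p w v u

/-- An orientation of `(M, g)`, given by a smooth 3-form `e_{abc}` whose value on every
orthonormal basis is `1` or `-1`, that is, `e_{abc} e^{abc} = -6`. -/
structure VolumeForm (g : LorentzMetric M) where
  form : ∀ p : M, TangentSpace 𝓘(ℝ, E3) p [⋀^Fin 3]→ₗ[ℝ] ℝ
  normalised : ∀ (p : M) (e : Basis (Fin 3) ℝ (TangentSpace 𝓘(ℝ, E3) p)),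
    (∀ i j, g.val p (e i) (e j) = Matrix.diagonal ![1, 1, -1] i j) → form p e ^ 2 = 1
  smooth : ∀ (U : Set M) (X Y Z : ∀ p : M, TangentSpace 𝓘(ℝ, E3) p), IsOpen U →
    SmoothFieldOn ∞ X U → SmoothFieldOn ∞ Y U → SmoothFieldOn ∞ Z U →
      ContMDiffOn 𝓘(ℝ, E3) 𝓘(ℝ) ∞ (fun p => form p ![X p, Y p, Z p]) U

/-- The Hodge dual `(*A)_{ab} = (1 / 2) e_b^{cd} A_{acd}` of the Cotton tensor. -/
noncomputable def hodgeCotton (g : LorentzMetric M) (e : g.VolumeForm) (p : M)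
    (u v : TangentSpace 𝓘(ℝ, E3) p) : ℝ :=
  1 / 2 * ∑ i, ∑ j, ∑ k, ∑ l, g.inv p i k * g.inv p j l
    * e.form p ![v, frame p i, frame p j] * g.cotton p u (frame p k) (frame p l)

/-- The equations of topological massive gravity,
`R_{ab} - R g_{ab} / 2 + Λ g_{ab} = (1 / m) (*A)_{ab}`. -/
def SolvesTMG (g : LorentzMetric M) (e : g.VolumeForm) (m Λ : ℝ) : Prop :=
  ∀ (p : M) (u v : TangentSpace 𝓘(ℝ, E3) p),
    g.ricci p u v - 1 / 2 * g.scalar p * g.val p u v + Λ * g.val p u v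
      = 1 / m * g.hodgeCotton e p u v

end LorentzMetric

/-- The ten Petrov types in Lorentzian signature; the suffix `r` marks the types all of whose
roots are real. -/
inductive PetrovType
  | G | SG | II | D | Gr | IIr | IIIr | Nr | Dr | O

/-- The linear form `ξ ↦ α_A ξ^A` on `ℂ²`, evaluated at `ξ = (s, t)`. -/
def spinPair (a : ℂ × ℂ) (s t : ℂ) : ℂ := a.1 * s + a.2 * t

/-- Componentwise complex conjugation. -/
def spinConj (a : ℂ × ℂ) : ℂ × ℂ := (starRingEnd ℂ a.1, starRingEnd ℂ a.2)

/-- The linear form has real coefficients. -/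
def SpinReal (a : ℂ × ℂ) : Prop := spinConj a = a

/-- The two linear forms are linearly independent, i.e. have distinct roots in `ℂP¹`. -/
def SpinIndep (a b : ℂ × ℂ) : Prop := a.1 * b.2 - a.2 * b.1 ≠ 0

/-- The root pattern of the binary quartic `Q`, as a factorisation into linear forms with
real coefficients and pairs of complex conjugate linear forms with non-real roots; `c` is a
nonzero real factor. -/
def HasRootType (Q : ℂ → ℂ → ℂ) : PetrovType → Prop
  | .G => ∃ (c : ℝ) (a b : ℂ × ℂ), c ≠ 0 ∧
      SpinIndep a (spinConj a) ∧ SpinIndep b (spinConj b) ∧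
      SpinIndep a b ∧ SpinIndep a (spinConj b) ∧
      ∀ s t, Q s t = c * (spinPair a s t * spinPair (spinConj a) s t
        * spinPair b s t * spinPair (spinConj b) s t)
  | .SG => ∃ (c : ℝ) (a b x : ℂ × ℂ), c ≠ 0 ∧ SpinReal a ∧ SpinReal b ∧
      SpinIndep a b ∧ SpinIndep x (spinConj x) ∧
      ∀ s t, Q s t = c * (spinPair a s t * spinPair b s t
        * spinPair x s t * spinPair (spinConj x) s t)
  | .II => ∃ (c : ℝ) (a x : ℂ × ℂ), c ≠ 0 ∧ SpinReal a ∧ a ≠ 0 ∧ SpinIndep x (spinConj x) ∧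
      ∀ s t, Q s t = c * (spinPair a s t ^ 2 * spinPair x s t * spinPair (spinConj x) s t)
  | .D => ∃ (c : ℝ) (x : ℂ × ℂ), c ≠ 0 ∧ SpinIndep x (spinConj x) ∧
      ∀ s t, Q s t = c * (spinPair x s t ^ 2 * spinPair (spinConj x) s t ^ 2)
  | .Gr => ∃ (c : ℝ) (a₁ a₂ a₃ a₄ : ℂ × ℂ), c ≠ 0 ∧
      SpinReal a₁ ∧ SpinReal a₂ ∧ SpinReal a₃ ∧ SpinReal a₄ ∧
      SpinIndep a₁ a₂ ∧ SpinIndep a₁ a₃ ∧ SpinIndep a₁ a₄ ∧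
      SpinIndep a₂ a₃ ∧ SpinIndep a₂ a₄ ∧ SpinIndep a₃ a₄ ∧
      ∀ s t, Q s t = c * (spinPair a₁ s t * spinPair a₂ s t
        * spinPair a₃ s t * spinPair a₄ s t)
  | .IIr => ∃ (c : ℝ) (a b d : ℂ × ℂ), c ≠ 0 ∧ SpinReal a ∧ SpinReal b ∧ SpinReal d ∧
      SpinIndep a b ∧ SpinIndep a d ∧ SpinIndep b d ∧
      ∀ s t, Q s t = c * (spinPair a s t ^ 2 * spinPair b s t * spinPair d s t)
  | .IIIr => ∃ (c : ℝ) (a b : ℂ × ℂ), c ≠ 0 ∧ SpinReal a ∧ SpinReal b ∧ SpinIndep a b ∧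
      ∀ s t, Q s t = c * (spinPair a s t ^ 3 * spinPair b s t)
  | .Nr => ∃ (c : ℝ) (a : ℂ × ℂ), c ≠ 0 ∧ SpinReal a ∧ a ≠ 0 ∧
      ∀ s t, Q s t = c * spinPair a s t ^ 4
  | .Dr => ∃ (c : ℝ) (a b : ℂ × ℂ), c ≠ 0 ∧ SpinReal a ∧ SpinReal b ∧ SpinIndep a b ∧
      ∀ s t, Q s t = c * (spinPair a s t ^ 2 * spinPair b s t ^ 2)
  | .O => ∀ s t, Q s t = 0

namespace LorentzMetric

variable {M : Type*} [TopologicalSpace M] [ChartedSpace E3 M] [IsManifold 𝓘(ℝ, E3) ∞ M]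

/-- A real null frame at `p`, so that `g_{ab} = 2 k_{(a} l_{b)} + u_a u_b`. -/
structure IsNullFrame (g : LorentzMetric M) (p : M) (k l u : TangentSpace 𝓘(ℝ, E3) p) : Prop where
  kk : g.val p k k = 0
  ll : g.val p l l = 0
  kl : g.val p k l = 1
  ku : g.val p k u = 0
  lu : g.val p l u = 0
  uu : g.val p u u = 1

/-- The binary quartic `(1 / 2) Φ_{ab} ξ^a ξ^b`, where `ξ = s² k + √2 s t u - t² l` runs over all
complex null vectors at `p` as `(s, t)` runs over `ℂ²`. The null direction of `ξ` is real if and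
only if `(s : t)` is. -/
noncomputable def ricciQuartic (g : LorentzMetric M) (p : M)
    (k l u : TangentSpace 𝓘(ℝ, E3) p) (s t : ℂ) : ℂ :=
  1 / 2 * ∑ i : Fin 3, ∑ j : Fin 3,
    ![s ^ 2, (Real.sqrt 2 : ℂ) * s * t, - t ^ 2] i * ![s ^ 2, (Real.sqrt 2 : ℂ) * s * t, - t ^ 2] j
      * (g.tracefreeRicci p (![k, u, l] i) (![k, u, l] j) : ℂ)

/-- The tracefree Ricci tensor is of Petrov type `T` at `p` (the real root pattern does not depend
on the null frame). -/
def HasPetrovType (g : LorentzMetric M) (p : M) (T : PetrovType) : Prop :=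
  ∃ k l u : TangentSpace 𝓘(ℝ, E3) p, g.IsNullFrame p k l u ∧
    HasRootType (g.ricciQuartic p k l u) T

/-- The real null vector `k` spans a multiple principal null direction of `Φ` at `p`:
`k_{[a} Φ_{b]c} k^c = 0`. -/
def IsMultiplePrincipal (g : LorentzMetric M) (p : M) (k : TangentSpace 𝓘(ℝ, E3) p) : Prop :=
  k ≠ 0 ∧ g.val p k k = 0 ∧ ∃ c : ℝ, ∀ w, g.tracefreeRicci p k w = c * g.val p k w

/-- There is a continuous field, on all of `M`, of real multiple principal null directions. -/
def HasMultiplePrincipalLineField (g : LorentzMetric M) : Prop :=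
  ∃ L : ∀ p : M, Submodule ℝ (TangentSpace 𝓘(ℝ, E3) p),
    ∀ p, ∃ V : Set M, IsOpen V ∧ p ∈ V ∧ ∃ k : ∀ q : M, TangentSpace 𝓘(ℝ, E3) q,
      SmoothFieldOn 0 k V ∧ ∀ q ∈ V, L q = Submodule.span ℝ {k q} ∧ g.IsMultiplePrincipal q (k q)

/-- The divergence `∇_a X^a`. -/
noncomputable def divergence (g : LorentzMetric M) (X : ∀ q : M, TangentSpace 𝓘(ℝ, E3) q)
    (p : M) : ℝ :=
  LinearMap.trace ℝ (TangentSpace 𝓘(ℝ, E3) p)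
    (g.leviCivita X p : TangentSpace 𝓘(ℝ, E3) p →ₗ[ℝ] TangentSpace 𝓘(ℝ, E3) p)

/-- `L` is a divergence-free congruence of null geodesics on `U`, given by its field of tangent
lines: locally `L` is spanned by a smooth nowhere vanishing null vector field `k` with
`k^a ∇_b k^b - k^b ∇_b k^a = 0`. -/
def IsKundtCongruence (g : LorentzMetric M) (U : Set M)
    (L : ∀ p : M, Submodule ℝ (TangentSpace 𝓘(ℝ, E3) p)) : Prop :=
  ∀ p ∈ U, ∃ V : Set M, IsOpen V ∧ p ∈ V ∧ V ⊆ U ∧ ∃ k : ∀ q : M, TangentSpace 𝓘(ℝ, E3) q,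
    SmoothFieldOn ∞ k V ∧ ∀ q ∈ V, k q ≠ 0 ∧ L q = Submodule.span ℝ {k q} ∧
      g.val q (k q) (k q) = 0 ∧
      g.divergence k q • k q - g.leviCivita k q (k q) = 0

/-- `L` is a shear-free congruence of timelike geodesics on `U`, given by its field of tangent
lines: locally `L` is spanned by a smooth unit timelike vector field `u` with `u^b ∇_b u^a = 0` and
`∇_{(a} u_{b)} - (1 / 2) h_{ab} ∇^c u_c + (u^c ∇_c u_{(a}) u_{b)} = 0`, where
`h_{ab} = g_{ab} + u_a u_b`. -/
def IsShearFreeTimelikeGeodesicCongruence (g : LorentzMetric M) (U : Set M)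
    (L : ∀ p : M, Submodule ℝ (TangentSpace 𝓘(ℝ, E3) p)) : Prop :=
  ∀ p ∈ U, ∃ V : Set M, IsOpen V ∧ p ∈ V ∧ V ⊆ U ∧ ∃ u : ∀ q : M, TangentSpace 𝓘(ℝ, E3) q,
    SmoothFieldOn ∞ u V ∧ ∀ q ∈ V, L q = Submodule.span ℝ {u q} ∧
      g.val q (u q) (u q) = -1 ∧
      g.leviCivita u q (u q) = 0 ∧
      ∀ v w : TangentSpace 𝓘(ℝ, E3) q,
        1 / 2 * (g.val q (g.leviCivita u q v) w + g.val q (g.leviCivita u q w) v)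
          - 1 / 2 * (g.val q v w + g.val q (u q) v * g.val q (u q) w) * g.divergence u q
          + 1 / 2 * (g.val q (g.leviCivita u q (u q)) v * g.val q (u q) w
            + g.val q (g.leviCivita u q (u q)) w * g.val q (u q) v) = 0

end LorentzMetric

/-! Why the theorem holds. For a null vector `k` and a unit vector `u` orthogonal to it put κ =
g(∇_k k, u) and ρ = g(∇_u k, u). A real null line field is a divergence-free geodesic congruence
exactly when κ = ρ = 0 (`IsOrthoFrame.kundt_iff`). For a unit timelike `n`, completed by orthonormal
`e 0`, `e 1`, take the complex null vector k = e 0 + i e 1 and u = i n; then κ = ρ = 0 says that `n`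
is geodesic and shear-free (`IsOrthoFrame.shearFree_iff`). Both kinds of congruence are thus
instances of one algebraic problem, treated once in `TMGFrame` over a commutative ring, which is
later the ring `smoothC V` of smooth complex functions.

The Hodge dual of the Cotton tensor is tracefree, so the field equations force R = 6Λ and become m Φ
= *A, where *A is a curl of Φ because R is constant.

From congruence to type: if κ = ρ = 0, the Ricci equation contracted with k twice gives Φ(k,k) = 0.
The curl equations then determine the derivatives of Φ₁ = Φ(k,u) along k and along u as multiples of
Φ₁. Comparing them through the commutator [k,u], and using two more Ricci equations, gives 5 Φ₁² = 0
(`TMGFrame.Φ₁_sq_eq_zero`), so k is a multiple principal null direction.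

From type to congruence: if Φ(k,k) = Φ(k,u) = 0, the curl equations give κ · x = ρ · x = 0 for x the
first nonvanishing one among Φ(u,u), Φ(l,u), Φ(l,l), where l is the null partner of k
(`TMGFrame.κ_mul_F₂₂` and its companions). A constant type other than O guarantees that one x serves
on the whole frame domain.

The dictionary between types and principal directions comes from the action of SL(2,ℝ) on null
frames (`IsNullFrame.rotate`): a double real root can be moved to (1:0), where the type is read off
a quadratic (`HasPetrovType.of_isMultiplePrincipal`). For D and D_r the quartic is a constant times
the square of a real quadratic form, so Φ is the tracefree part of a multiple of v ⊗ v with v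
timelike or spacelike (`HasPetrovType.exists_isDoubleEigen`).

The principal lines are smooth because polynomials in the endomorphism Φ project onto them. For II,
II_r, III_r, N_r and D this makes the line field global without further choices. For D_r the two
null lines orthogonal to the simple eigenvector may be interchanged along loops, whence the
assumption of a continuous choice. -/

set_option linter.unusedSectionVars false

namespace LorentzMetric

variable {M : Type*} [TopologicalSpace M] [ChartedSpace E3 M] [IsManifold 𝓘(ℝ, E3) ∞ M]

/-- The real function `f` is smooth on `V`. -/
abbrev SmoothFnOn (f : M → ℝ) (V : Set M) : Prop := ContMDiffOn 𝓘(ℝ, E3) 𝓘(ℝ) ∞ f V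

/-- The derivative of a function along a vector field. -/
noncomputable def lieD (X : ∀ p : M, TangentSpace 𝓘(ℝ, E3) p) (f : M → ℝ) : M → ℝ :=
  fun q => mvfderiv 𝓘(ℝ, E3) f q (X q)

/-- The covariant derivative of a vector field along a vector field. -/
noncomputable def nab (g : LorentzMetric M) (X Y : ∀ p : M, TangentSpace 𝓘(ℝ, E3) p) :
    ∀ p : M, TangentSpace 𝓘(ℝ, E3) p :=
  fun q => g.leviCivita Y q (X q)

/-! ### Smooth functions, vector fields and Lie brackets -/

section smooth

variable {V : Set M} {X Y Z : ∀ p : M, TangentSpace 𝓘(ℝ, E3) p} {f f' : M → ℝ} {q : M}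

lemma SmoothFnOn.mdiffAt (hV : IsOpen V) (hf : SmoothFnOn f V) (hq : q ∈ V) :
    MDifferentiableAt 𝓘(ℝ, E3) 𝓘(ℝ) f q :=
  (hf.contMDiffAt (hV.mem_nhds hq)).mdifferentiableAt (by simp)

lemma _root_.SmoothFieldOn.diffAt (hV : IsOpen V) (hX : SmoothFieldOn ∞ X V) (hq : q ∈ V) :
    DiffFieldAt X q :=
  (hX.contMDiffAt (hV.mem_nhds hq)).mdifferentiableAt (by simp)

lemma _root_.SmoothFieldOn.add (hX : SmoothFieldOn ∞ X V) (hY : SmoothFieldOn ∞ Y V) :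
    SmoothFieldOn ∞ (X + Y) V :=
  ContMDiffOn.add_section hX hY

lemma _root_.SmoothFieldOn.sub (hX : SmoothFieldOn ∞ X V) (hY : SmoothFieldOn ∞ Y V) :
    SmoothFieldOn ∞ (X - Y) V :=
  ContMDiffOn.sub_section hX hY

lemma _root_.SmoothFieldOn.smul (hf : SmoothFnOn f V) (hX : SmoothFieldOn ∞ X V) :
    SmoothFieldOn ∞ (f • X) V :=
  ContMDiffOn.smul_section hf hX

lemma _root_.SmoothFieldOn.const_smul (c : ℝ) (hX : SmoothFieldOn ∞ X V) :
    SmoothFieldOn ∞ (c • X) V :=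
  ContMDiffOn.const_smul_section hX

lemma _root_.SmoothFieldOn.sum {ι : Type*} {s : Finset ι} {X : ι → ∀ p : M, TangentSpace 𝓘(ℝ, E3) p}
    (hX : ∀ i ∈ s, SmoothFieldOn ∞ (X i) V) :
    SmoothFieldOn ∞ (fun q => ∑ i ∈ s, X i q) V :=
  ContMDiffOn.sum_section hX

lemma _root_.SmoothFieldOn.congr (hX : SmoothFieldOn ∞ X V) (h : ∀ q ∈ V, Y q = X q) :
    SmoothFieldOn ∞ Y V :=
  ContMDiffOn.congr hX fun q hq => by rw [h q hq]

lemma smoothFnOn_val (g : LorentzMetric M) (hX : SmoothFieldOn ∞ X V)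
    (hY : SmoothFieldOn ∞ Y V) : SmoothFnOn (fun q => g.val q (X q) (Y q)) V := by
  have : ContMDiffOn 𝓘(ℝ, E3) (𝓘(ℝ, E3).prod 𝓘(ℝ)) ∞
      (fun m ↦ TotalSpace.mk' ℝ (E := Bundle.Trivial M ℝ) m (g.val m (X m) (Y m))) V := by
    apply ContMDiffOn.clm_bundle_apply₂ (F₁ := E3) (F₂ := E3)
    · exact g.contMDiff.contMDiffOn
    · exact hX
    · exact hY
  intro x hx
  have := this x hx
  rw [contMDiffWithinAt_totalSpace] at this
  exact this.2

/-- The derivative is the fibre component of the tangent map of `f` composed with the section `X`.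
-/
lemma smoothFnOn_lieD (hV : IsOpen V) (hX : SmoothFieldOn ∞ X V) (hf : SmoothFnOn f V) :
    SmoothFnOn (lieD X f) V := by
  have h1 : ContMDiffOn (𝓘(ℝ, E3)).tangent (𝓘(ℝ)).tangent ∞
      (tangentMapWithin 𝓘(ℝ, E3) 𝓘(ℝ) f V) (TotalSpace.proj ⁻¹' V) :=
    hf.contMDiffOn_tangentMapWithin (by simp) hV.uniqueMDiffOn
  have h2 := h1.comp hX (fun q hq => hq)
  have h3 := (contMDiff_snd_tangentBundle_modelSpace ℝ 𝓘(ℝ) (n := ∞)).comp_contMDiffOn h2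
  refine h3.congr fun q hq => ?_
  simp only [lieD, mvfderiv, Function.comp, tangentMapWithin, mfderivWithin_of_isOpen hV hq]
  rfl

lemma smoothFieldOn_mlieBracket (hV : IsOpen V) (hX : SmoothFieldOn ∞ X V)
    (hY : SmoothFieldOn ∞ Y V) : SmoothFieldOn ∞ (mlieBracket 𝓘(ℝ, E3) X Y) V := by
  intro q hq
  have : IsManifold 𝓘(ℝ, E3) (minSmoothness ℝ 2) M := by
    simp only [minSmoothness_of_isRCLikeNormedField]; exact IsManifold.of_le (n := ∞) (by norm_cast)
  have : IsManifold 𝓘(ℝ, E3) (((⊤ : ℕ∞) : WithTop ℕ∞) + 1) M := by simpa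
  exact (ContMDiffAt.mlieBracket_vectorField (m := ⊤) (n := ⊤) (hX.contMDiffAt (hV.mem_nhds hq))
    (hY.contMDiffAt (hV.mem_nhds hq)) (by simp)).contMDiffWithinAt

lemma exists_smoothFieldOn_extend (p : M) (v : TangentSpace 𝓘(ℝ, E3) p) :
    ∃ W : Set M, IsOpen W ∧ p ∈ W ∧
      SmoothFieldOn ∞ (extend E3 v : ∀ q : M, TangentSpace 𝓘(ℝ, E3) q) W := by
  obtain ⟨s, hs, h⟩ := exists_contMDiffOn_extend (k := ∞) 𝓘(ℝ, E3) E3 v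
  obtain ⟨W, hWs, hW, hp⟩ := mem_nhds_iff.1 hs
  exact ⟨W, hW, hp, h.mono hWs⟩

lemma lieD_congr (hV : IsOpen V) (h : ∀ q ∈ V, f q = f' q) (hq : q ∈ V) :
    lieD X f q = lieD X f' q := by
  have : f =ᶠ[𝓝 q] f' := Filter.eventuallyEq_of_mem (hV.mem_nhds hq) h
  simp only [lieD, mvfderiv]
  rw [this.mfderiv_eq]
  rfl

lemma mlieBracket_smul_right_on (hV : IsOpen V) (hY : SmoothFieldOn ∞ Y V) (hf : SmoothFnOn f V)
    (hq : q ∈ V) : mlieBracket 𝓘(ℝ, E3) X (f • Y) q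
      = (lieD X f • Y + f • mlieBracket 𝓘(ℝ, E3) X Y) q := by
  rw [mlieBracket_smul_right (hf.mdiffAt hV hq) (hY.diffAt hV hq)]
  rfl

lemma mlieBracket_congr_on (hV : IsOpen V) {X' Y' : ∀ p : M, TangentSpace 𝓘(ℝ, E3) p}
    (hX : ∀ q ∈ V, X q = X' q) (hY : ∀ q ∈ V, Y q = Y' q) (hq : q ∈ V) :
    mlieBracket 𝓘(ℝ, E3) X Y q = mlieBracket 𝓘(ℝ, E3) X' Y' q :=
  Filter.EventuallyEq.mlieBracket_vectorField_eq
    (Filter.eventuallyEq_of_mem (hV.mem_nhds hq) hX)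
    (Filter.eventuallyEq_of_mem (hV.mem_nhds hq) hY)

lemma mlieBracket_jacobi (hV : IsOpen V) (hX : SmoothFieldOn ∞ X V) (hY : SmoothFieldOn ∞ Y V)
    (hZ : SmoothFieldOn ∞ Z V) (hq : q ∈ V) :
    mlieBracket 𝓘(ℝ, E3) X (mlieBracket 𝓘(ℝ, E3) Y Z) q
      = mlieBracket 𝓘(ℝ, E3) (mlieBracket 𝓘(ℝ, E3) X Y) Z q
        + mlieBracket 𝓘(ℝ, E3) Y (mlieBracket 𝓘(ℝ, E3) X Z) q := by
  have : IsManifold 𝓘(ℝ, E3) (minSmoothness ℝ 3) M := by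
    simp only [minSmoothness_of_isRCLikeNormedField]; exact IsManifold.of_le (n := ∞) (by norm_cast)
  have h : (minSmoothness ℝ 2) ≤ (∞ : WithTop ℕ∞) := by
    simp only [minSmoothness_of_isRCLikeNormedField]; norm_cast
  exact leibniz_identity_mlieBracket_apply ((hX.contMDiffAt (hV.mem_nhds hq)).of_le h)
    ((hY.contMDiffAt (hV.mem_nhds hq)).of_le h) ((hZ.contMDiffAt (hV.mem_nhds hq)).of_le h)

/-- The commutator of the derivatives along two vector fields is the derivative along their
Lie bracket. -/
lemma lieD_commutator (hV : IsOpen V) (hX : SmoothFieldOn ∞ X V) (hY : SmoothFieldOn ∞ Y V)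
    (hf : SmoothFnOn f V) (hq : q ∈ V) :
    lieD X (lieD Y f) q - lieD Y (lieD X f) q = lieD (mlieBracket 𝓘(ℝ, E3) X Y) f q := by
  -- The Jacobi identity for `X`, `Y`, `f • Z`, compared with the one for `X`, `Y`, `Z`, leaves the
  -- desired difference as the coefficient of `Z`. Hence `Z` must not vanish at `q`.
  obtain ⟨v, hv⟩ : ∃ v : TangentSpace 𝓘(ℝ, E3) q, v ≠ 0 := exists_ne (α := E3) 0
  obtain ⟨W, hW, hqW, hZ⟩ := exists_smoothFieldOn_extend q v
  set Z : ∀ q : M, TangentSpace 𝓘(ℝ, E3) q := extend E3 v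
  have hN := hV.inter hW
  have hqN : q ∈ V ∩ W := ⟨hq, hqW⟩
  replace hX := hX.mono (Set.inter_subset_left (t := W))
  replace hY := hY.mono (Set.inter_subset_left (t := W))
  replace hf := hf.mono (Set.inter_subset_left (t := W))
  replace hZ := hZ.mono (Set.inter_subset_right (s := V))
  have key : ∀ A B : ∀ p : M, TangentSpace 𝓘(ℝ, E3) p, SmoothFieldOn ∞ A (V ∩ W) →
      SmoothFieldOn ∞ B (V ∩ W) →
      mlieBracket 𝓘(ℝ, E3) A (mlieBracket 𝓘(ℝ, E3) B (f • Z)) q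
        = lieD A (lieD B f) q • Z q + lieD B f q • mlieBracket 𝓘(ℝ, E3) A Z q
          + lieD A f q • mlieBracket 𝓘(ℝ, E3) B Z q
          + f q • mlieBracket 𝓘(ℝ, E3) A (mlieBracket 𝓘(ℝ, E3) B Z) q := by
    intro A B hA hB
    have sBf := smoothFnOn_lieD hN hB hf
    have sBZ := smoothFieldOn_mlieBracket hN hB hZ
    rw [mlieBracket_congr_on hN (fun _ _ => rfl)
      (fun r hr => mlieBracket_smul_right_on (X := B) hN hZ hf hr) hqN,
      mlieBracket_add_right ((SmoothFieldOn.smul sBf hZ).diffAt hN hqN)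
        ((SmoothFieldOn.smul hf sBZ).diffAt hN hqN),
      mlieBracket_smul_right_on hN hZ sBf hqN, mlieBracket_smul_right_on hN sBZ hf hqN]
    simp only [Pi.add_apply, Pi.smul_apply']
    abel
  have h1 := mlieBracket_jacobi hN hX hY (SmoothFieldOn.smul hf hZ) hqN
  have h2 := mlieBracket_jacobi hN hX hY hZ hqN
  rw [key X Y hX hY, key Y X hY hX, mlieBracket_smul_right_on hN hZ hf hqN, h2] at h1
  simp only [Pi.add_apply, Pi.smul_apply', smul_add] at h1
  have h3 : (lieD X (lieD Y f) q - lieD Y (lieD X f) q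
      - lieD (mlieBracket 𝓘(ℝ, E3) X Y) f q) • Z q = 0 := by
    rw [← sub_eq_zero] at h1
    rw [← h1]; module
  have hZq : Z q ≠ 0 := by simpa [Z] using hv
  have := (smul_eq_zero.1 h3).resolve_right hZq
  linarith

end smooth

/-! ### Orthonormal triples at a point -/

section algebra

/-- A triple of tangent vectors which is orthonormal with signs `ε`. -/
def IsOrthoTriple (g : LorentzMetric M) (p : M) (ε : Fin 3 → ℝ)
    (b : Fin 3 → TangentSpace 𝓘(ℝ, E3) p) : Prop :=
  (∀ i, ε i ^ 2 = 1) ∧ ∀ i j, g.val p (b i) (b j) = if i = j then ε i else 0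

variable {g : LorentzMetric M} {p : M} {ε : Fin 3 → ℝ} {b : Fin 3 → TangentSpace 𝓘(ℝ, E3) p}

/-- The basis formed by an orthonormal triple. -/
noncomputable def IsOrthoTriple.basis (hb : g.IsOrthoTriple p ε b) :
    Basis (Fin 3) ℝ (TangentSpace 𝓘(ℝ, E3) p) :=
  basisOfLinearIndependentOfCardEqFinrank (b := b)
    (by
      rw [Fintype.linearIndependent_iff]
      intro c hc i
      have := congrArg (fun v => g.val p v (b i)) hc
      simp only [map_sum, map_smul, _root_.sum_apply, _root_.smul_apply, hb.2, map_zero,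
        _root_.zero_apply, smul_eq_mul, mul_ite, mul_zero, Finset.sum_ite_eq',
        Finset.mem_univ, if_true] at this
      have h1 := hb.1 i
      rcases mul_eq_zero.1 this with h | h
      · exact h
      · simp [h] at h1)
    (by
      have : finrank ℝ (TangentSpace 𝓘(ℝ, E3) p) = finrank ℝ E3 := rfl
      rw [this]; simp)

@[simp]
lemma IsOrthoTriple.basis_apply (hb : g.IsOrthoTriple p ε b) (i : Fin 3) : hb.basis i = b i := by
  simp [IsOrthoTriple.basis]

lemma IsOrthoTriple.repr (hb : g.IsOrthoTriple p ε b) (v : TangentSpace 𝓘(ℝ, E3) p) (i : Fin 3) :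
    hb.basis.repr v i = ε i * g.val p v (b i) := by
  have h : g.val p v (b i) = hb.basis.repr v i * ε i := by
    conv_lhs => rw [← hb.basis.sum_repr v]
    simp [hb.2]
  have h1 := hb.1 i
  rw [h]; linear_combination (-hb.basis.repr v i) * h1

lemma IsOrthoTriple.sum_val (hb : g.IsOrthoTriple p ε b) (v : TangentSpace 𝓘(ℝ, E3) p) :
    ∑ i, (ε i * g.val p v (b i)) • b i = v := by
  conv_rhs => rw [← hb.basis.sum_repr v]
  simp [hb.repr]

lemma IsOrthoTriple.val_eq (hb : g.IsOrthoTriple p ε b) (v w : TangentSpace 𝓘(ℝ, E3) p) :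
    g.val p v w = ∑ i, ε i * g.val p v (b i) * g.val p w (b i) := by
  conv_lhs => rw [← hb.sum_val w]
  simp only [map_sum, map_smul, smul_eq_mul]
  exact Finset.sum_congr rfl fun i _ => by ring

lemma IsOrthoTriple.ext (hb : g.IsOrthoTriple p ε b) {v w : TangentSpace 𝓘(ℝ, E3) p}
    (h : ∀ i, g.val p v (b i) = g.val p w (b i)) : v = w := by
  rw [← hb.sum_val v, ← hb.sum_val w]; simp [h]

lemma exists_isOrthoTriple (g : LorentzMetric M) (p : M) :
    ∃ b, g.IsOrthoTriple p ![1, 1, -1] b := by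
  obtain ⟨e, he⟩ := g.signature p
  refine ⟨e, fun i => by fin_cases i <;> simp, fun i j => ?_⟩
  rw [he, Matrix.diagonal_apply]

end algebra

/-! ### Smooth orthonormal frames by Gram–Schmidt -/

section gramSchmidt

/-- A field of orthonormal triples, smooth on the open set `V`. -/
structure IsOrthoFrame (g : LorentzMetric M) (V : Set M) (ε : Fin 3 → ℝ)
    (e : Fin 3 → ∀ p : M, TangentSpace 𝓘(ℝ, E3) p) : Prop where
  isOpen : IsOpen V
  smooth : ∀ i, SmoothFieldOn ∞ (e i) V
  ortho : ∀ q ∈ V, g.IsOrthoTriple q ε (fun i => e i q)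

variable {g : LorentzMetric M} {V : Set M} {X Y Z : ∀ p : M, TangentSpace 𝓘(ℝ, E3) p} {p : M}
  {ε : Fin 3 → ℝ} {e : Fin 3 → ∀ p : M, TangentSpace 𝓘(ℝ, E3) p}

lemma IsOrthoFrame.mono (he : g.IsOrthoFrame V ε e) {W : Set M} (hW : IsOpen W) (hWV : W ⊆ V) :
    g.IsOrthoFrame W ε e :=
  ⟨hW, fun i => (he.smooth i).mono hWV, fun q hq => he.ortho q (hWV hq)⟩

/-- The factor is (σ g(Y,Y))^(-1/2). The last clause makes the orthonormalisation leave alone those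
fields that are already normalised. -/
lemma exists_normalised (g : LorentzMetric M) (hV : IsOpen V) (hY : SmoothFieldOn ∞ Y V)
    (hp : p ∈ V) {σ : ℝ} (hσ : σ ^ 2 = 1) (hYp : 0 < σ * g.val p (Y p) (Y p)) :
    ∃ W ⊆ V, IsOpen W ∧ p ∈ W ∧ ∃ f : M → ℝ, SmoothFnOn f W ∧
      ∀ q ∈ W, 0 < f q ∧ g.val q ((f • Y) q) ((f • Y) q) = σ ∧
        (g.val q (Y q) (Y q) = σ → f q = 1) := by
  have hs := smoothFnOn_val g hY hY
  have hs' : SmoothFnOn (fun q => σ * g.val q (Y q) (Y q)) V := contMDiffOn_const.mul hs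
  refine ⟨V ∩ {q | 0 < σ * g.val q (Y q) (Y q)}, Set.inter_subset_left,
    hs'.continuousOn.isOpen_inter_preimage hV isOpen_Ioi, ⟨hp, hYp⟩,
    fun q => (Real.sqrt (σ * g.val q (Y q) (Y q)))⁻¹, ?_, ?_⟩
  · intro q hq
    have h1 : ContMDiffAt 𝓘(ℝ) 𝓘(ℝ) ∞ (fun x : ℝ => (Real.sqrt x)⁻¹)
        (σ * g.val q (Y q) (Y q)) :=
      ((Real.contDiffAt_sqrt (ne_of_gt hq.2)).inv
        (Real.sqrt_ne_zero'.2 hq.2)).contMDiffAt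
    exact h1.comp_contMDiffWithinAt (f := fun q => σ * g.val q (Y q) (Y q)) q
      ((hs' q hq.1).mono Set.inter_subset_left)
  · intro q hq
    have h0 : 0 < σ * g.val q (Y q) (Y q) := hq.2
    refine ⟨inv_pos.2 (Real.sqrt_pos.2 h0), ?_, fun h => ?_⟩
    · simp only [Pi.smul_apply', map_smul, _root_.smul_apply, smul_eq_mul]
      have h1 : (Real.sqrt (σ * g.val q (Y q) (Y q))) ^ 2 = σ * g.val q (Y q) (Y q) :=
        Real.sq_sqrt h0.le
      have h2 := (Real.sqrt_pos.2 h0).ne'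
      set r := Real.sqrt (σ * g.val q (Y q) (Y q))
      field_simp
      rw [h1]; linear_combination (-g.val q (Y q) (Y q)) * hσ
    · have : σ * g.val q (Y q) (Y q) = 1 := by rw [h]; linarith
      simp [this]

/-- The orthonormalisation of three vector fields which are orthonormal at `p`. -/
lemma exists_isOrthoFrame (g : LorentzMetric M) (hV : IsOpen V) (hp : p ∈ V)
    {X : Fin 3 → ∀ p : M, TangentSpace 𝓘(ℝ, E3) p} (hX : ∀ i, SmoothFieldOn ∞ (X i) V)
    (hXp : g.IsOrthoTriple p ε (fun i => X i p)) :
    ∃ W ⊆ V, p ∈ W ∧ ∃ e, g.IsOrthoFrame W ε e ∧ (∀ i, e i p = X i p) ∧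
      ∀ q ∈ W, g.val q (X 0 q) (X 0 q) = ε 0 → (e 0 q = X 0 q ∧
        (g.val q (X 1 q) (X 1 q) = ε 1 → g.val q (X 1 q) (X 0 q) = 0 → e 1 q = X 1 q)) := by
  have hε := hXp.1
  have hXX := hXp.2
  have hpos : ∀ i, 0 < ε i * g.val p (X i p) (X i p) := fun i => by
    have h1 := hXX i i
    simp only [if_true] at h1
    rw [h1]; nlinarith [hε i]
  obtain ⟨W0, hW0V, hW0, hp0, f0, hf0, h0⟩ := exists_normalised g hV (hX 0) hp (hε 0) (hpos 0)
  set e0 := f0 • X 0 with he0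
  have se0 : SmoothFieldOn ∞ e0 W0 := SmoothFieldOn.smul hf0 ((hX 0).mono hW0V)
  have e0p : e0 p = X 0 p := by
    have := (h0 p hp0).2.2 (by simpa using hXX 0 0)
    simp [he0, this]
  set Y1 := X 1 - (fun q => ε 0 * g.val q (X 1 q) (e0 q)) • e0 with hY1
  have sY1 : SmoothFieldOn ∞ Y1 W0 :=
    SmoothFieldOn.sub ((hX 1).mono hW0V) (SmoothFieldOn.smul
      (contMDiffOn_const.mul (smoothFnOn_val g ((hX 1).mono hW0V) se0)) se0)
  have Y1p : Y1 p = X 1 p := by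
    have := hXX 1 0
    simp at this
    simp [hY1, e0p, this]
  obtain ⟨W1, hW1V, hW1, hp1, f1, hf1, h1⟩ := exists_normalised g hW0 sY1 hp0 (hε 1)
    (by rw [Y1p]; exact hpos 1)
  set e1 := f1 • Y1 with he1
  have se1 : SmoothFieldOn ∞ e1 W1 := SmoothFieldOn.smul hf1 (sY1.mono hW1V)
  have e1p : e1 p = X 1 p := by
    have := (h1 p hp1).2.2 (by rw [Y1p]; simpa using hXX 1 1)
    simp [he1, this, Y1p]
  set Y2 := X 2 - (fun q => ε 0 * g.val q (X 2 q) (e0 q)) • e0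
    - (fun q => ε 1 * g.val q (X 2 q) (e1 q)) • e1 with hY2
  have sX2 := ((hX 2).mono hW0V).mono hW1V
  have sY2 : SmoothFieldOn ∞ Y2 W1 :=
    SmoothFieldOn.sub (SmoothFieldOn.sub sX2 (SmoothFieldOn.smul
      (contMDiffOn_const.mul (smoothFnOn_val g sX2 (se0.mono hW1V))) (se0.mono hW1V)))
      (SmoothFieldOn.smul (contMDiffOn_const.mul (smoothFnOn_val g sX2 se1)) se1)
  have Y2p : Y2 p = X 2 p := by
    have a := hXX 2 0
    have b := hXX 2 1
    simp at a b
    simp [hY2, e0p, e1p, a, b]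
  obtain ⟨W2, hW2V, hW2, hp2, f2, hf2, h2⟩ := exists_normalised g hW1 sY2 hp1 (hε 2)
    (by rw [Y2p]; exact hpos 2)
  set e2 := f2 • Y2 with he2
  have se2 : SmoothFieldOn ∞ e2 W2 := SmoothFieldOn.smul hf2 (sY2.mono hW2V)
  have e2p : e2 p = X 2 p := by
    have := (h2 p hp2).2.2 (by rw [Y2p]; simpa using hXX 2 2)
    simp [he2, this, Y2p]
  refine ⟨W2, (hW2V.trans hW1V).trans hW0V, hp2, ![e0, e1, e2], ⟨hW2, ?_, ?_⟩, ?_, ?_⟩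
  · intro i
    fin_cases i
    · exact (se0.mono hW1V).mono hW2V
    · exact se1.mono hW2V
    · exact se2
  · intro q hq
    have q1 := hW2V hq
    have q0 := hW1V q1
    have n0 : g.val q (e0 q) (e0 q) = ε 0 := (h0 q q0).2.1
    have n1 : g.val q (e1 q) (e1 q) = ε 1 := (h1 q q1).2.1
    have n2 : g.val q (e2 q) (e2 q) = ε 2 := (h2 q hq).2.1
    have o10 : g.val q (e1 q) (e0 q) = 0 := by
      have : g.val q (Y1 q) (e0 q) = 0 := by
        simp only [hY1, Pi.sub_apply, Pi.smul_apply', map_sub, map_smul, _root_.sub_apply,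
          _root_.smul_apply, smul_eq_mul, n0]
        linear_combination (-g.val q (X 1 q) (e0 q)) * hε 0
      simp [he1, this]
    have o01 : g.val q (e0 q) (e1 q) = 0 := by rw [g.symm]; exact o10
    have o20 : g.val q (e2 q) (e0 q) = 0 := by
      have : g.val q (Y2 q) (e0 q) = 0 := by
        simp only [hY2, Pi.sub_apply, Pi.smul_apply', map_sub, map_smul, _root_.sub_apply,
          _root_.smul_apply, smul_eq_mul, n0, o10]
        linear_combination (-g.val q (X 2 q) (e0 q)) * hε 0
      simp [he2, this]
    have o02 : g.val q (e0 q) (e2 q) = 0 := by rw [g.symm]; exact o20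
    have o21 : g.val q (e2 q) (e1 q) = 0 := by
      have : g.val q (Y2 q) (e1 q) = 0 := by
        simp only [hY2, Pi.sub_apply, Pi.smul_apply', map_sub, map_smul, _root_.sub_apply,
          _root_.smul_apply, smul_eq_mul, n1, o01]
        linear_combination (-g.val q (X 2 q) (e1 q)) * hε 1
      simp [he2, this]
    have o12 : g.val q (e1 q) (e2 q) = 0 := by rw [g.symm]; exact o21
    exact ⟨hε, fun i j => match i, j with
      | 0, 0 => n0 | 0, 1 => o01 | 0, 2 => o02
      | 1, 0 => o10 | 1, 1 => n1 | 1, 2 => o12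
      | 2, 0 => o20 | 2, 1 => o21 | 2, 2 => n2⟩
  · intro i
    fin_cases i
    · exact e0p
    · exact e1p
    · exact e2p
  -- Where the first two fields are already orthonormal the process changes nothing, so a prescribed
  -- field survives as a member of the frame on a whole neighbourhood.
  · intro q hq a
    have q1 := hW2V hq
    have q0 := hW1V q1
    have b : e0 q = X 0 q := by simp [he0, (h0 q q0).2.2 a]
    refine ⟨b, fun c d => ?_⟩
    have c' : Y1 q = X 1 q := by simp [hY1, b, d]
    have : f1 q = 1 := (h1 q q1).2.2 (by rw [c']; exact c)
    change e1 q = X 1 q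
    simp [he1, this, c']

/-- A neighbourhood of `p` carries an orthonormal frame prolonging a given one at `p`. -/
lemma exists_isOrthoFrame_extend (g : LorentzMetric M)
    {b : Fin 3 → TangentSpace 𝓘(ℝ, E3) p} (hb : g.IsOrthoTriple p ε b) :
    ∃ W, p ∈ W ∧ ∃ e, g.IsOrthoFrame W ε e ∧ ∀ i, e i p = b i := by
  choose W hW hp hs using fun i => exists_smoothFieldOn_extend p (b i)
  obtain ⟨V, -, hpV, e, he, h, -⟩ := exists_isOrthoFrame (ε := ε) (V := W 0 ∩ W 1 ∩ W 2) (p := p) g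
    (((hW 0).inter (hW 1)).inter (hW 2)) ⟨⟨hp 0, hp 1⟩, hp 2⟩
    (X := fun i => extend E3 (b i)) (fun i => (hs i).mono (by
      fin_cases i
      · exact fun q hq => hq.1.1
      · exact fun q hq => hq.1.2
      · exact fun q hq => hq.2))
    (by simpa using hb)
  exact ⟨V, hpV, e, he, fun i => by rw [h]; simp⟩

end gramSchmidt

/-! ### Derivation rules and the Levi-Civita connection on smooth fields -/

section lieD

variable {V : Set M} {X Y Z : ∀ p : M, TangentSpace 𝓘(ℝ, E3) p} {f f' : M → ℝ} {q : M}

lemma lieD_add (hV : IsOpen V) (hf : SmoothFnOn f V) (hf' : SmoothFnOn f' V) (hq : q ∈ V) :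
    lieD X (fun q => f q + f' q) q = lieD X f q + lieD X f' q := by
  simp only [lieD]
  rw [mvfderiv_fun_add (hf.mdiffAt hV hq) (hf'.mdiffAt hV hq)]
  rfl

lemma lieD_mul (hV : IsOpen V) (hf : SmoothFnOn f V) (hf' : SmoothFnOn f' V) (hq : q ∈ V) :
    lieD X (fun q => f q * f' q) q = f q * lieD X f' q + lieD X f q * f' q := by
  simp only [lieD]
  rw [mvfderiv_fun_mul (hf.mdiffAt hV hq) (hf'.mdiffAt hV hq)]
  simp
  ring

lemma lieD_const (c : ℝ) : lieD X (fun _ => c) q = 0 := by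
  simp [lieD, mvfderiv_const]

end lieD

section nab

variable {g : LorentzMetric M} {V : Set M} {X Y Z : ∀ p : M, TangentSpace 𝓘(ℝ, E3) p} {f f' : M → ℝ} {q : M}

lemma nab_add_left : g.nab (X + Y) Z = g.nab X Z + g.nab Y Z := by
  funext q; simp [nab]

lemma nab_smul_left : g.nab (f • X) Z = f • g.nab X Z := by
  funext q; simp [nab]

lemma nab_add_right (hV : IsOpen V) (hY : SmoothFieldOn ∞ Y V) (hZ : SmoothFieldOn ∞ Z V)
    (hq : q ∈ V) : g.nab X (Y + Z) q = g.nab X Y q + g.nab X Z q := by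
  simp only [nab]
  rw [g.leviCivita.isCovariantDerivativeOnUniv.add (hY.diffAt hV hq) (hZ.diffAt hV hq)]
  rfl

lemma leviCivita_smul (hY : DiffFieldAt Y q) (hf : MDifferentiableAt 𝓘(ℝ, E3) 𝓘(ℝ) f q)
    (v : TangentSpace 𝓘(ℝ, E3) q) : g.leviCivita (f • Y) q v
      = f q • g.leviCivita Y q v + mvfderiv 𝓘(ℝ, E3) f q v • Y q := by
  rw [g.leviCivita.isCovariantDerivativeOnUniv.leibniz hY hf]
  simp

lemma nab_smul_right (hV : IsOpen V) (hY : SmoothFieldOn ∞ Y V) (hf : SmoothFnOn f V)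
    (hq : q ∈ V) : g.nab X (f • Y) q = f q • g.nab X Y q + lieD X f q • Y q :=
  leviCivita_smul (hY.diffAt hV hq) (hf.mdiffAt hV hq) _

lemma leviCivita_congr (hV : IsOpen V) {Y' : ∀ p : M, TangentSpace 𝓘(ℝ, E3) p}
    (hY : DiffFieldAt Y q) (hY' : DiffFieldAt Y' q) (h : ∀ q ∈ V, Y q = Y' q)
    (hq : q ∈ V) : g.leviCivita Y q = g.leviCivita Y' q :=
  g.leviCivita.isCovariantDerivativeOnUniv.congr_of_eventuallyEq hY hY' Filter.univ_mem
    (Filter.eventuallyEq_of_mem (hV.mem_nhds hq) h)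

lemma nab_metric (hV : IsOpen V) (hX : SmoothFieldOn ∞ X V) (hY : SmoothFieldOn ∞ Y V)
    (hZ : SmoothFieldOn ∞ Z V) (hq : q ∈ V) :
    lieD X (fun q => g.val q (Y q) (Z q)) q
      = g.val q (g.nab X Y q) (Z q) + g.val q (Y q) (g.nab X Z q) :=
  g.leviCivita_metric (hX.diffAt hV hq) (hY.diffAt hV hq) (hZ.diffAt hV hq)

lemma nab_torsion (hV : IsOpen V) (hX : SmoothFieldOn ∞ X V) (hY : SmoothFieldOn ∞ Y V)
    (hq : q ∈ V) : mlieBracket 𝓘(ℝ, E3) X Y q = g.nab X Y q - g.nab Y X q :=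
  (g.leviCivita_torsion (hX.diffAt hV hq) (hY.diffAt hV hq)).symm

/-- A vector field is smooth if its products with the members of a smooth frame are. -/
lemma IsOrthoFrame.smoothFieldOn {ε : Fin 3 → ℝ} {e : Fin 3 → ∀ p : M, TangentSpace 𝓘(ℝ, E3) p}
    (he : g.IsOrthoFrame V ε e) (h : ∀ i, SmoothFnOn (fun q => g.val q (X q) (e i q)) V) :
    SmoothFieldOn ∞ X V := by
  have : SmoothFieldOn ∞ (fun q => ∑ i, ((fun q => ε i * g.val q (X q) (e i q)) • e i) q) V :=
    SmoothFieldOn.sum fun i _ => SmoothFieldOn.smul (contMDiffOn_const.mul (h i)) (he.smooth i)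
  exact this.congr fun q hq => ((he.ortho q hq).sum_val (X q)).symm

lemma smoothFieldOn_of_local (h : ∀ q ∈ V, ∃ W, IsOpen W ∧ q ∈ W ∧ SmoothFieldOn ∞ X W) :
    SmoothFieldOn ∞ X V := by
  intro q hq
  obtain ⟨W, hW, hqW, hs⟩ := h q hq
  exact (hs.contMDiffAt (hW.mem_nhds hqW)).contMDiffWithinAt

/-- By the Koszul formula the products of `∇_X Y` with the members of a smooth frame are built from
derivatives of smooth functions and from Lie brackets. -/
lemma smoothFieldOn_nab (g : LorentzMetric M) (hV : IsOpen V) (hX : SmoothFieldOn ∞ X V)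
    (hY : SmoothFieldOn ∞ Y V) : SmoothFieldOn ∞ (g.nab X Y) V := by
  apply smoothFieldOn_of_local
  intro q hq
  obtain ⟨b, hb⟩ := g.exists_isOrthoTriple q
  obtain ⟨W, hqW, e, he, -⟩ := exists_isOrthoFrame_extend g hb
  have hN := hV.inter he.isOpen
  refine ⟨V ∩ W, hN, ⟨hq, hqW⟩, ?_⟩
  have he' := he.mono hN Set.inter_subset_right
  apply he'.smoothFieldOn
  intro i
  replace hX := hX.mono (Set.inter_subset_left (t := W))
  replace hY := hY.mono (Set.inter_subset_left (t := W))
  have hZ := he'.smooth i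
  have h1 := smoothFnOn_lieD hN hX (smoothFnOn_val g hY hZ)
  have h2 := smoothFnOn_lieD hN hY (smoothFnOn_val g hX hZ)
  have h3 := smoothFnOn_lieD hN hZ (smoothFnOn_val g hX hY)
  have h4 := smoothFnOn_val g (smoothFieldOn_mlieBracket hN hX hY) hZ
  have h5 := smoothFnOn_val g (smoothFieldOn_mlieBracket hN hX hZ) hY
  have h6 := smoothFnOn_val g (smoothFieldOn_mlieBracket hN hY hZ) hX
  have h7 := (contMDiffOn_const (c := (1 / 2 : ℝ))).mul
    (((((h1.add h2).sub h3).add h4).sub h5).sub h6)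
  refine h7.congr fun r hr => ?_
  have := g.leviCivitaFun_spec (SmoothFieldOn.diffAt hN hX hr)
    (SmoothFieldOn.diffAt hN hY hr) (SmoothFieldOn.diffAt hN hZ hr)
  simp only [koszul] at this
  change g.val r (g.leviCivitaFun Y r (X r)) (e i r) = 1 / 2 * (lieD X _ r + lieD Y _ r
    - lieD (e i) _ r + _ - _ - _)
  simp only [lieD]
  linarith

end nab

/-! ### The curvature operator on vector fields -/

section curv

variable {g : LorentzMetric M} {V : Set M} {X Y Z W X' Y' Z' : ∀ p : M, TangentSpace 𝓘(ℝ, E3) p}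
  {f f' : M → ℝ} {q : M}

/-- The curvature operator on vector fields. -/
noncomputable def curv (g : LorentzMetric M) (X Y Z : ∀ p : M, TangentSpace 𝓘(ℝ, E3) p) :
    ∀ p : M, TangentSpace 𝓘(ℝ, E3) p :=
  g.nab X (g.nab Y Z) - g.nab Y (g.nab X Z) - g.nab (mlieBracket 𝓘(ℝ, E3) X Y) Z

lemma smoothFieldOn_curv (hV : IsOpen V) (hX : SmoothFieldOn ∞ X V) (hY : SmoothFieldOn ∞ Y V)
    (hZ : SmoothFieldOn ∞ Z V) : SmoothFieldOn ∞ (g.curv X Y Z) V :=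
  SmoothFieldOn.sub (SmoothFieldOn.sub (smoothFieldOn_nab g hV hX (smoothFieldOn_nab g hV hY hZ))
    (smoothFieldOn_nab g hV hY (smoothFieldOn_nab g hV hX hZ)))
    (smoothFieldOn_nab g hV (smoothFieldOn_mlieBracket hV hX hY) hZ)

lemma curv_swap : g.curv X Y Z q = - g.curv Y X Z q := by
  simp only [curv, Pi.sub_apply]
  rw [mlieBracket_swap]
  simp only [nab, Pi.neg_apply, map_neg]
  abel

/-- Metric compatibility of the curvature. -/
lemma val_curv_swap (hV : IsOpen V) (hX : SmoothFieldOn ∞ X V) (hY : SmoothFieldOn ∞ Y V)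
    (hZ : SmoothFieldOn ∞ Z V) (hW : SmoothFieldOn ∞ W V) (hq : q ∈ V) :
    g.val q (g.curv X Y Z q) (W q) = - g.val q (Z q) (g.curv X Y W q) := by
  have key : ∀ A B : ∀ p : M, TangentSpace 𝓘(ℝ, E3) p, SmoothFieldOn ∞ A V →
      SmoothFieldOn ∞ B V → lieD A (lieD B (fun q => g.val q (Z q) (W q))) q
        = g.val q (g.nab A (g.nab B Z) q) (W q) + g.val q (g.nab B Z q) (g.nab A W q)
          + (g.val q (g.nab A Z q) (g.nab B W q) + g.val q (Z q) (g.nab A (g.nab B W) q)) := by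
    intro A B hA hB
    have nBZ := smoothFieldOn_nab g hV hB hZ
    have nBW := smoothFieldOn_nab g hV hB hW
    rw [lieD_congr hV (fun r hr => nab_metric hV hB hZ hW hr) hq,
      lieD_add hV (smoothFnOn_val g nBZ hW) (smoothFnOn_val g hZ nBW) hq,
      nab_metric hV hA nBZ hW hq, nab_metric hV hA hZ nBW hq]
  have h1 := lieD_commutator hV hX hY (smoothFnOn_val g hZ hW) hq
  rw [key X Y hX hY, key Y X hY hX,
    nab_metric hV (smoothFieldOn_mlieBracket hV hX hY) hZ hW hq] at h1
  simp only [curv, Pi.sub_apply, map_sub, _root_.sub_apply]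
  linarith

lemma curv_add_left (hV : IsOpen V) (hX : SmoothFieldOn ∞ X V) (hX' : SmoothFieldOn ∞ X' V)
    (hZ : SmoothFieldOn ∞ Z V) (hq : q ∈ V) :
    g.curv (X + X') Y Z q = g.curv X Y Z q + g.curv X' Y Z q := by
  simp only [curv, Pi.sub_apply]
  rw [nab_add_left, nab_add_left, Pi.add_apply, nab_add_right hV (smoothFieldOn_nab g hV hX hZ)
    (smoothFieldOn_nab g hV hX' hZ) hq]
  simp only [nab]
  rw [mlieBracket_add_left (hX.diffAt hV hq) (hX'.diffAt hV hq), map_add]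
  abel

lemma curv_smul_left (hV : IsOpen V) (hf : SmoothFnOn f V) (hX : SmoothFieldOn ∞ X V)
    (hZ : SmoothFieldOn ∞ Z V) (hq : q ∈ V) :
    g.curv (f • X) Y Z q = f q • g.curv X Y Z q := by
  simp only [curv, Pi.sub_apply]
  rw [nab_smul_left, nab_smul_left, nab_smul_right hV (smoothFieldOn_nab g hV hX hZ) hf hq]
  simp only [nab, Pi.smul_apply']
  rw [mlieBracket_smul_left (hf.mdiffAt hV hq) (hX.diffAt hV hq), map_add, map_smul, map_smul]
  simp only [lieD]
  module

lemma curv_congr_on (hV : IsOpen V) (hX' : SmoothFieldOn ∞ X' V)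
    (hZ : SmoothFieldOn ∞ Z V) (h : ∀ q ∈ V, X q = X' q) (hq : q ∈ V) :
    g.curv X Y Z q = g.curv X' Y Z q := by
  have hX : SmoothFieldOn ∞ X V := hX'.congr h
  simp only [curv, Pi.sub_apply]
  have h1 : g.nab X (g.nab Y Z) q = g.nab X' (g.nab Y Z) q := by simp only [nab, h q hq]
  have h2 : g.nab Y (g.nab X Z) q = g.nab Y (g.nab X' Z) q := by
    simp only [nab]
    rw [leviCivita_congr hV ((smoothFieldOn_nab g hV hX hZ).diffAt hV hq)
      ((smoothFieldOn_nab g hV hX' hZ).diffAt hV hq) (fun r hr => ?_) hq]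
    · simp only [nab, h r hr]
  have h3 : g.nab (mlieBracket 𝓘(ℝ, E3) X Y) Z q = g.nab (mlieBracket 𝓘(ℝ, E3) X' Y) Z q := by
    simp only [nab]
    rw [mlieBracket_congr_on hV h (fun _ _ => rfl) hq]
  rw [h1, h2, h3]

/-- The curvature operator in terms of the components of its first argument in a frame. -/
lemma curv_expand_left {ε : Fin 3 → ℝ} {e : Fin 3 → ∀ p : M, TangentSpace 𝓘(ℝ, E3) p}
    (he : g.IsOrthoFrame V ε e) (hX : SmoothFieldOn ∞ X V)
    (hZ : SmoothFieldOn ∞ Z V) (hq : q ∈ V) :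
    g.curv X Y Z q = ∑ i, (ε i * g.val q (X q) (e i q)) • g.curv (e i) Y Z q := by
  have hV := he.isOpen
  have hc : ∀ i, SmoothFnOn (fun q => ε i * g.val q (X q) (e i q)) V := fun i =>
    contMDiffOn_const.mul (smoothFnOn_val g hX (he.smooth i))
  have hs : ∀ i, SmoothFieldOn ∞ ((fun q => ε i * g.val q (X q) (e i q)) • e i) V := fun i =>
    SmoothFieldOn.smul (hc i) (he.smooth i)
  have h1 : ∀ r ∈ V, X r = ((fun q => ε 0 * g.val q (X q) (e 0 q)) • e 0
      + (fun q => ε 1 * g.val q (X q) (e 1 q)) • e 1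
      + (fun q => ε 2 * g.val q (X q) (e 2 q)) • e 2) r := by
    intro r hr
    have := (he.ortho r hr).sum_val (X r)
    rw [Fin.sum_univ_three] at this
    exact this.symm
  rw [curv_congr_on hV (SmoothFieldOn.add (SmoothFieldOn.add (hs 0) (hs 1)) (hs 2)) hZ h1 hq,
    curv_add_left hV (SmoothFieldOn.add (hs 0) (hs 1)) (hs 2) hZ hq,
    curv_add_left hV (hs 0) (hs 1) hZ hq, curv_smul_left hV (hc 0) (he.smooth 0) hZ hq,
    curv_smul_left hV (hc 1) (he.smooth 1) hZ hq, curv_smul_left hV (hc 2) (he.smooth 2) hZ hq,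
    Fin.sum_univ_three]

/-- In a frame the first argument enters only through its components, hence only through its value
at the point. -/
lemma curv_tensorial_left (hV : IsOpen V) (hX : SmoothFieldOn ∞ X V) (hX' : SmoothFieldOn ∞ X' V)
    (hZ : SmoothFieldOn ∞ Z V) (hq : q ∈ V) (h : X q = X' q) :
    g.curv X Y Z q = g.curv X' Y Z q := by
  obtain ⟨b, hb⟩ := g.exists_isOrthoTriple q
  obtain ⟨W, hqW, e, he, -⟩ := exists_isOrthoFrame_extend g hb
  have hN := hV.inter he.isOpen
  have he' := he.mono hN Set.inter_subset_right
  have hs := Set.inter_subset_left (s := V) (t := W)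
  rw [curv_expand_left he' (hX.mono hs) (hZ.mono hs) ⟨hq, hqW⟩,
    curv_expand_left he' (hX'.mono hs) (hZ.mono hs) ⟨hq, hqW⟩, h]

/-- The value of the curvature operator at a point depends only on the values of the vector
fields at that point. -/
lemma curv_tensorial (hV : IsOpen V) (hX : SmoothFieldOn ∞ X V) (hX' : SmoothFieldOn ∞ X' V)
    (hY : SmoothFieldOn ∞ Y V) (hY' : SmoothFieldOn ∞ Y' V) (hZ : SmoothFieldOn ∞ Z V)
    (hZ' : SmoothFieldOn ∞ Z' V) (hq : q ∈ V) (h1 : X q = X' q) (h2 : Y q = Y' q)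
    (h3 : Z q = Z' q) :
    g.curv X Y Z q = g.curv X' Y' Z' q := by
  rw [curv_tensorial_left hV hX hX' hZ hq h1, curv_swap,
    curv_tensorial_left hV hY hY' hZ hq h2, ← curv_swap]
  -- The first two arguments are done. The third is moved to the other slot of the metric by
  -- `val_curv_swap`, where only its value at `q` counts.
  rw [← sub_eq_zero]
  apply g.nondegenerate q
  intro w
  obtain ⟨W, hW, hqW, hw⟩ := exists_smoothFieldOn_extend q w
  have hN := hV.inter hW
  have hs := Set.inter_subset_left (s := V) (t := W)
  replace hw := hw.mono (Set.inter_subset_right (s := V))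
  have a1 := val_curv_swap hN (hX'.mono hs) (hY'.mono hs) (hZ.mono hs) hw ⟨hq, hqW⟩ (g := g)
  have a2 := val_curv_swap hN (hX'.mono hs) (hY'.mono hs) (hZ'.mono hs) hw ⟨hq, hqW⟩ (g := g)
  rw [h3, ← a2, extend_apply_self] at a1
  rw [map_sub, _root_.sub_apply, a1, sub_self]

/-- This frees the Riemann tensor from the extensions chosen in its definition: any smooth fields,
in particular frame fields, compute it. -/
lemma curvature_eq_curv (hV : IsOpen V) (hX : SmoothFieldOn ∞ X V) (hY : SmoothFieldOn ∞ Y V)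
    (hZ : SmoothFieldOn ∞ Z V) (hq : q ∈ V) :
    g.curvature q (X q) (Y q) (Z q) = g.curv X Y Z q := by
  obtain ⟨W1, hW1, hqW1, h1⟩ := exists_smoothFieldOn_extend q (X q)
  obtain ⟨W2, hW2, hqW2, h2⟩ := exists_smoothFieldOn_extend q (Y q)
  obtain ⟨W3, hW3, hqW3, h3⟩ := exists_smoothFieldOn_extend q (Z q)
  have hN := hV.inter (hW1.inter (hW2.inter hW3))
  have hs := Set.inter_subset_left (s := V) (t := W1 ∩ (W2 ∩ W3))
  rw [← curv_tensorial hN (h1.mono fun r hr => hr.2.1) (hX.mono hs) (h2.mono fun r hr => hr.2.2.1)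
    (hY.mono hs) (h3.mono fun r hr => hr.2.2.2) (hZ.mono hs) ⟨hq, hqW1, hqW2, hqW3⟩
    (by simp) (by simp) (by simp)]
  simp only [curvature, curv, Pi.sub_apply, nab, extend_apply_self]
  rfl

/-- The first Bianchi identity. -/
lemma curv_bianchi (hV : IsOpen V) (hX : SmoothFieldOn ∞ X V) (hY : SmoothFieldOn ∞ Y V)
    (hZ : SmoothFieldOn ∞ Z V) (hq : q ∈ V) :
    g.curv X Y Z q + g.curv Y Z X q + g.curv Z X Y q = 0 := by
  -- Absence of torsion turns iterated brackets into covariant derivatives, so that the Jacobi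
  -- identity becomes the claim.
  have key : ∀ A B C : ∀ p : M, TangentSpace 𝓘(ℝ, E3) p, SmoothFieldOn ∞ A V →
      SmoothFieldOn ∞ B V → SmoothFieldOn ∞ C V →
      mlieBracket 𝓘(ℝ, E3) A (mlieBracket 𝓘(ℝ, E3) B C) q
        = g.nab A (g.nab B C) q - g.nab A (g.nab C B) q
          - g.nab (mlieBracket 𝓘(ℝ, E3) B C) A q := by
    intro A B C hA hB hC
    have nBC := smoothFieldOn_nab g hV hB hC
    have nCB := smoothFieldOn_nab g hV hC hB
    rw [nab_torsion (g := g) hV hA (smoothFieldOn_mlieBracket hV hB hC) hq]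
    congr 1
    have e : g.leviCivita (mlieBracket 𝓘(ℝ, E3) B C) q = g.leviCivita (g.nab B C - g.nab C B) q :=
      leviCivita_congr hV ((smoothFieldOn_mlieBracket hV hB hC).diffAt hV hq)
        ((SmoothFieldOn.sub nBC nCB).diffAt hV hq) (fun r hr => nab_torsion hV hB hC hr) hq
    have e2 := nab_add_right (g := g) (X := A) hV (SmoothFieldOn.sub nBC nCB) nCB hq
    rw [sub_add_cancel] at e2
    rw [e2]
    simp only [nab, e]
    abel
  have h := mlieBracket_jacobi hV hX hY hZ hq
  have h' : mlieBracket 𝓘(ℝ, E3) (mlieBracket 𝓘(ℝ, E3) X Y) Z q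
      = - mlieBracket 𝓘(ℝ, E3) Z (mlieBracket 𝓘(ℝ, E3) X Y) q := mlieBracket_swap_apply
  rw [h', key X Y Z hX hY hZ, key Z X Y hZ hX hY, key Y X Z hY hX hZ] at h
  have s : g.nab (mlieBracket 𝓘(ℝ, E3) Z X) Y q = - g.nab (mlieBracket 𝓘(ℝ, E3) X Z) Y q := by
    simp only [nab]
    rw [mlieBracket_swap_apply, map_neg]
  simp only [curv, Pi.sub_apply, s]
  rw [← sub_eq_zero] at h
  rw [← h]; abel

end curv

/-! ### Symmetries of the Riemann, Ricci and Schouten tensors at a point -/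

section pointwise

variable {g : LorentzMetric M} {p : M} {ε : Fin 3 → ℝ} {b : Fin 3 → TangentSpace 𝓘(ℝ, E3) p}

lemma exists_smoothFieldOn_pair (u v : TangentSpace 𝓘(ℝ, E3) p) :
    ∃ W : Set M, IsOpen W ∧ p ∈ W ∧
      SmoothFieldOn ∞ (extend E3 u : ∀ q : M, TangentSpace 𝓘(ℝ, E3) q) W ∧
      SmoothFieldOn ∞ (extend E3 v : ∀ q : M, TangentSpace 𝓘(ℝ, E3) q) W := by
  obtain ⟨W1, hW1, hp1, h1⟩ := exists_smoothFieldOn_extend p u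
  obtain ⟨W2, hW2, hp2, h2⟩ := exists_smoothFieldOn_extend p v
  exact ⟨W1 ∩ W2, hW1.inter hW2, ⟨hp1, hp2⟩, h1.mono Set.inter_subset_left,
    h2.mono Set.inter_subset_right⟩

lemma exists_smoothFieldOn_quadruple (u v w z : TangentSpace 𝓘(ℝ, E3) p) :
    ∃ W : Set M, IsOpen W ∧ p ∈ W ∧
      SmoothFieldOn ∞ (extend E3 u : ∀ q : M, TangentSpace 𝓘(ℝ, E3) q) W ∧
      SmoothFieldOn ∞ (extend E3 v : ∀ q : M, TangentSpace 𝓘(ℝ, E3) q) W ∧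
      SmoothFieldOn ∞ (extend E3 w : ∀ q : M, TangentSpace 𝓘(ℝ, E3) q) W ∧
      SmoothFieldOn ∞ (extend E3 z : ∀ q : M, TangentSpace 𝓘(ℝ, E3) q) W := by
  obtain ⟨W1, hW1, hp1, h1, h2⟩ := exists_smoothFieldOn_pair u v
  obtain ⟨W2, hW2, hp2, h3, h4⟩ := exists_smoothFieldOn_pair w z
  exact ⟨W1 ∩ W2, hW1.inter hW2, ⟨hp1, hp2⟩, h1.mono Set.inter_subset_left,
    h2.mono Set.inter_subset_left, h3.mono Set.inter_subset_right, h4.mono Set.inter_subset_right⟩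

lemma curvature_swap (u v w : TangentSpace 𝓘(ℝ, E3) p) :
    g.curvature p u v w = - g.curvature p v u w := by
  obtain ⟨W, hW, hp, hu, hv, hw, -⟩ := exists_smoothFieldOn_quadruple u v w w
  have h1 := curvature_eq_curv (g := g) hW hu hv hw hp
  have h2 := curvature_eq_curv (g := g) hW hv hu hw hp
  simp only [extend_apply_self] at h1 h2
  rw [h1, h2, curv_swap]

lemma curvature_bianchi (u v w : TangentSpace 𝓘(ℝ, E3) p) :
    g.curvature p u v w + g.curvature p v w u + g.curvature p w u v = 0 := by
  obtain ⟨W, hW, hp, hu, hv, hw, -⟩ := exists_smoothFieldOn_quadruple u v w w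
  have h1 := curvature_eq_curv (g := g) hW hu hv hw hp
  have h2 := curvature_eq_curv (g := g) hW hv hw hu hp
  have h3 := curvature_eq_curv (g := g) hW hw hu hv hp
  simp only [extend_apply_self] at h1 h2 h3
  rw [h1, h2, h3, curv_bianchi hW hu hv hw hp]

lemma val_curvature_swap (u v w z : TangentSpace 𝓘(ℝ, E3) p) :
    g.val p (g.curvature p u v w) z = - g.val p (g.curvature p u v z) w := by
  obtain ⟨W, hW, hp, hu, hv, hw, hz⟩ := exists_smoothFieldOn_quadruple u v w z
  have h1 := curvature_eq_curv (g := g) hW hu hv hw hp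
  have h2 := curvature_eq_curv (g := g) hW hu hv hz hp
  have h3 := val_curv_swap (g := g) hW hu hv hw hz hp
  simp only [extend_apply_self] at h1 h2 h3
  rw [h1, h2, h3, g.symm]

lemma curvature_add_left (u u' v w : TangentSpace 𝓘(ℝ, E3) p) :
    g.curvature p (u + u') v w = g.curvature p u v w + g.curvature p u' v w := by
  obtain ⟨W, hW, hp, hu, hu', hv, hw⟩ := exists_smoothFieldOn_quadruple u u' v w
  have h1 := curvature_eq_curv (g := g) hW hu hv hw hp
  have h2 := curvature_eq_curv (g := g) hW hu' hv hw hp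
  have h3 := curvature_eq_curv (g := g) hW (SmoothFieldOn.add hu hu') hv hw hp
  simp only [extend_apply_self, Pi.add_apply] at h1 h2 h3
  rw [h1, h2, h3, curv_add_left hW hu hu' hw hp]

lemma curvature_smul_left (c : ℝ) (u v w : TangentSpace 𝓘(ℝ, E3) p) :
    g.curvature p (c • u) v w = c • g.curvature p u v w := by
  obtain ⟨W, hW, hp, hu, hv, hw, -⟩ := exists_smoothFieldOn_quadruple u v w w
  have hc : SmoothFnOn (fun _ : M => c) W := contMDiffOn_const
  have h1 := curvature_eq_curv (g := g) hW hu hv hw hp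
  have h3 := curvature_eq_curv (g := g) hW (SmoothFieldOn.smul hc hu) hv hw hp
  simp only [extend_apply_self, Pi.smul_apply'] at h1 h3
  rw [h1, h3, curv_smul_left hW hc hu hw hp]

lemma curvature_add_mid (u v v' w : TangentSpace 𝓘(ℝ, E3) p) :
    g.curvature p u (v + v') w = g.curvature p u v w + g.curvature p u v' w := by
  rw [curvature_swap, curvature_add_left, curvature_swap v, curvature_swap v']; abel

lemma curvature_smul_mid (c : ℝ) (u v w : TangentSpace 𝓘(ℝ, E3) p) :
    g.curvature p u (c • v) w = c • g.curvature p u v w := by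
  rw [curvature_swap, curvature_smul_left, curvature_swap v, smul_neg, neg_neg]

lemma curvature_add_right (u v w w' : TangentSpace 𝓘(ℝ, E3) p) :
    g.curvature p u v (w + w') = g.curvature p u v w + g.curvature p u v w' := by
  rw [← sub_eq_zero]
  apply g.nondegenerate p
  intro z
  simp only [map_sub, map_add, _root_.sub_apply, _root_.add_apply]
  rw [val_curvature_swap, val_curvature_swap u v w, val_curvature_swap u v w', map_add]
  ring

lemma curvature_smul_right (c : ℝ) (u v w : TangentSpace 𝓘(ℝ, E3) p) :
    g.curvature p u v (c • w) = c • g.curvature p u v w := by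
  rw [← sub_eq_zero]
  apply g.nondegenerate p
  intro z
  simp only [map_sub, map_smul, _root_.sub_apply, _root_.smul_apply, smul_eq_mul]
  rw [val_curvature_swap, val_curvature_swap u v w, map_smul, smul_eq_mul]
  ring

/-- The classical octahedron argument: four instances of the first Bianchi identity and the
antisymmetry in each pair of arguments imply the exchange of pairs by linear arithmetic. -/
lemma val_curvature_pair (u v w z : TangentSpace 𝓘(ℝ, E3) p) :
    g.val p (g.curvature p u v w) z = g.val p (g.curvature p w z u) v := by
  have B : ∀ a b c d : TangentSpace 𝓘(ℝ, E3) p, g.val p (g.curvature p a b c) d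
      + g.val p (g.curvature p b c a) d + g.val p (g.curvature p c a b) d = 0 := by
    intro a b c d
    have := congrArg (fun x => g.val p x d) (g.curvature_bianchi a b c)
    simpa using this
  have S : ∀ a b c d : TangentSpace 𝓘(ℝ, E3) p, g.val p (g.curvature p a b c) d
      = - g.val p (g.curvature p b a c) d := by
    intro a b c d; rw [curvature_swap]; simp
  have T := g.val_curvature_swap (p := p)
  linarith [B u v w z, B v w z u, B w z u v, B z u v w, S u v w z, S v w z u, S w z u v, S z u v w,
    T u v w z, T v w z u, T w z u v, T z u v w, S w u v z, S u v z w, S v z w u, S z w u v,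
    T w u v z, T u w v z, T v z w u, T z v w u, T u v z w, T z w u v, S u w v z, S v z u w,
    T v z u w, T w u z v, S w u z v, S z v u w, T z u w v, S z u w v, S u z v w, S v w u z,
    T v w u z, T u z v w]

lemma trace_eq_sum {ι : Type*} [Fintype ι] [DecidableEq ι]
    (B : Basis ι ℝ (TangentSpace 𝓘(ℝ, E3) p))
    (L : TangentSpace 𝓘(ℝ, E3) p →ₗ[ℝ] TangentSpace 𝓘(ℝ, E3) p) :
    LinearMap.trace ℝ _ L = ∑ i, B.coord i (L (B i)) := by
  rw [LinearMap.trace_eq_matrix_trace ℝ B, Matrix.trace]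
  simp [LinearMap.toMatrix_apply]

lemma IsOrthoTriple.trace (hb : g.IsOrthoTriple p ε b)
    (L : TangentSpace 𝓘(ℝ, E3) p →ₗ[ℝ] TangentSpace 𝓘(ℝ, E3) p) :
    LinearMap.trace ℝ _ L = ∑ i, ε i * g.val p (L (b i)) (b i) := by
  rw [trace_eq_sum hb.basis]
  simp [hb.repr]

/-- The contraction is the trace of a linear map in the second argument, so an orthonormal basis may
replace `frame p`. -/
lemma IsOrthoTriple.ricci (hb : g.IsOrthoTriple p ε b) (u w : TangentSpace 𝓘(ℝ, E3) p) :
    g.ricci p u w = ∑ i, ε i * g.val p (g.curvature p u (b i) w) (b i) := by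
  let L : TangentSpace 𝓘(ℝ, E3) p →ₗ[ℝ] TangentSpace 𝓘(ℝ, E3) p :=
    { toFun := fun v => g.curvature p u v w
      map_add' := fun v v' => g.curvature_add_mid u v v' w
      map_smul' := fun c v => g.curvature_smul_mid c u v w }
  exact (trace_eq_sum (frame p) L).symm.trans (hb.trace L)

lemma ricci_symm (g : LorentzMetric M) (u w : TangentSpace 𝓘(ℝ, E3) p) :
    g.ricci p u w = g.ricci p w u := by
  obtain ⟨b, hb⟩ := g.exists_isOrthoTriple p
  rw [hb.ricci, hb.ricci]
  exact Finset.sum_congr rfl fun i _ => by rw [val_curvature_pair]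

/-- The Ricci tensor as a bilinear map. -/
noncomputable def ricciBilin (g : LorentzMetric M) (p : M) :
    TangentSpace 𝓘(ℝ, E3) p →ₗ[ℝ] TangentSpace 𝓘(ℝ, E3) p →ₗ[ℝ] ℝ :=
  LinearMap.mk₂ ℝ (g.ricci p)
    (fun u u' w => by simp [LorentzMetric.ricci, curvature_add_left, Finset.sum_add_distrib])
    (fun c u w => by simp [LorentzMetric.ricci, curvature_smul_left, Finset.mul_sum])
    (fun u w w' => by simp [LorentzMetric.ricci, curvature_add_right, Finset.sum_add_distrib])
    (fun c u w => by simp [LorentzMetric.ricci, curvature_smul_right, Finset.mul_sum])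

/-- The metric as a bilinear map. -/
noncomputable def valBilin (g : LorentzMetric M) (p : M) :
    TangentSpace 𝓘(ℝ, E3) p →ₗ[ℝ] TangentSpace 𝓘(ℝ, E3) p →ₗ[ℝ] ℝ :=
  LinearMap.mk₂ ℝ (fun u v => g.val p u v) (by simp) (by simp) (by simp) (by simp)

/-- The tracefree Ricci tensor as a bilinear map. -/
noncomputable def phi (g : LorentzMetric M) (p : M) :
    TangentSpace 𝓘(ℝ, E3) p →ₗ[ℝ] TangentSpace 𝓘(ℝ, E3) p →ₗ[ℝ] ℝ :=
  g.ricciBilin p - (1 / 3 * g.scalar p) • g.valBilin p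

/-- The Schouten tensor as a bilinear map. -/
noncomputable def schoutenBilin (g : LorentzMetric M) (p : M) :
    TangentSpace 𝓘(ℝ, E3) p →ₗ[ℝ] TangentSpace 𝓘(ℝ, E3) p →ₗ[ℝ] ℝ :=
  - g.phi p - (1 / 12 * g.scalar p) • g.valBilin p

lemma phi_apply (g : LorentzMetric M) (u v : TangentSpace 𝓘(ℝ, E3) p) :
    g.phi p u v = g.tracefreeRicci p u v := rfl

lemma schoutenBilin_apply (g : LorentzMetric M) (u v : TangentSpace 𝓘(ℝ, E3) p) :
    g.schoutenBilin p u v = g.schouten p u v := rfl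

lemma phi_symm (g : LorentzMetric M) (u v : TangentSpace 𝓘(ℝ, E3) p) :
    g.phi p u v = g.phi p v u := by
  simp only [phi_apply, tracefreeRicci]
  rw [ricci_symm, g.symm]

lemma schouten_symm (g : LorentzMetric M) (u v : TangentSpace 𝓘(ℝ, E3) p) :
    g.schouten p u v = g.schouten p v u := by
  simp only [schouten, ← phi_apply]
  rw [phi_symm, g.symm]

/-- A vector in the kernel of the Gram matrix would give a nonzero tangent vector orthogonal to
everything. -/
lemma inv_mul_gram (g : LorentzMetric M) (p : M) :
    g.inv p * (Matrix.of fun i j => g.val p (frame p i) (frame p j)) = 1 := by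
  unfold inv
  apply Matrix.nonsing_inv_mul
  rw [isUnit_iff_ne_zero]
  intro h
  obtain ⟨x, hx, hx0⟩ := Matrix.exists_vecMul_eq_zero_iff.2 h
  apply hx
  have : ∑ i, x i • frame p i = 0 := by
    apply g.nondegenerate p
    intro w
    rw [← (frame p).sum_repr w]
    simp only [map_sum, map_smul, _root_.sum_apply, _root_.smul_apply, smul_eq_mul]
    apply Finset.sum_eq_zero
    intro j _
    have := congrFun hx0 j
    simp only [Matrix.vecMul, dotProduct, Matrix.of_apply, Pi.zero_apply] at this
    rw [this, mul_zero]
  exact funext fun i => (Fintype.linearIndependent_iff.1 (frame p).linearIndependent) x this i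

/-- Contraction with the inverse metric may be computed in an orthonormal basis. -/
lemma IsOrthoTriple.sum_inv (hb : g.IsOrthoTriple p ε b)
    (B : TangentSpace 𝓘(ℝ, E3) p →ₗ[ℝ] TangentSpace 𝓘(ℝ, E3) p →ₗ[ℝ] ℝ) :
    ∑ i, ∑ j, g.inv p i j * B (frame p i) (frame p j) = ∑ a, ε a * B (b a) (b a) := by
  -- The basis dual to `frame p` with respect to the metric.
  set c : Fin 3 → TangentSpace 𝓘(ℝ, E3) p := fun i => ∑ j, g.inv p i j • frame p j with hc
  have hcf : ∀ i k, g.val p (c i) (frame p k) = if i = k then 1 else 0 := by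
    intro i k
    have := congrFun (congrFun (g.inv_mul_gram p) i) k
    simp only [Matrix.mul_apply, Matrix.of_apply, Matrix.one_apply] at this
    rw [← this]
    simp [hc]
  have hcv : ∀ v, ∑ i, g.val p (c i) v • frame p i = v := by
    intro v
    conv_rhs => rw [← (frame p).sum_repr v]
    refine Finset.sum_congr rfl fun i _ => ?_
    congr 1
    conv_lhs => rw [← (frame p).sum_repr v]
    simp only [map_sum, map_smul, hcf, smul_eq_mul, mul_ite, mul_one, mul_zero,
      Finset.sum_ite_eq, Finset.mem_univ, if_true]
  calc ∑ i, ∑ j, g.inv p i j * B (frame p i) (frame p j)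
      = ∑ i, B (frame p i) (c i) := by simp [hc]
    _ = ∑ i, ∑ a, ε a * g.val p (c i) (b a) * B (frame p i) (b a) := by
        refine Finset.sum_congr rfl fun i _ => ?_
        conv_lhs => rw [← hb.sum_val (c i)]
        simp
    _ = ∑ a, ε a * B (∑ i, g.val p (c i) (b a) • frame p i) (b a) := by
        rw [Finset.sum_comm]
        refine Finset.sum_congr rfl fun a _ => ?_
        simp only [map_sum, map_smul, LinearMap.sum_apply, LinearMap.smul_apply, smul_eq_mul,
          Finset.mul_sum]
        exact Finset.sum_congr rfl fun i _ => by ring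
    _ = _ := by simp [hcv]

lemma IsOrthoTriple.scalar (hb : g.IsOrthoTriple p ε b) :
    g.scalar p = ∑ a, ε a * g.ricci p (b a) (b a) :=
  hb.sum_inv (g.ricciBilin p)

lemma IsOrthoTriple.phi_trace (hb : g.IsOrthoTriple p ε b) :
    ∑ a, ε a * g.phi p (b a) (b a) = 0 := by
  have h1 := hb.scalar
  have h2 : ∀ a, g.val p (b a) (b a) = ε a := fun a => by simp [hb.2]
  have h3 := hb.1
  simp only [phi_apply, tracefreeRicci, h2, Fin.sum_univ_three] at h1 ⊢
  linear_combination (-1 : ℝ) * h1 - 1 / 3 * g.scalar p * (h3 0 + h3 1 + h3 2)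

end pointwise

/-! ### Smoothness of the curvature tensors; the derivative of the Schouten tensor -/

section tensor

variable {g : LorentzMetric M} {V : Set M} {X Y Z : ∀ p : M, TangentSpace 𝓘(ℝ, E3) p} {p q : M}
  {ε : Fin 3 → ℝ} {e : Fin 3 → ∀ p : M, TangentSpace 𝓘(ℝ, E3) p}

lemma IsOrthoFrame.smoothFnOn_ricci (he : g.IsOrthoFrame V ε e) (hX : SmoothFieldOn ∞ X V)
    (hY : SmoothFieldOn ∞ Y V) : SmoothFnOn (fun q => g.ricci q (X q) (Y q)) V := by
  have h : ∀ i, SmoothFnOn (fun q => ε i * g.val q (g.curv X (e i) Y q) (e i q)) V := fun i =>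
    contMDiffOn_const.mul (smoothFnOn_val g (smoothFieldOn_curv he.isOpen hX (he.smooth i) hY)
      (he.smooth i))
  refine (((h 0).add (h 1)).add (h 2)).congr fun q hq => ?_
  rw [(he.ortho q hq).ricci, Fin.sum_univ_three]
  simp only [curvature_eq_curv he.isOpen hX (he.smooth _) hY hq]
  rfl

lemma IsOrthoFrame.smoothFnOn_scalar (he : g.IsOrthoFrame V ε e) : SmoothFnOn g.scalar V := by
  have h : ∀ i, SmoothFnOn (fun q => ε i * g.ricci q (e i q) (e i q)) V := fun i =>
    contMDiffOn_const.mul (he.smoothFnOn_ricci (he.smooth i) (he.smooth i))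
  refine (((h 0).add (h 1)).add (h 2)).congr fun q hq => ?_
  rw [(he.ortho q hq).scalar, Fin.sum_univ_three]
  rfl

lemma IsOrthoFrame.smoothFnOn_phi (he : g.IsOrthoFrame V ε e) (hX : SmoothFieldOn ∞ X V)
    (hY : SmoothFieldOn ∞ Y V) : SmoothFnOn (fun q => g.phi q (X q) (Y q)) V := by
  have h1 := he.smoothFnOn_ricci hX hY
  have h2 := he.smoothFnOn_scalar
  have h3 := smoothFnOn_val g hX hY
  exact h1.sub ((contMDiffOn_const.mul h2).mul h3)

lemma IsOrthoFrame.smoothFnOn_schouten (he : g.IsOrthoFrame V ε e) (hX : SmoothFieldOn ∞ X V)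
    (hY : SmoothFieldOn ∞ Y V) : SmoothFnOn (fun q => g.schouten q (X q) (Y q)) V := by
  have h1 := he.smoothFnOn_phi hX hY
  have h2 := he.smoothFnOn_scalar
  have h3 := smoothFnOn_val g hX hY
  exact h1.neg.sub ((contMDiffOn_const.mul h2).mul h3)

/-- Tensoriality is tested on fields that are merely differentiable at the point, so the smooth
version is not enough. The components of such fields in a smooth frame are differentiable, and those
of the Schouten tensor are smooth. -/
lemma mdifferentiableAt_schouten (g : LorentzMetric M) (hX : DiffFieldAt X p)
    (hY : DiffFieldAt Y p) :
    MDifferentiableAt 𝓘(ℝ, E3) 𝓘(ℝ) (fun q => g.schouten q (X q) (Y q)) p := by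
  obtain ⟨b, hb⟩ := g.exists_isOrthoTriple p
  obtain ⟨W, hW, e, he, -⟩ := exists_isOrthoFrame_extend g hb
  have hd := fun i => SmoothFieldOn.diffAt he.isOpen (he.smooth i) hW
  have h : ∀ i j, MDifferentiableAt 𝓘(ℝ, E3) 𝓘(ℝ) (fun q => (![1, 1, -1] : Fin 3 → ℝ) i
      * g.val q (X q) (e i q) * ((![1, 1, -1] : Fin 3 → ℝ) j * g.val q (Y q) (e j q))
      * g.schouten q (e i q) (e j q)) p := fun i j =>
    ((mdifferentiableAt_const.mul (g.mdiffAt_val hX (hd i))).mul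
      (mdifferentiableAt_const.mul (g.mdiffAt_val hY (hd j)))).mul
      ((he.smoothFnOn_schouten (he.smooth i) (he.smooth j)).mdiffAt he.isOpen hW)
  have hs : MDifferentiableAt 𝓘(ℝ, E3) 𝓘(ℝ) (fun q => ∑ i, ∑ j, (![1, 1, -1] : Fin 3 → ℝ) i
      * g.val q (X q) (e i q) * ((![1, 1, -1] : Fin 3 → ℝ) j * g.val q (Y q) (e j q))
      * g.schouten q (e i q) (e j q)) p := by
    simp only [Fin.sum_univ_three]
    exact ((((h 0 0).add (h 0 1)).add (h 0 2)).add (((h 1 0).add (h 1 1)).add (h 1 2))).add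
      (((h 2 0).add (h 2 1)).add (h 2 2))
  refine hs.congr_of_eventuallyEq (Filter.eventuallyEq_of_mem (he.isOpen.mem_nhds hW) ?_)
  intro q hq
  have ho := he.ortho q hq
  simp only [← schoutenBilin_apply]
  conv_lhs => rw [← ho.sum_val (X q), ← ho.sum_val (Y q)]
  simp only [map_sum, map_smul, LinearMap.sum_apply, LinearMap.smul_apply, smul_eq_mul,
    Finset.mul_sum]
  rw [Finset.sum_comm]
  exact Finset.sum_congr rfl fun i _ => Finset.sum_congr rfl fun j _ => by ring

lemma mdifferentiableAt_schoutenBilin (g : LorentzMetric M) (hX : DiffFieldAt X p)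
    (hY : DiffFieldAt Y p) :
    MDifferentiableAt 𝓘(ℝ, E3) 𝓘(ℝ) (fun q => g.schoutenBilin q (X q) (Y q)) p :=
  g.mdifferentiableAt_schouten hX hY

lemma nablaSchouten_tensorial_left (g : LorentzMetric M) (x : TangentSpace 𝓘(ℝ, E3) p)
    (hY : DiffFieldAt Y p) : TensorialAt 𝓘(ℝ, E3) E3
      (fun X => mvfderiv 𝓘(ℝ, E3) (fun q => g.schouten q (X q) (Y q)) p x
        - g.schouten p (g.leviCivita X p x) (Y p)
        - g.schouten p (X p) (g.leviCivita Y p x)) p where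
  smul {f X} hf hX := by
    rw [leviCivita_smul hX hf]
    simp only [← schoutenBilin_apply, Pi.smul_apply', map_smul, map_add, LinearMap.add_apply,
      LinearMap.smul_apply, smul_eq_mul]
    rw [mvfderiv_fun_mul hf (g.mdifferentiableAt_schoutenBilin hX hY)]
    simp
    ring
  add {X X'} hX hX' := by
    rw [g.leviCivita.isCovariantDerivativeOnUniv.add hX hX']
    simp only [← schoutenBilin_apply, Pi.add_apply, map_add, LinearMap.add_apply,
      _root_.add_apply]
    rw [mvfderiv_fun_add (g.mdifferentiableAt_schoutenBilin hX hY) (g.mdifferentiableAt_schoutenBilin hX' hY)]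
    simp
    ring

lemma nablaSchouten_tensorial_right (g : LorentzMetric M) (x : TangentSpace 𝓘(ℝ, E3) p)
    (hX : DiffFieldAt X p) : TensorialAt 𝓘(ℝ, E3) E3
      (fun Y => mvfderiv 𝓘(ℝ, E3) (fun q => g.schouten q (X q) (Y q)) p x
        - g.schouten p (g.leviCivita X p x) (Y p)
        - g.schouten p (X p) (g.leviCivita Y p x)) p where
  smul {f Y} hf hY := by
    rw [leviCivita_smul hY hf]
    simp only [← schoutenBilin_apply, Pi.smul_apply', map_smul, map_add, smul_eq_mul]
    rw [mvfderiv_fun_mul hf (g.mdifferentiableAt_schoutenBilin hX hY)]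
    simp
    ring
  add {Y Y'} hY hY' := by
    rw [g.leviCivita.isCovariantDerivativeOnUniv.add hY hY']
    simp only [← schoutenBilin_apply, Pi.add_apply, map_add, _root_.add_apply]
    rw [mvfderiv_fun_add (g.mdifferentiableAt_schoutenBilin hX hY) (g.mdifferentiableAt_schoutenBilin hX hY')]
    simp
    ring

/-- The derivative `x^c ∇_c P_{ab}` of the Schouten tensor as a bilinear map. -/
noncomputable def nablaSchoutenBilin (g : LorentzMetric M) (p : M)
    (x : TangentSpace 𝓘(ℝ, E3) p) :
    TangentSpace 𝓘(ℝ, E3) p →L[ℝ] TangentSpace 𝓘(ℝ, E3) p →L[ℝ] ℝ :=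
  TensorialAt.mkHom₂ (fun X Y => mvfderiv 𝓘(ℝ, E3) (fun q => g.schouten q (X q) (Y q)) p x
    - g.schouten p (g.leviCivita X p x) (Y p) - g.schouten p (X p) (g.leviCivita Y p x)) p
    (fun _ hY => g.nablaSchouten_tensorial_left x hY)
    (fun _ hX => g.nablaSchouten_tensorial_right x hX)

lemma nablaSchoutenBilin_apply (x u v : TangentSpace 𝓘(ℝ, E3) p) :
    g.nablaSchoutenBilin p x u v = g.nablaSchouten p x u v := by
  rw [nablaSchoutenBilin, TensorialAt.mkHom₂_apply_eq_extend]
  simp [nablaSchouten]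

/-- Tensoriality allows frame fields to take the place of the extensions used in the definition. -/
lemma nablaSchouten_eq (x : TangentSpace 𝓘(ℝ, E3) p) (hX : DiffFieldAt X p)
    (hY : DiffFieldAt Y p) :
    g.nablaSchouten p x (X p) (Y p) = mvfderiv 𝓘(ℝ, E3) (fun q => g.schouten q (X q) (Y q)) p x
      - g.schouten p (g.leviCivita X p x) (Y p) - g.schouten p (X p) (g.leviCivita Y p x) := by
  rw [← nablaSchoutenBilin_apply]
  exact TensorialAt.mkHom₂_apply _ _ hX hY

lemma nablaSchouten_add_left (x x' u v : TangentSpace 𝓘(ℝ, E3) p) :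
    g.nablaSchouten p (x + x') u v = g.nablaSchouten p x u v + g.nablaSchouten p x' u v := by
  simp only [nablaSchouten, ← schoutenBilin_apply, map_add, LinearMap.add_apply]
  ring

lemma nablaSchouten_smul_left (c : ℝ) (x u v : TangentSpace 𝓘(ℝ, E3) p) :
    g.nablaSchouten p (c • x) u v = c * g.nablaSchouten p x u v := by
  simp only [nablaSchouten, ← schoutenBilin_apply, map_smul, LinearMap.smul_apply, smul_eq_mul]
  ring

lemma nablaSchouten_symm (x u v : TangentSpace 𝓘(ℝ, E3) p) :
    g.nablaSchouten p x u v = g.nablaSchouten p x v u := by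
  simp only [nablaSchouten]
  have : (fun q => g.schouten q (extend E3 u q) (extend E3 v q))
      = fun q => g.schouten q (extend E3 v q) (extend E3 u q) :=
    funext fun q => schouten_symm g _ _
  rw [this, schouten_symm g u, schouten_symm g _ v]
  ring

/-- The Cotton tensor, as a bilinear map in its two antisymmetric arguments. -/
noncomputable def cottonBilin (g : LorentzMetric M) (p : M) (u : TangentSpace 𝓘(ℝ, E3) p) :
    TangentSpace 𝓘(ℝ, E3) p →ₗ[ℝ] TangentSpace 𝓘(ℝ, E3) p →ₗ[ℝ] ℝ :=
  LinearMap.mk₂ ℝ (g.cotton p u)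
    (fun v v' w => by
      simp only [cotton, nablaSchouten_add_left]
      simp only [← nablaSchoutenBilin_apply, map_add,
        _root_.add_apply]
      ring)
    (fun c v w => by
      simp only [cotton, nablaSchouten_smul_left]
      simp only [← nablaSchoutenBilin_apply, map_smul,
        _root_.smul_apply, smul_eq_mul]
      ring)
    (fun v w w' => by
      simp only [cotton, nablaSchouten_add_left]
      simp only [← nablaSchoutenBilin_apply, map_add,
        _root_.add_apply]
      ring)
    (fun c v w => by
      simp only [cotton, nablaSchouten_smul_left]
      simp only [← nablaSchoutenBilin_apply, map_smul,
        _root_.smul_apply, smul_eq_mul]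
      ring)

end tensor
end LorentzMetric

/-! ### The field equations as algebra in a commutative ring -/

/-- The components of the equations of topological massive gravity in a (possibly complex) frame
`e₀, e₁, e₂` with `g = diag (1, -1, 1)`: derivations `D i` along the frame, connection coefficients
`Γ i j k = g (∇_i e_j, e_k)`, components `F i j` of the tracefree Ricci tensor and `N i j k` of its
covariant derivative. -/
structure TMGFrame (B : Type*) [CommRing B] [Algebra ℂ B] where
  D : Fin 3 → Derivation ℂ B B
  Γ : Fin 3 → Fin 3 → Fin 3 → B
  F : Fin 3 → Fin 3 → B
  /-- A third of the Ricci scalar. -/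
  r : B
  /-- The mass multiplied by the value of the volume form on the frame. -/
  μ : B
  Γ_anti : ∀ i j k, Γ i j k = - Γ i k j
  F_symm : ∀ i j, F i j = F j i
  D_μ : ∀ i, D i μ = 0
  -- Absence of torsion: [e_i, e_j] = ∇_i e_j - ∇_j e_i, expanded in the frame.
  comm : ∀ i j f, D i (D j f) - D j (D i f) = ∑ k, ![1, -1, 1] k * ((Γ i j k - Γ j i k) * D k f)
  ricci : ∀ i k, F i k + (if i = k then ![1, -1, 1] i * r else 0)
    = ∑ j, ![1, -1, 1] j * (D i (Γ j k j) - D j (Γ i k j)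
      - ∑ n, ![1, -1, 1] n * (Γ j k n * Γ i j n - Γ i k n * Γ j j n)
      - ∑ n, ![1, -1, 1] n * ((Γ i j n - Γ j i n) * Γ n k j))
  F_trace : F 0 0 - F 1 1 + F 2 2 = 0
  N : Fin 3 → Fin 3 → Fin 3 → B
  N_eq : ∀ i j k, N i j k = D i (F j k) - ∑ n, ![1, -1, 1] n * (Γ i j n * F n k)
    - ∑ n, ![1, -1, 1] n * (Γ i k n * F j n)
  -- The field equations m Φ = *A. As R is constant, the Cotton tensor is minus the antisymmetrised
  -- derivative of Φ.
  curl₀ : ∀ a, μ * F a 0 = N 1 2 a - N 2 1 a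
  curl₁ : ∀ a, μ * F a 1 = N 0 2 a - N 2 0 a
  curl₂ : ∀ a, μ * F a 2 = N 0 1 a - N 1 0 a

namespace TMGFrame

variable {B : Type*} [CommRing B] [Algebra ℂ B] (T : TMGFrame B)

/-- `g (∇_k k, u)` for `k = e₀ + e₁`, `u = e₂` -/
def κ : B := T.Γ 0 0 2 + T.Γ 0 1 2 + T.Γ 1 0 2 + T.Γ 1 1 2

/-- `g (∇_u k, u)` -/
def ρ : B := T.Γ 2 0 2 + T.Γ 2 1 2

/-- `Φ (k, k)` -/
def Φ₀ : B := T.F 0 0 + 2 * T.F 0 1 + T.F 1 1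

/-- `Φ (k, u)` -/
def Φ₁ : B := T.F 0 2 + T.F 1 2

variable {T}

lemma Γ_self_of_two (h2 : ∀ x : B, x + x = 0 → x = 0) (i j : Fin 3) : T.Γ i j j = 0 :=
  h2 _ (by linear_combination T.Γ_anti i j j)

/-- A Raychaudhuri equation: the four components add up to the Ricci equation contracted twice with
k. The scalar term drops out since k is null, and nothing survives on the right once κ and ρ vanish.
-/
lemma Φ₀_eq_zero (h2 : ∀ x : B, x + x = 0 → x = 0) (hκ : T.κ = 0) (hρ : T.ρ = 0) : T.Φ₀ = 0 := by
  have r00 := T.ricci 0 0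
  have r11 := T.ricci 1 1
  have r01 := T.ricci 0 1
  have r10 := T.ricci 1 0
  have k1 : T.Γ 1 1 2 = - T.Γ 0 0 2 - T.Γ 0 1 2 - T.Γ 1 0 2 := by
    simp only [κ] at hκ; linear_combination hκ
  have k2 : T.Γ 2 1 2 = - T.Γ 2 0 2 := by simp only [ρ] at hρ; linear_combination hρ
  simp [Fin.sum_univ_three, Γ_self_of_two h2, T.Γ_anti _ 1 0, T.Γ_anti _ 2 0, T.Γ_anti _ 2 1,
    T.F_symm 1 0, k1, k2] at r00 r11 r01 r10
  simp only [Φ₀]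
  linear_combination (exp := 1) r00 + r01 + r10 + r11

/-- The sum of the four equations is μ Φ(k,k) = ∇_kΦ(u,k) - ∇_uΦ(k,k). By κ = ρ = 0 the derivatives
∇_k k, ∇_u k and ∇_k u are all multiples of k, so only the derivative of Φ₁ and a multiple of Φ₁
remain. -/
lemma K_Φ₁ (h2 : ∀ x : B, x + x = 0 → x = 0) (hκ : T.κ = 0) (hρ : T.ρ = 0) (h0 : T.Φ₀ = 0) :
    T.D 0 T.Φ₁ + T.D 1 T.Φ₁ = - (T.Γ 0 0 1 + T.Γ 1 0 1) * T.Φ₁ := by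
  have k1 : T.Γ 1 1 2 = - T.Γ 0 0 2 - T.Γ 0 1 2 - T.Γ 1 0 2 := by
    simp only [κ] at hκ; linear_combination hκ
  have k2 : T.Γ 2 1 2 = - T.Γ 2 0 2 := by simp only [ρ] at hρ; linear_combination hρ
  have k3 : T.F 1 1 = - T.F 0 0 - 2 * T.F 0 1 := by
    simp only [Φ₀] at h0; linear_combination h0
  have k4 : T.F 2 2 = - 2 * T.F 0 0 - 2 * T.F 0 1 := by linear_combination T.F_trace + k3
  have c00 := T.curl₀ 0
  have c01 := T.curl₀ 1
  have c10 := T.curl₁ 0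
  have c11 := T.curl₁ 1
  simp [T.N_eq, Fin.sum_univ_three, Γ_self_of_two h2, T.Γ_anti _ 1 0, T.Γ_anti _ 2 0,
    T.Γ_anti _ 2 1, T.F_symm 1 0, T.F_symm 2 0, T.F_symm 2 1, k1, k2, k3, k4, two_mul] at c00 c01 c10 c11
  simp only [Φ₁, map_add]
  linear_combination (exp := 1) -c00 - c01 - c10 - c11

/-- Two components of the curl equation contain a k-derivative of Φ(u,u), the second one through
Φ(k,l), which the vanishing trace ties to Φ(u,u). The coefficient -2 in the combination cancels
these derivatives. -/
lemma U_Φ₁ (h2 : ∀ x : B, x + x = 0 → x = 0) (hκ : T.κ = 0) (hρ : T.ρ = 0) (h0 : T.Φ₀ = 0) :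
    T.D 2 T.Φ₁ = (2 * (T.Γ 0 0 2 + T.Γ 0 1 2 - T.Γ 1 0 2 - T.Γ 1 1 2) + T.μ - T.Γ 2 0 1) * T.Φ₁ := by
  have k1 : T.Γ 1 1 2 = - T.Γ 0 0 2 - T.Γ 0 1 2 - T.Γ 1 0 2 := by
    simp only [κ] at hκ; linear_combination hκ
  have k2 : T.Γ 2 1 2 = - T.Γ 2 0 2 := by simp only [ρ] at hρ; linear_combination hρ
  have k3 : T.F 1 1 = - T.F 0 0 - 2 * T.F 0 1 := by
    simp only [Φ₀] at h0; linear_combination h0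
  have k4 : T.F 2 2 = - 2 * T.F 0 0 - 2 * T.F 0 1 := by linear_combination T.F_trace + k3
  have c00 := T.curl₀ 2
  have c01 := T.curl₁ 2
  have c10 := T.curl₂ 0
  have c11 := T.curl₂ 1
  simp [T.N_eq, Fin.sum_univ_three, Γ_self_of_two h2, T.Γ_anti _ 1 0, T.Γ_anti _ 2 0,
    T.Γ_anti _ 2 1, T.F_symm 1 0, T.F_symm 2 0, T.F_symm 2 1, k1, k2, k3, k4, two_mul] at c00 c01 c10 c11
  simp only [Φ₁, map_add, k1]
  linear_combination (exp := 1) c00 + c01 - 2 * c10 - 2 * c11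

/-- The component Ric(k,u). Given κ = 0, the differentiated quantity is τ = g(∇_l k, u) for l = (e₀
- e₁)/2; since 4 τ occurs in the coefficient of `U_Φ₁`, its derivative along k is needed. -/
lemma K_τ (h2 : ∀ x : B, x + x = 0 → x = 0) (hκ : T.κ = 0) (hρ : T.ρ = 0) :
    T.D 0 (T.Γ 0 0 2 + T.Γ 0 1 2) + T.D 1 (T.Γ 0 0 2 + T.Γ 0 1 2) = - T.Φ₁ := by
  have k1 : T.Γ 1 1 2 = - T.Γ 0 0 2 - T.Γ 0 1 2 - T.Γ 1 0 2 := by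
    simp only [κ] at hκ; linear_combination hκ
  have k2 : T.Γ 2 1 2 = - T.Γ 2 0 2 := by simp only [ρ] at hρ; linear_combination hρ
  have c00 := T.ricci 0 2
  have c01 := T.ricci 1 2
  simp [Fin.sum_univ_three, Γ_self_of_two h2, T.Γ_anti _ 1 0, T.Γ_anti _ 2 0, T.Γ_anti _ 2 1, k1, k2] at c00 c01
  simp only [Φ₁, map_add]
  linear_combination (exp := 1) c00 + c01

/-- The same Ricci component with its indices in the other order, which brings in the derivatives of
the boost coefficients Γ · 0 1. These are the other derivatives that the commutator of `K_Φ₁` and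
`U_Φ₁` produces. -/
lemma curvature_ku (h2 : ∀ x : B, x + x = 0 → x = 0) (hκ : T.κ = 0) (hρ : T.ρ = 0) :
    T.D 0 (T.Γ 2 0 1) + T.D 1 (T.Γ 2 0 1) - T.D 2 (T.Γ 0 0 1 + T.Γ 1 0 1) +
      (T.Γ 0 0 1 + T.Γ 1 0 1) *
        (T.Γ 0 0 2 + T.Γ 1 0 2 - T.Γ 2 0 1) = T.Φ₁ := by
  have k1 : T.Γ 1 1 2 = - T.Γ 0 0 2 - T.Γ 0 1 2 - T.Γ 1 0 2 := by
    simp only [κ] at hκ; linear_combination hκ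
  have k2 : T.Γ 2 1 2 = - T.Γ 2 0 2 := by simp only [ρ] at hρ; linear_combination hρ
  have c00 := T.ricci 2 0
  have c01 := T.ricci 2 1
  simp [Fin.sum_univ_three, Γ_self_of_two h2, T.Γ_anti _ 1 0, T.Γ_anti _ 2 0, T.Γ_anti _ 2 1,
    T.F_symm 2 0, T.F_symm 2 1, k1, k2] at c00 c01
  simp only [Φ₁, map_add]
  linear_combination (exp := 1) -c00 - c01

/-- The conditions κ = ρ = 0 make the bracket of k and u a multiple of k. -/
lemma comm_ku (h2 : ∀ x : B, x + x = 0 → x = 0) (hκ : T.κ = 0) (hρ : T.ρ = 0) (f : B) :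
    T.D 0 (T.D 2 f) + T.D 1 (T.D 2 f) - T.D 2 (T.D 0 f + T.D 1 f)
      = (T.Γ 2 0 1 - T.Γ 0 0 2 - T.Γ 1 0 2) * (T.D 0 f + T.D 1 f) := by
  have k1 : T.Γ 1 1 2 = - T.Γ 0 0 2 - T.Γ 0 1 2 - T.Γ 1 0 2 := by
    simp only [κ] at hκ; linear_combination hκ
  have k2 : T.Γ 2 1 2 = - T.Γ 2 0 2 := by simp only [ρ] at hρ; linear_combination hρ
  have c00 := T.comm 0 2 f
  have c01 := T.comm 1 2 f
  simp [Fin.sum_univ_three, Γ_self_of_two h2, T.Γ_anti _ 1 0, T.Γ_anti _ 2 0, T.Γ_anti _ 2 1,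
    k1, k2] at c00 c01
  simp only [map_add]
  linear_combination (exp := 1) c00 + c01

/-- The Goldberg–Sachs theorem for topological massive gravity: `Φ (k, u)² = 0`. -/
lemma Φ₁_sq_eq_zero (h2 : ∀ x : B, x + x = 0 → x = 0) (hκ : T.κ = 0) (hρ : T.ρ = 0) :
    5 * (T.Φ₁ * T.Φ₁) = 0 := by
  have h0 := Φ₀_eq_zero h2 hκ hρ
  have eK := K_Φ₁ h2 hκ hρ h0
  have eU := U_Φ₁ h2 hκ hρ h0
  have k1 : T.Γ 1 1 2 = - T.Γ 0 0 2 - T.Γ 0 1 2 - T.Γ 1 0 2 := by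
    simp only [κ] at hκ; linear_combination hκ
  have dK := congrArg (T.D 2) eK
  have dU0 := congrArg (T.D 0) eU
  have dU1 := congrArg (T.D 1) eU
  have c := comm_ku h2 hκ hρ T.Φ₁
  have kt := K_τ h2 hκ hρ
  have cu := curvature_ku h2 hκ hρ
  simp only [map_add, map_sub, map_neg, Derivation.leibniz, smul_eq_mul, k1, two_mul, T.D_μ]
    at dK dU0 dU1 kt cu c eU eK
  -- Integrability of the two equations for Φ₁. The derivative of 4 τ along k contributes -4 Φ₁² by
  -- `K_τ`, and the boost coefficients contribute -Φ₁² by `curvature_ku`; all else cancels.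
  linear_combination (exp := 1) dU0 + dU1 - dK - c + 4 * kt * T.Φ₁ - cu * T.Φ₁
    + (5 * T.Γ 0 0 2 + 4 * T.Γ 0 1 2 + T.Γ 1 0 2 + T.μ - 2 * T.Γ 2 0 1) * eK
    + (T.Γ 0 0 1 + T.Γ 1 0 1) * eU

/-! The vanishing of `κ` and `ρ` where `Φ (k, k) = Φ (k, u) = 0`. -/

section Converse

variable (h2 : ∀ x : B, x + x = 0 → x = 0) (h0 : T.Φ₀ = 0) (h1 : T.Φ₁ = 0)
include h2 h0 h1

/-- The combination of `K_Φ₁`, now with Φ₀ = Φ₁ = 0 and κ unknown. With ∇_k k = a k + κ u, and -κ l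
as the part of ∇_k u transverse to k, the terms Φ(u,u) and Φ(k,l) = -Φ(u,u)/2 add up to 3/2 κ
Φ(u,u). -/
lemma κ_mul_F₂₂ : 3 * (T.κ * T.F 2 2) = 0 := by
  have k1 : T.F 1 2 = - T.F 0 2 := by simp only [Φ₁] at h1; linear_combination h1
  have k3 : T.F 1 1 = - T.F 0 0 - 2 * T.F 0 1 := by
    simp only [Φ₀] at h0; linear_combination h0
  have k4 : T.F 2 2 = - 2 * T.F 0 0 - 2 * T.F 0 1 := by linear_combination T.F_trace + k3
  have c00 := T.curl₀ 0
  have c01 := T.curl₀ 1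
  have c10 := T.curl₁ 0
  have c11 := T.curl₁ 1
  simp [T.N_eq, Fin.sum_univ_three, Γ_self_of_two h2, T.Γ_anti _ 1 0, T.Γ_anti _ 2 0,
    T.Γ_anti _ 2 1, T.F_symm 1 0, T.F_symm 2 0, T.F_symm 2 1, k1, k3, k4, two_mul]
    at c00 c01 c10 c11
  simp only [κ, k4]
  linear_combination (exp := 1) 2 * (c00 + c01 + c10 + c11)

/-- The combination of `U_Φ₁`, read as an equation for ρ. -/
lemma ρ_mul_F₂₂ : 3 * (T.ρ * T.F 2 2) = 0 := by
  have k1 : T.F 1 2 = - T.F 0 2 := by simp only [Φ₁] at h1; linear_combination h1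
  have k3 : T.F 1 1 = - T.F 0 0 - 2 * T.F 0 1 := by
    simp only [Φ₀] at h0; linear_combination h0
  have k4 : T.F 2 2 = - 2 * T.F 0 0 - 2 * T.F 0 1 := by linear_combination T.F_trace + k3
  have c00 := T.curl₀ 2
  have c01 := T.curl₁ 2
  have c10 := T.curl₂ 0
  have c11 := T.curl₂ 1
  simp [T.N_eq, Fin.sum_univ_three, Γ_self_of_two h2, T.Γ_anti _ 1 0, T.Γ_anti _ 2 0,
    T.Γ_anti _ 2 1, T.F_symm 1 0, T.F_symm 2 0, T.F_symm 2 1, k1, k3, k4, two_mul]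
    at c00 c01 c10 c11
  simp only [ρ, k4]
  linear_combination (exp := 1) -2 * (c00 + c01 - 2 * c10 - 2 * c11)

section
variable (hS : T.F 2 2 = 0)
include hS

/-- When Φ(u,u) and hence Φ(k,l) vanish identically, the next component is Φ(l,u) = F 0 2, with l =
(e₀ - e₁)/2. It appears in the equation `curl₂` contracted with k. -/
lemma κ_mul_F₀₂ : T.κ * T.F 0 2 = 0 := by
  have k1 : T.F 1 2 = - T.F 0 2 := by simp only [Φ₁] at h1; linear_combination h1
  have k3 : 2 * T.F 0 1 = - T.F 0 0 - T.F 1 1 := by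
    simp only [Φ₀] at h0; linear_combination h0
  have k4 : T.F 1 1 = T.F 0 0 := by linear_combination hS - T.F_trace
  have k5 : T.F 0 1 = - T.F 0 0 := by
    have := h2 (T.F 0 1 + T.F 0 0) (by linear_combination k3 - k4)
    linear_combination this
  have c10 := T.curl₂ 0
  have c11 := T.curl₂ 1
  simp [T.N_eq, Fin.sum_univ_three, Γ_self_of_two h2, T.Γ_anti _ 1 0, T.Γ_anti _ 2 0,
    T.Γ_anti _ 2 1, T.F_symm 1 0, T.F_symm 2 0, T.F_symm 2 1, k1, k4, k5, hS]
    at c10 c11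
  simp only [κ]
  linear_combination (exp := 1) -c10 - c11

lemma ρ_mul_F₀₂ : T.ρ * T.F 0 2 = 0 := by
  have k1 : T.F 1 2 = - T.F 0 2 := by simp only [Φ₁] at h1; linear_combination h1
  have k3 : 2 * T.F 0 1 = - T.F 0 0 - T.F 1 1 := by
    simp only [Φ₀] at h0; linear_combination h0
  have k4 : T.F 1 1 = T.F 0 0 := by linear_combination hS - T.F_trace
  have k5 : T.F 0 1 = - T.F 0 0 := by
    have := h2 (T.F 0 1 + T.F 0 0) (by linear_combination k3 - k4)
    linear_combination this
  have c00 := T.curl₀ 0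
  have c01 := T.curl₁ 0
  have c10 := T.curl₂ 2
  simp [T.N_eq, Fin.sum_univ_three, Γ_self_of_two h2, T.Γ_anti _ 1 0, T.Γ_anti _ 2 0,
    T.Γ_anti _ 2 1, T.F_symm 1 0, T.F_symm 2 0, T.F_symm 2 1, k1, k4, k5, hS]
    at c00 c01 c10
  simp only [ρ]
  linear_combination (exp := 1) -(c00 + c01 + c10)

variable (hT : T.F 0 2 = 0)
include hT

/-- The last case: only Φ(l,l) = F 0 0 is left. -/
lemma κ_mul_F₀₀ : T.κ * T.F 0 0 = 0 := by
  have k1 : T.F 1 2 = - T.F 0 2 := by simp only [Φ₁] at h1; linear_combination h1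
  have k3 : 2 * T.F 0 1 = - T.F 0 0 - T.F 1 1 := by
    simp only [Φ₀] at h0; linear_combination h0
  have k4 : T.F 1 1 = T.F 0 0 := by linear_combination hS - T.F_trace
  have k5 : T.F 0 1 = - T.F 0 0 := by
    have := h2 (T.F 0 1 + T.F 0 0) (by linear_combination k3 - k4)
    linear_combination this
  have c10 := T.curl₂ 2
  simp [T.N_eq, Fin.sum_univ_three, Γ_self_of_two h2, T.Γ_anti _ 1 0, T.Γ_anti _ 2 0,
    T.Γ_anti _ 2 1, T.F_symm 1 0, T.F_symm 2 0, T.F_symm 2 1, k1, k4, k5, hS, hT]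
    at c10
  simp only [κ]
  linear_combination (exp := 1) c10

lemma ρ_mul_F₀₀ : T.ρ * T.F 0 0 = 0 := by
  have k1 : T.F 1 2 = - T.F 0 2 := by simp only [Φ₁] at h1; linear_combination h1
  have k3 : 2 * T.F 0 1 = - T.F 0 0 - T.F 1 1 := by
    simp only [Φ₀] at h0; linear_combination h0
  have k4 : T.F 1 1 = T.F 0 0 := by linear_combination hS - T.F_trace
  have k5 : T.F 0 1 = - T.F 0 0 := by
    have := h2 (T.F 0 1 + T.F 0 0) (by linear_combination k3 - k4)
    linear_combination this
  have c00 := T.curl₀ 2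
  simp [T.N_eq, Fin.sum_univ_three, Γ_self_of_two h2, T.Γ_anti _ 1 0, T.Γ_anti _ 2 0,
    T.Γ_anti _ 2 1, T.F_symm 1 0, T.F_symm 2 0, T.F_symm 2 1, k1, k4, k5, hS, hT]
    at c00
  simp only [ρ]
  linear_combination (exp := 1) -c00

end

end Converse

end TMGFrame

namespace LorentzMetric

variable {M : Type*} [TopologicalSpace M] [ChartedSpace E3 M] [IsManifold 𝓘(ℝ, E3) ∞ M]

/-! ### The Hodge dual of the Cotton tensor and the trace of the field equations -/

section volume

variable {g : LorentzMetric M} {p : M} {ε : Fin 3 → ℝ} {b : Fin 3 → TangentSpace 𝓘(ℝ, E3) p}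

lemma VolumeForm.swap_left (e : g.VolumeForm) (x y z : TangentSpace 𝓘(ℝ, E3) p) :
    e.form p ![y, x, z] = - e.form p ![x, y, z] := by
  rw [← (e.form p).map_swap ![x, y, z] (i := 0) (j := 1) (by decide)]
  congr 1; funext i; fin_cases i <;> rfl

lemma VolumeForm.swap_right (e : g.VolumeForm) (x y z : TangentSpace 𝓘(ℝ, E3) p) :
    e.form p ![x, z, y] = - e.form p ![x, y, z] := by
  rw [← (e.form p).map_swap ![x, y, z] (i := 1) (j := 2) (by decide)]
  congr 1; funext i; fin_cases i <;> rfl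

lemma VolumeForm.self_right (e : g.VolumeForm) (x y : TangentSpace 𝓘(ℝ, E3) p) :
    e.form p ![x, y, y] = 0 := by
  linarith [e.swap_right x y y]

lemma VolumeForm.self_left (e : g.VolumeForm) (x y : TangentSpace 𝓘(ℝ, E3) p) :
    e.form p ![x, x, y] = 0 := by
  linarith [e.swap_left x x y]

lemma VolumeForm.self_outer (e : g.VolumeForm) (x y : TangentSpace 𝓘(ℝ, E3) p) :
    e.form p ![x, y, x] = 0 := by
  rw [e.swap_right x x y, e.self_left, neg_zero]

/-- The volume form as a linear map of its third argument. -/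
noncomputable def VolumeForm.right (e : g.VolumeForm) (x y : TangentSpace 𝓘(ℝ, E3) p) :
    TangentSpace 𝓘(ℝ, E3) p →ₗ[ℝ] ℝ :=
  (e.form p).toMultilinearMap.toLinearMap ![x, y, 0] 2

lemma VolumeForm.right_apply (e : g.VolumeForm) (x y z : TangentSpace 𝓘(ℝ, E3) p) :
    e.right x y z = e.form p ![x, y, z] := by
  change e.form p (Function.update ![x, y, 0] 2 z) = _
  congr 1; funext i; fin_cases i <;> rfl

lemma IsOrthoTriple.hodgeCotton (hb : g.IsOrthoTriple p ε b) (e : g.VolumeForm)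
    (u v : TangentSpace 𝓘(ℝ, E3) p) :
    g.hodgeCotton e p u v = 1 / 2 * ∑ a, ∑ c, ε a * ε c * e.form p ![v, b a, b c]
      * g.cotton p u (b a) (b c) := by
  have h1 : ∀ x y : TangentSpace 𝓘(ℝ, E3) p,
      ∑ i, ∑ k, g.inv p i k * (e.form p ![v, frame p i, x] * g.cotton p u (frame p k) y)
        = ∑ a, ε a * (e.form p ![v, b a, x] * g.cotton p u (b a) y) := by
    intro x y
    have := hb.sum_inv ((e.right v x).smulRight ((g.cottonBilin p u).flip y))
    simp only [LinearMap.smulRight_apply, LinearMap.smul_apply, VolumeForm.right_apply,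
      LinearMap.flip_apply, smul_eq_mul] at this
    simp only [e.swap_right v x]
    simpa [cottonBilin] using this
  have h2 : ∀ x y : TangentSpace 𝓘(ℝ, E3) p,
      ∑ j, ∑ l, g.inv p j l * (e.form p ![v, x, frame p j] * g.cotton p u y (frame p l))
        = ∑ c, ε c * (e.form p ![v, x, b c] * g.cotton p u y (b c)) := by
    intro x y
    have := hb.sum_inv ((e.right v x).smulRight (g.cottonBilin p u y))
    simp only [LinearMap.smulRight_apply, LinearMap.smul_apply, VolumeForm.right_apply,
      smul_eq_mul] at this
    simpa [cottonBilin] using this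
  simp only [LorentzMetric.hodgeCotton]
  congr 1
  calc _ = ∑ j, ∑ l, g.inv p j l * ∑ i, ∑ k, g.inv p i k *
        (e.form p ![v, frame p i, frame p j] * g.cotton p u (frame p k) (frame p l)) := by
        simp only [Finset.mul_sum]
        symm
        refine Eq.trans (Finset.sum_congr rfl fun j _ => Finset.sum_comm) ?_
        refine Finset.sum_comm.trans ?_
        refine Finset.sum_congr rfl fun i _ => Finset.sum_congr rfl fun j _ => ?_
        refine Finset.sum_comm.trans ?_
        exact Finset.sum_congr rfl fun k _ => Finset.sum_congr rfl fun l _ => by ring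
    _ = ∑ a, ε a * ∑ j, ∑ l, g.inv p j l *
        (e.form p ![v, b a, frame p j] * g.cotton p u (b a) (frame p l)) := by
        simp only [h1, Finset.mul_sum]
        refine Eq.trans (Finset.sum_congr rfl fun i _ => Finset.sum_comm) ?_
        rw [Finset.sum_comm]
        exact Finset.sum_congr rfl fun i _ => Finset.sum_congr rfl fun j _ =>
          Finset.sum_congr rfl fun k _ => by ring
    _ = _ := by
        simp only [h2, Finset.mul_sum]
        exact Finset.sum_congr rfl fun i _ => Finset.sum_congr rfl fun j _ => by ring

/-- The trace is the totally antisymmetric part of the derivative of the Schouten tensor, which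
vanishes because that tensor is symmetric. -/
lemma IsOrthoTriple.hodgeCotton_trace (hb : g.IsOrthoTriple p ε b) (e : g.VolumeForm) :
    ∑ a, ε a * g.hodgeCotton e p (b a) (b a) = 0 := by
  simp only [hb.hodgeCotton, Fin.sum_univ_three, e.self_left, e.self_right, e.self_outer,
    LorentzMetric.cotton]
  rw [e.swap_right (b 0) (b 1) (b 2), e.swap_right (b 1) (b 0) (b 2),
    e.swap_right (b 2) (b 0) (b 1), e.swap_left (b 0) (b 1) (b 2),
    e.swap_left (b 0) (b 2) (b 1), e.swap_right (b 0) (b 1) (b 2),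
    g.nablaSchouten_symm (b 0) (b 2) (b 1), g.nablaSchouten_symm (b 1) (b 2) (b 0),
    g.nablaSchouten_symm (b 2) (b 1) (b 0)]
  ring

/-- The trace of the field equations reads -R/2 + 3Λ = 0. -/
lemma SolvesTMG.scalar {e : g.VolumeForm} {m Λ : ℝ} (h : g.SolvesTMG e m Λ) (p : M) :
    g.scalar p = 6 * Λ := by
  obtain ⟨b, hb⟩ := g.exists_isOrthoTriple p
  have h1 := hb.hodgeCotton_trace e
  have h2 := hb.scalar
  have h3 := fun i => h p (b i) (b i)
  have h4 := fun i => hb.2 i i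
  simp only [if_true] at h4
  simp only [Fin.sum_univ_three, Matrix.cons_val_zero, Matrix.cons_val_one, Matrix.cons_val_two,
    Matrix.head_cons, Matrix.tail_cons] at h1 h2
  have e0 := h3 0
  have e1 := h3 1
  have e2 := h3 2
  rw [h4] at e0 e1 e2
  simp at e0 e1 e2 h1 h2
  linear_combination (-2) * e0 - 2 * e1 + 2 * e2 - 2 * m⁻¹ * h1 - 2 * h2

/-- With R = 6Λ the left side of the field equations is exactly Φ. -/
lemma SolvesTMG.phi {e : g.VolumeForm} {m Λ : ℝ} (h : g.SolvesTMG e m Λ) (hm : m ≠ 0)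
    (u v : TangentSpace 𝓘(ℝ, E3) p) : m * g.phi p u v = g.hodgeCotton e p u v := by
  have h1 := h p u v
  rw [h.scalar p] at h1
  rw [phi_apply, LorentzMetric.tracefreeRicci, h.scalar p]
  field_simp at h1
  linear_combination h1 / 2

/-- The normalisation concerns bases with the timelike vector in last place; a transposition covers
the frames that have it in the middle. -/
lemma VolumeForm.sq (hb : g.IsOrthoTriple p ε b) (e : g.VolumeForm)
    (hε : ε = ![1, 1, -1] ∨ ε = ![1, -1, 1]) : e.form p ![b 0, b 1, b 2] ^ 2 = 1 := by
  rcases hε with rfl | rfl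
  · have := e.normalised p hb.basis (fun i j => by
      rw [hb.basis_apply, hb.basis_apply, hb.2, Matrix.diagonal_apply])
    rw [← this]; congr 2; funext i; fin_cases i <;> simp
  · have := e.normalised p (hb.basis.reindex (Equiv.swap 1 2)) (fun i j => by
      simp only [Basis.reindex_apply, hb.basis_apply, hb.2, Matrix.diagonal_apply]
      fin_cases i <;> fin_cases j <;> simp [Equiv.swap_apply_def])
    rw [← this, show (hb.basis.reindex (Equiv.swap 1 2) : Fin 3 → _) = ![b 0, b 2, b 1] by
      funext i; fin_cases i <;> simp [Equiv.swap_apply_def], e.swap_right (b 0) (b 1) (b 2), neg_sq]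

end volume

/-! ### Connection, Ricci tensor and field equations in an orthonormal frame -/

section frame

variable {g : LorentzMetric M} {V : Set M} {ε : Fin 3 → ℝ}
  {e : Fin 3 → ∀ p : M, TangentSpace 𝓘(ℝ, E3) p} {q : M}

/-- The connection coefficients `g (∇_{e i} (e j), e k)` of a frame. -/
noncomputable def frameΓ (g : LorentzMetric M) (e : Fin 3 → ∀ p : M, TangentSpace 𝓘(ℝ, E3) p)
    (i j k : Fin 3) : M → ℝ :=
  fun q => g.val q (g.nab (e i) (e j) q) (e k q)

/-- The components of the tracefree Ricci tensor in a frame. -/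
noncomputable def frameΦ (g : LorentzMetric M) (e : Fin 3 → ∀ p : M, TangentSpace 𝓘(ℝ, E3) p)
    (i j : Fin 3) : M → ℝ :=
  fun q => g.phi q (e i q) (e j q)

/-- The components of the covariant derivative of the tracefree Ricci tensor in a frame with
signs `ε`. -/
noncomputable def frameN (g : LorentzMetric M) (ε : Fin 3 → ℝ)
    (e : Fin 3 → ∀ p : M, TangentSpace 𝓘(ℝ, E3) p) (i j k : Fin 3) : M → ℝ :=
  fun q => lieD (e i) (g.frameΦ e j k) q - ∑ n, ε n * (g.frameΓ e i j n q * g.frameΦ e n k q)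
    - ∑ n, ε n * (g.frameΓ e i k n q * g.frameΦ e j n q)

variable (he : g.IsOrthoFrame V ε e)
include he

lemma IsOrthoFrame.smooth_Γ (i j k : Fin 3) : SmoothFnOn (g.frameΓ e i j k) V :=
  smoothFnOn_val g (smoothFieldOn_nab g he.isOpen (he.smooth i) (he.smooth j)) (he.smooth k)

lemma IsOrthoFrame.smooth_Φ (i j : Fin 3) : SmoothFnOn (g.frameΦ e i j) V :=
  he.smoothFnOn_phi (he.smooth i) (he.smooth j)

lemma IsOrthoFrame.lieD_val (X : ∀ p : M, TangentSpace 𝓘(ℝ, E3) p) (j k : Fin 3) (hq : q ∈ V) :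
    lieD X (fun q => g.val q (e j q) (e k q)) q = 0 := by
  rw [lieD_congr he.isOpen (f' := fun _ => if j = k then ε j else 0)
    (fun q hq => (he.ortho q hq).2 j k) hq, lieD_const]

lemma IsOrthoFrame.Γ_anti (i j k : Fin 3) (hq : q ∈ V) :
    g.frameΓ e i j k q = - g.frameΓ e i k j q := by
  have h := nab_metric (g := g) he.isOpen (he.smooth i) (he.smooth j) (he.smooth k) hq
  rw [he.lieD_val _ j k hq, g.symm q (e j q)] at h
  simp only [frameΓ]
  linarith

lemma IsOrthoFrame.nab_eq (i j : Fin 3) (hq : q ∈ V) :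
    g.nab (e i) (e j) q = ∑ n, (ε n * g.frameΓ e i j n q) • e n q :=
  ((he.ortho q hq).sum_val _).symm

lemma IsOrthoFrame.mlieBracket_eq (i j : Fin 3) (hq : q ∈ V) :
    mlieBracket 𝓘(ℝ, E3) (e i) (e j) q
      = ∑ n, (ε n * (g.frameΓ e i j n q - g.frameΓ e j i n q)) • e n q := by
  rw [nab_torsion (g := g) he.isOpen (he.smooth i) (he.smooth j) hq, he.nab_eq i j hq,
    he.nab_eq j i hq, ← Finset.sum_sub_distrib]
  exact Finset.sum_congr rfl fun n _ => by rw [← sub_smul, mul_sub]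

lemma IsOrthoFrame.lieD_comm (i j : Fin 3) {f : M → ℝ} (hf : SmoothFnOn f V) (hq : q ∈ V) :
    lieD (e i) (lieD (e j) f) q - lieD (e j) (lieD (e i) f) q
      = ∑ n, ε n * ((g.frameΓ e i j n q - g.frameΓ e j i n q) * lieD (e n) f q) := by
  have h := lieD_commutator he.isOpen (he.smooth i) (he.smooth j) hf hq
  refine h.trans ?_
  simp only [lieD, he.mlieBracket_eq i j hq, map_sum, map_smul, smul_eq_mul, mul_assoc]

lemma IsOrthoFrame.val_nab_nab (i j k l : Fin 3) (hq : q ∈ V) :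
    g.val q (g.nab (e i) (g.nab (e j) (e k)) q) (e l q) = lieD (e i) (g.frameΓ e j k l) q
      - ∑ n, ε n * (g.frameΓ e j k n q * g.frameΓ e i l n q) := by
  have h := nab_metric (g := g) he.isOpen (he.smooth i)
    (smoothFieldOn_nab g he.isOpen (he.smooth j) (he.smooth k)) (he.smooth l) hq
  have h' : g.val q (g.nab (e j) (e k) q) (g.nab (e i) (e l) q)
      = ∑ n, ε n * (g.frameΓ e j k n q * g.frameΓ e i l n q) := by
    rw [(he.ortho q hq).val_eq]
    simp only [frameΓ, mul_assoc]
  rw [h'] at h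
  change lieD (e i) (g.frameΓ e j k l) q = _ at h
  linarith

lemma IsOrthoFrame.ricci_eq (i k : Fin 3) (hq : q ∈ V) :
    g.ricci q (e i q) (e k q) = ∑ j, ε j * (lieD (e i) (g.frameΓ e j k j) q
      - lieD (e j) (g.frameΓ e i k j) q
      - ∑ n, ε n * (g.frameΓ e j k n q * g.frameΓ e i j n q
        - g.frameΓ e i k n q * g.frameΓ e j j n q)
      - ∑ n, ε n * ((g.frameΓ e i j n q - g.frameΓ e j i n q) * g.frameΓ e n k j q)) := by
  rw [(he.ortho q hq).ricci]
  refine Finset.sum_congr rfl fun j _ => ?_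
  rw [curvature_eq_curv he.isOpen (he.smooth i) (he.smooth j) (he.smooth k) hq]
  simp only [curv, Pi.sub_apply, map_sub, _root_.sub_apply]
  rw [he.val_nab_nab _ _ _ _ hq, he.val_nab_nab _ _ _ _ hq]
  have : g.val q (g.nab (mlieBracket 𝓘(ℝ, E3) (e i) (e j)) (e k) q) (e j q)
      = ∑ n, ε n * ((g.frameΓ e i j n q - g.frameΓ e j i n q) * g.frameΓ e n k j q) := by
    simp only [nab, he.mlieBracket_eq i j hq, map_sum, map_smul, _root_.sum_apply,
      _root_.smul_apply, smul_eq_mul, mul_assoc]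
    rfl
  rw [this]
  simp only [mul_sub, Finset.sum_sub_distrib]
  ring

lemma IsOrthoFrame.phi_nab_left (i j k : Fin 3) (hq : q ∈ V) :
    g.phi q (g.nab (e i) (e j) q) (e k q) = ∑ n, ε n * (g.frameΓ e i j n q * g.frameΦ e n k q) := by
  rw [he.nab_eq i j hq]
  simp only [map_sum, map_smul, LinearMap.sum_apply, LinearMap.smul_apply, smul_eq_mul, mul_assoc]
  rfl

lemma IsOrthoFrame.phi_nab_right (i j k : Fin 3) (hq : q ∈ V) :
    g.phi q (e j q) (g.nab (e i) (e k) q) = ∑ n, ε n * (g.frameΓ e i k n q * g.frameΦ e j n q) := by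
  rw [he.nab_eq i k hq]
  simp only [map_sum, map_smul, smul_eq_mul, mul_assoc]
  rfl

variable {o : g.VolumeForm} {m Λ : ℝ}

/-- The Schouten tensor is -Φ - (Λ/2) g, and the metric is parallel. -/
lemma IsOrthoFrame.nablaSchouten_eq (h : g.SolvesTMG o m Λ) (i j k : Fin 3) (hq : q ∈ V) :
    g.nablaSchouten q (e i q) (e j q) (e k q) = - g.frameN ε e i j k q := by
  have hs : ∀ (p : M) (u v : TangentSpace 𝓘(ℝ, E3) p),
      g.schouten p u v = - g.phi p u v - Λ / 2 * g.val p u v := by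
    intro p u v
    rw [schouten, h.scalar, phi_apply]; ring
  rw [LorentzMetric.nablaSchouten_eq _ ((he.smooth j).diffAt he.isOpen hq)
    ((he.smooth k).diffAt he.isOpen hq)]
  have h1 : mvfderiv 𝓘(ℝ, E3) (fun q => g.schouten q (e j q) (e k q)) q (e i q)
      = - lieD (e i) (g.frameΦ e j k) q := by
    change lieD (e i) _ q = _
    have c : ∀ p ∈ V, g.schouten p (e j p) (e k p)
        = (-1) * g.frameΦ e j k p + (- (Λ / 2) * (if j = k then ε j else 0)) := by
      intro p hp
      rw [hs, (he.ortho p hp).2, frameΦ]; ring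
    rw [lieD_congr he.isOpen c hq, lieD_add (f := fun p => (-1) * g.frameΦ e j k p) he.isOpen
        (contMDiffOn_const.mul (he.smooth_Φ j k)) contMDiffOn_const hq, lieD_mul he.isOpen contMDiffOn_const (he.smooth_Φ j k) hq,
      lieD_const, lieD_const]
    ring
  have h2 := he.Γ_anti i j k hq
  have h3 := he.phi_nab_left i j k hq
  have h4 := he.phi_nab_right i j k hq
  simp only [frameΓ, nab] at h2 h3 h4
  rw [h1, hs, hs, frameN, h3, h4, g.symm q (e j q)]
  simp only [frameΓ, nab]
  linear_combination (Λ / 2) * h2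

/-- The field equations multiplied by the value v = ±1 of the volume form on the frame: since v² = 1
this moves v to the side of the mass, and m v plays the role of a locally constant mass. -/
lemma IsOrthoFrame.curl_eq (h : g.SolvesTMG o m Λ) (hm : m ≠ 0)
    (hε : ε = ![1, 1, -1] ∨ ε = ![1, -1, 1]) (a : Fin 3) (hq : q ∈ V) :
    m * o.form q ![e 0 q, e 1 q, e 2 q] * g.frameΦ e a 0 q
        = - (ε 1 * ε 2 * (g.frameN ε e 1 2 a q - g.frameN ε e 2 1 a q)) ∧
      m * o.form q ![e 0 q, e 1 q, e 2 q] * g.frameΦ e a 1 q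
        = - (ε 2 * ε 0 * (g.frameN ε e 2 0 a q - g.frameN ε e 0 2 a q)) ∧
      m * o.form q ![e 0 q, e 1 q, e 2 q] * g.frameΦ e a 2 q
        = - (ε 0 * ε 1 * (g.frameN ε e 0 1 a q - g.frameN ε e 1 0 a q)) := by
  have hv := VolumeForm.sq (he.ortho q hq) o hε
  have hb := he.ortho q hq
  have hΦ := fun b => h.phi hm (e a q) (e b q)
  simp only [hb.hodgeCotton, cotton, he.nablaSchouten_eq h _ _ _ hq, Fin.sum_univ_three] at hΦ
  have h0 := hΦ 0
  have h1 := hΦ 1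
  have h2 := hΦ 2
  rw [o.swap_right (e 0 q) (e 1 q) (e 2 q)] at h0
  rw [o.swap_right (e 1 q) (e 0 q) (e 2 q), o.swap_left (e 0 q) (e 1 q) (e 2 q)] at h1
  rw [o.swap_right (e 2 q) (e 0 q) (e 1 q), o.swap_left (e 0 q) (e 2 q) (e 1 q),
    o.swap_right (e 0 q) (e 1 q) (e 2 q)] at h2
  simp only [o.self_left, o.self_right, o.self_outer] at h0 h1 h2
  refine ⟨?_, ?_, ?_⟩
  · simp only [frameΦ]
    linear_combination o.form q ![e 0 q, e 1 q, e 2 q] * h0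
      - ε 1 * ε 2 * (g.frameN ε e 1 2 a q - g.frameN ε e 2 1 a q) * hv
  · simp only [frameΦ]
    linear_combination o.form q ![e 0 q, e 1 q, e 2 q] * h1
      - ε 2 * ε 0 * (g.frameN ε e 2 0 a q - g.frameN ε e 0 2 a q) * hv
  · simp only [frameΦ]
    linear_combination o.form q ![e 0 q, e 1 q, e 2 q] * h2
      - ε 0 * ε 1 * (g.frameN ε e 0 1 a q - g.frameN ε e 1 0 a q) * hv

/-- The value of the volume form on an orthonormal frame is locally constant. -/
lemma IsOrthoFrame.lieD_vol (o : g.VolumeForm) (hε : ε = ![1, 1, -1] ∨ ε = ![1, -1, 1])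
    (X : ∀ p : M, TangentSpace 𝓘(ℝ, E3) p) (hq : q ∈ V) :
    lieD X (fun q => o.form q ![e 0 q, e 1 q, e 2 q]) q = 0 := by
  have hs := o.smooth V (e 0) (e 1) (e 2) he.isOpen (he.smooth 0) (he.smooth 1) (he.smooth 2)
  -- Differentiating v² = 1 gives 2 v · D v = 0, and v is invertible.
  have h := lieD_mul (X := X) he.isOpen hs hs hq
  rw [lieD_congr he.isOpen (f' := fun _ => 1)
    (fun p hp => by have := VolumeForm.sq (he.ortho p hp) o hε; simpa [sq] using this) hq,
    lieD_const] at h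
  have hv := VolumeForm.sq (he.ortho q hq) o hε
  linear_combination (-lieD X (fun q => o.form q ![e 0 q, e 1 q, e 2 q]) q) * hv
    - (1 / 2 : ℝ) * o.form q ![e 0 q, e 1 q, e 2 q] * h

end frame

/-! ### The algebra of smooth complex functions on an open set -/

section smoothC

variable {V : Set M}

/-- The real part (c = -1) and the imaginary part (c = 1) of a product of complex functions both
have this shape. -/
lemma lieD_mul_add_mul {X : ∀ p : M, TangentSpace 𝓘(ℝ, E3) p} {F F' G G' : M → ℝ} (hV : IsOpen V)
    (hF : SmoothFnOn F V) (hF' : SmoothFnOn F' V) (hG : SmoothFnOn G V) (hG' : SmoothFnOn G' V)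
    (c : ℝ) {q : M} (hq : q ∈ V) :
    lieD X (fun p => F p * F' p + c * (G p * G' p)) q
      = F q * lieD X F' q + lieD X F q * F' q + c * (G q * lieD X G' q + lieD X G q * G' q) := by
  rw [lieD_add (f := fun p => F p * F' p) (f' := fun p => c * (G p * G' p)) hV (hF.mul hF')
    (contMDiffOn_const.mul (hG.mul hG')) hq, lieD_mul hV hF hF' hq,
    lieD_mul (f := fun _ => c) (f' := fun p => G p * G' p) hV contMDiffOn_const (hG.mul hG') hq,
    lieD_mul hV hG hG' hq, lieD_const]
  ring

open Classical in
/-- Extension by zero of a function on `V`. -/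
noncomputable def extendZero (f : V → ℝ) : M → ℝ := fun q => if h : q ∈ V then f ⟨q, h⟩ else 0

lemma extendZero_apply (f : V → ℝ) {q : M} (hq : q ∈ V) : extendZero f q = f ⟨q, hq⟩ := dif_pos hq

lemma smoothFnOn_extendZero {f : V → ℝ} {F : M → ℝ} (hF : SmoothFnOn F V) (h : ∀ q : V, f q = F q) :
    SmoothFnOn (extendZero f) V :=
  hF.congr fun q hq => (extendZero_apply f hq).trans (h ⟨q, hq⟩)

/-- The algebra of smooth complex-valued functions on `V`. -/
noncomputable def smoothC (V : Set M) : Subalgebra ℂ (V → ℂ) where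
  -- Elements are functions on the subtype `V`, while smoothness is stated for functions on `M`; the
  -- extension by zero matters only through its values on `V`.
  carrier := {f | SmoothFnOn (extendZero fun q => (f q).re) V ∧
    SmoothFnOn (extendZero fun q => (f q).im) V}
  mul_mem' {f f'} hf hf' :=
    ⟨smoothFnOn_extendZero ((hf.1.mul hf'.1).sub (hf.2.mul hf'.2)) fun q => by
        simp [extendZero_apply _ q.2],
      smoothFnOn_extendZero ((hf.1.mul hf'.2).add (hf.2.mul hf'.1)) fun q => by
        simp [extendZero_apply _ q.2]⟩
  add_mem' {f f'} hf hf' :=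
    ⟨smoothFnOn_extendZero (hf.1.add hf'.1) fun q => by simp [extendZero_apply _ q.2],
      smoothFnOn_extendZero (hf.2.add hf'.2) fun q => by simp [extendZero_apply _ q.2]⟩
  algebraMap_mem' c :=
    ⟨smoothFnOn_extendZero (contMDiffOn_const (c := c.re)) fun q => by simp,
      smoothFnOn_extendZero (contMDiffOn_const (c := c.im)) fun q => by simp⟩

/-- The real part of a smooth complex-valued function on `V`, extended by zero. -/
noncomputable def rePart (f : smoothC V) : M → ℝ := extendZero fun q => (f.1 q).re

/-- The imaginary part of a smooth complex-valued function on `V`, extended by zero. -/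
noncomputable def imPart (f : smoothC V) : M → ℝ := extendZero fun q => (f.1 q).im

lemma rePart_apply (f : smoothC V) {q : M} (hq : q ∈ V) : rePart f q = (f.1 ⟨q, hq⟩).re :=
  extendZero_apply _ hq

lemma imPart_apply (f : smoothC V) {q : M} (hq : q ∈ V) : imPart f q = (f.1 ⟨q, hq⟩).im :=
  extendZero_apply _ hq

lemma smooth_rePart (f : smoothC V) : SmoothFnOn (rePart f) V := f.2.1

lemma smooth_imPart (f : smoothC V) : SmoothFnOn (imPart f) V := f.2.2

/-- A smooth complex-valued function on `V` with given real and imaginary parts. -/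
noncomputable def ofReIm {F G : M → ℝ} (hF : SmoothFnOn F V) (hG : SmoothFnOn G V) : smoothC V :=
  ⟨fun q => ⟨F q, G q⟩, smoothFnOn_extendZero hF fun _ => rfl, smoothFnOn_extendZero hG fun _ => rfl⟩

/-- A real smooth function on `V`, as a complex-valued one. -/
noncomputable def ofRe {F : M → ℝ} (hF : SmoothFnOn F V) : smoothC V :=
  ofReIm hF contMDiffOn_const (G := fun _ => 0)

variable {X : ∀ p : M, TangentSpace 𝓘(ℝ, E3) p}

/-- The derivation of the algebra of smooth complex-valued functions on `V` along a smooth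
vector field. -/
noncomputable def derivC (hV : IsOpen V) (hX : SmoothFieldOn ∞ X V) :
    Derivation ℂ (smoothC V) (smoothC V) :=
  Derivation.mk'
    { toFun := fun f => ofReIm (smoothFnOn_lieD hV hX (smooth_rePart f))
        (smoothFnOn_lieD hV hX (smooth_imPart f))
      map_add' := fun f f' => by
        apply Subtype.ext
        funext q
        apply Complex.ext
        · change lieD X (rePart (f + f')) q = lieD X (rePart f) q + lieD X (rePart f') q
          rw [← lieD_add hV (smooth_rePart f) (smooth_rePart f') q.2]
          exact lieD_congr hV (fun p hp => by simp [rePart_apply _ hp]) q.2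
        · change lieD X (imPart (f + f')) q = lieD X (imPart f) q + lieD X (imPart f') q
          rw [← lieD_add hV (smooth_imPart f) (smooth_imPart f') q.2]
          exact lieD_congr hV (fun p hp => by simp [imPart_apply _ hp]) q.2
      map_smul' := fun c f => by
        have hc : ∀ c : ℝ, SmoothFnOn (fun _ : M => c) V := fun c => contMDiffOn_const
        apply Subtype.ext
        funext q
        apply Complex.ext
        · have h := lieD_mul_add_mul (X := X) hV (hc c.re) (smooth_rePart f) (hc c.im)
            (smooth_imPart f) (-1) q.2
          rw [lieD_const, lieD_const] at h
          change lieD X (rePart (c • f)) q = c.re * lieD X (rePart f) q - c.im * lieD X (imPart f) q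
          rw [lieD_congr hV (fun p hp => ?_) q.2, h]
          · ring
          · simp [rePart_apply _ hp, imPart_apply _ hp]; ring
        · have h := lieD_mul_add_mul (X := X) hV (hc c.re) (smooth_imPart f) (hc c.im)
            (smooth_rePart f) 1 q.2
          rw [lieD_const, lieD_const] at h
          change lieD X (imPart (c • f)) q = c.re * lieD X (imPart f) q + c.im * lieD X (rePart f) q
          rw [lieD_congr hV (fun p hp => ?_) q.2, h]
          · ring
          · simp [rePart_apply _ hp, imPart_apply _ hp] }
    (fun f f' => by
      apply Subtype.ext
      funext q
      apply Complex.ext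
      · have h := lieD_mul_add_mul (X := X) hV (smooth_rePart f) (smooth_rePart f')
          (smooth_imPart f) (smooth_imPart f') (-1) q.2
        change lieD X (rePart (f * f')) q
          = ((f.1 q).re * lieD X (rePart f') q - (f.1 q).im * lieD X (imPart f') q)
            + ((f'.1 q).re * lieD X (rePart f) q - (f'.1 q).im * lieD X (imPart f) q)
        rw [lieD_congr hV (fun p hp => ?_) q.2, h]
        · simp only [rePart_apply _ q.2, imPart_apply _ q.2]; ring
        · simp [rePart_apply _ hp, imPart_apply _ hp]; ring
      · have h := lieD_mul_add_mul (X := X) hV (smooth_rePart f) (smooth_imPart f')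
          (smooth_imPart f) (smooth_rePart f') 1 q.2
        change lieD X (imPart (f * f')) q
          = ((f.1 q).re * lieD X (imPart f') q + (f.1 q).im * lieD X (rePart f') q)
            + ((f'.1 q).re * lieD X (imPart f) q + (f'.1 q).im * lieD X (rePart f) q)
        rw [lieD_congr hV (fun p hp => ?_) q.2, h]
        · simp only [rePart_apply _ q.2, imPart_apply _ q.2]; ring
        · simp [rePart_apply _ hp, imPart_apply _ hp])

lemma derivC_ofRe (hV : IsOpen V) (hX : SmoothFieldOn ∞ X V) {F : M → ℝ} (hF : SmoothFnOn F V) :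
    derivC hV hX (ofRe hF) = ofRe (smoothFnOn_lieD hV hX hF) := by
  apply Subtype.ext
  funext q
  apply Complex.ext
  · exact lieD_congr hV (fun p hp => rePart_apply _ hp) q.2
  · change lieD X (imPart (ofRe hF)) q = 0
    rw [lieD_congr hV (f' := fun _ => 0) (fun p hp => imPart_apply _ hp) q.2, lieD_const]

lemma rePart_derivC (hV : IsOpen V) (hX : SmoothFieldOn ∞ X V) (f : smoothC V) {q : M}
    (hq : q ∈ V) : rePart (derivC hV hX f) q = lieD X (rePart f) q :=
  rePart_apply _ hq

lemma imPart_derivC (hV : IsOpen V) (hX : SmoothFieldOn ∞ X V) (f : smoothC V) {q : M}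
    (hq : q ∈ V) : imPart (derivC hV hX f) q = lieD X (imPart f) q :=
  imPart_apply _ hq

end smoothC

section evaluation

variable {V : Set M}

/-- Evaluation of a smooth complex-valued function at a point. -/
noncomputable def evalC (q : V) : smoothC V →ₐ[ℂ] ℂ :=
  (Pi.evalAlgHom ℂ (fun _ : V => ℂ) q).comp (smoothC V).val

lemma smoothC_ext {f f' : smoothC V} (h : ∀ q, evalC q f = evalC q f') : f = f' :=
  Subtype.ext (funext h)

@[simp]
lemma evalC_ofRe {F : M → ℝ} (hF : SmoothFnOn F V) (q : V) : evalC q (ofRe hF) = (F q : ℂ) := rfl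

@[simp]
lemma evalC_sign (q : V) (i : Fin 3) : evalC q (![1, -1, 1] i) = ![1, -1, 1] i := by
  match i with
  | 0 => simp
  | 1 => simp
  | 2 => simp

lemma evalC_derivC {X : ∀ p : M, TangentSpace 𝓘(ℝ, E3) p} (hV : IsOpen V)
    (hX : SmoothFieldOn ∞ X V) (f : smoothC V) (q : V) : evalC q (derivC hV hX f)
      = lieD X (rePart f) q + lieD X (imPart f) q * Complex.I :=
  Complex.mk_eq_add_mul_I _ _

end evaluation

/-! ### From an orthonormal frame to a `TMGFrame` -/

section frame

variable {g : LorentzMetric M} {V : Set M} {ε : Fin 3 → ℝ}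
  {e : Fin 3 → ∀ p : M, TangentSpace 𝓘(ℝ, E3) p}

lemma IsOrthoFrame.smooth_N (he : g.IsOrthoFrame V ε e) (i j k : Fin 3) :
    SmoothFnOn (g.frameN ε e i j k) V := by
  have hs : ∀ F : Fin 3 → M → ℝ, (∀ n, SmoothFnOn (F n) V) →
      SmoothFnOn (fun q => ∑ n, ε n * F n q) V := fun F hF => by
    have h := fun n => (contMDiffOn_const (c := ε n)).mul (hF n)
    simp only [Fin.sum_univ_three]
    exact ((h 0).add (h 1)).add (h 2)
  refine ((smoothFnOn_lieD he.isOpen (he.smooth i) (he.smooth_Φ j k)).sub (hs _ fun n => ?_)).sub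
    (hs _ fun n => ?_)
  · exact (he.smooth_Γ i j n).mul (he.smooth_Φ n k)
  · exact (he.smooth_Γ i k n).mul (he.smooth_Φ j n)

lemma IsOrthoFrame.derivC_comm (he : g.IsOrthoFrame V ε e) (i j : Fin 3) (f : smoothC V) (q : V) :
    evalC q (derivC he.isOpen (he.smooth i) (derivC he.isOpen (he.smooth j) f))
      - evalC q (derivC he.isOpen (he.smooth j) (derivC he.isOpen (he.smooth i) f))
      = ∑ n, (ε n : ℂ) * (((g.frameΓ e i j n q : ℂ) - g.frameΓ e j i n q)
        * evalC q (derivC he.isOpen (he.smooth n) f)) := by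
  simp only [evalC_derivC]
  rw [lieD_congr he.isOpen (fun p hp => rePart_derivC he.isOpen (he.smooth j) f hp) q.2,
    lieD_congr he.isOpen (fun p hp => rePart_derivC he.isOpen (he.smooth i) f hp) q.2,
    lieD_congr he.isOpen (fun p hp => imPart_derivC he.isOpen (he.smooth j) f hp) q.2,
    lieD_congr he.isOpen (fun p hp => imPart_derivC he.isOpen (he.smooth i) f hp) q.2]
  have h1 := congrArg (fun x : ℝ => (x : ℂ)) (he.lieD_comm i j (smooth_rePart f) q.2)
  have h2 := congrArg (fun x : ℝ => (x : ℂ)) (he.lieD_comm i j (smooth_imPart f) q.2)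
  simp only [Complex.ofReal_sub, Complex.ofReal_sum, Complex.ofReal_mul] at h1 h2
  simp only [mul_add, Finset.sum_add_distrib]
  rw [← h1]
  have h3 : ∑ n, (ε n : ℂ) * (((g.frameΓ e i j n q : ℂ) - g.frameΓ e j i n q)
      * (lieD (e n) (imPart f) q * Complex.I)) = (∑ n, (ε n : ℂ) * (((g.frameΓ e i j n q : ℂ)
        - g.frameΓ e j i n q) * lieD (e n) (imPart f) q)) * Complex.I := by
    rw [Finset.sum_mul]; exact Finset.sum_congr rfl fun n _ => by ring
  rw [h3, ← h2]
  ring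

variable {o : g.VolumeForm} {m Λ : ℝ}

/-- The equations of topological massive gravity in a smooth orthonormal frame, rescaled by complex
factors to have signs `(1, -1, 1)`. -/
noncomputable def IsOrthoFrame.tmgFrame (he : g.IsOrthoFrame V ε e) (h : g.SolvesTMG o m Λ)
    (hm : m ≠ 0) (hε : ε = ![1, 1, -1] ∨ ε = ![1, -1, 1]) (c : Fin 3 → ℂ)
    (hc : ∀ i, (ε i : ℂ) = ![1, -1, 1] i * (c i * c i)) (hcc : ∀ i, c i * c i * (c i * c i) = 1)
    (hcp : c 0 * c 1 * c 2 * (c 0 * c 1 * c 2) = 1) : TMGFrame (smoothC V) where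
  -- The complex frame is E_i = c_i e_i, so each index brings one factor c_i. By `hc` and `hcc`,
  -- g(E_i, E_i) = ε_i c_i² is the required sign.
  D i := c i • derivC he.isOpen (he.smooth i)
  Γ i j k := (c i * c j * c k) • ofRe (he.smooth_Γ i j k)
  F i j := (c i * c j) • ofRe (he.smooth_Φ i j)
  r := algebraMap ℂ _ (2 * Λ)
  -- The mass multiplied by the volume form on (E₀, E₁, E₂).
  μ := (m * (c 0 * c 1 * c 2)) • ofRe (o.smooth V (e 0) (e 1) (e 2) he.isOpen (he.smooth 0)
    (he.smooth 1) (he.smooth 2))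
  N i j k := (c i * c j * c k) • ofRe (he.smooth_N i j k)
  Γ_anti i j k := smoothC_ext fun q => by
    simp only [he.Γ_anti i j k q.2, map_neg, map_smul, evalC_ofRe, smul_eq_mul, Complex.ofReal_neg]
    ring
  F_symm i j := smoothC_ext fun q => by
    simp only [frameΦ, g.phi_symm (e i q) (e j q), map_smul, evalC_ofRe, smul_eq_mul]
    ring
  D_μ i := smoothC_ext fun q => by
    simp [derivC_ofRe, he.lieD_vol o hε _ q.2]
  comm i j f := smoothC_ext fun q => by
    have h1 := he.derivC_comm i j f q
    simp only [map_sub, map_sum, map_mul, map_smul, evalC_sign, Derivation.smul_apply, smul_eq_mul,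
      evalC_ofRe, Derivation.map_smul]
    calc _ = c i * c j * (evalC q (derivC he.isOpen (he.smooth i) (derivC he.isOpen (he.smooth j) f))
      - evalC q (derivC he.isOpen (he.smooth j) (derivC he.isOpen (he.smooth i) f))) := by ring
      _ = _ := by
        rw [h1, Finset.mul_sum]
        exact Finset.sum_congr rfl fun n _ => by rw [hc]; ring
  ricci i k := smoothC_ext fun q => by
    have h1 := congrArg (fun x : ℝ => (x : ℂ)) (he.ricci_eq i k q.2)
    have h2 : g.ricci q (e i q) (e k q) = g.frameΦ e i k q + 2 * Λ * (if i = k then ε i else 0) := by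
      rw [← (he.ortho q q.2).2 i k, frameΦ, phi_apply, tracefreeRicci, h.scalar]; ring
    simp only [h2, Complex.ofReal_add, Complex.ofReal_sub, Complex.ofReal_sum, Complex.ofReal_mul,
      Complex.ofReal_ofNat] at h1
    simp only [map_add, map_sub, map_sum, map_mul, map_smul, evalC_sign, Derivation.smul_apply,
      smul_eq_mul, evalC_ofRe, Derivation.map_smul, derivC_ofRe]
    calc _ = c i * c k * ((g.frameΦ e i k q : ℂ) + 2 * Λ * ((if i = k then ε i else 0 : ℝ) : ℂ)) := by
          split_ifs with hik
          · subst hik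
            rw [hc]; simp
            linear_combination (-(2 * Λ * ![1, -1, 1] i) : ℂ) * hcc i
          · simp
      _ = _ := by
        rw [h1, Finset.mul_sum]
        refine Finset.sum_congr rfl fun j _ => ?_
        have e1 : ∀ x : Fin 3 → ℂ, (∑ n, (ε n : ℂ) * x n)
          = ∑ n, ![1, -1, 1] n * (c n * c n * x n) :=
          fun x => Finset.sum_congr rfl fun n _ => by rw [hc]; ring
        rw [e1, e1, hc]
        simp only [mul_sub, Finset.mul_sum]
        congr 1
        · congr 1
          · ring
          · exact Finset.sum_congr rfl fun n _ => by ring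
        · exact Finset.sum_congr rfl fun n _ => by ring
  F_trace := smoothC_ext fun q => by
    have h1 := congrArg (fun x : ℝ => (x : ℂ)) (he.ortho q q.2).phi_trace
    simp only [Fin.sum_univ_three, Complex.ofReal_add, Complex.ofReal_mul, hc] at h1
    simp [frameΦ] at h1 ⊢
    linear_combination h1
  N_eq i j k := smoothC_ext fun q => by
    simp only [map_sub, map_sum, map_mul, map_smul, evalC_sign, Derivation.smul_apply,
      smul_eq_mul, evalC_ofRe, Derivation.map_smul, derivC_ofRe, frameN, Complex.ofReal_sub, Complex.ofReal_sum,
      Complex.ofReal_mul, mul_sub, Finset.mul_sum]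
    congr 1
    · congr 1
      · ring
      · exact Finset.sum_congr rfl fun n _ => by rw [hc]; ring
    · exact Finset.sum_congr rfl fun n _ => by rw [hc]; ring
  curl₀ a := smoothC_ext fun q => by
    have h1 := congrArg (fun x : ℝ => (x : ℂ)) (he.curl_eq h hm hε a q.2).1
    simp only [Complex.ofReal_neg, Complex.ofReal_sub, Complex.ofReal_mul, hc] at h1
    simp at h1 ⊢
    linear_combination c a * c 0 * (c 0 * c 1 * c 2) * h1
      + c a * c 1 * c 2 * (g.frameN ε e 1 2 a q - g.frameN ε e 2 1 a q) * hcp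
  curl₁ a := smoothC_ext fun q => by
    have h1 := congrArg (fun x : ℝ => (x : ℂ)) (he.curl_eq h hm hε a q.2).2.1
    simp only [Complex.ofReal_neg, Complex.ofReal_sub, Complex.ofReal_mul, hc] at h1
    simp at h1 ⊢
    linear_combination c a * c 1 * (c 0 * c 1 * c 2) * h1
      + c a * c 0 * c 2 * (g.frameN ε e 0 2 a q - g.frameN ε e 2 0 a q) * hcp
  curl₂ a := smoothC_ext fun q => by
    have h1 := congrArg (fun x : ℝ => (x : ℂ)) (he.curl_eq h hm hε a q.2).2.2
    simp only [Complex.ofReal_neg, Complex.ofReal_sub, Complex.ofReal_mul, hc] at h1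
    simp at h1 ⊢
    linear_combination c a * c 2 * (c 0 * c 1 * c 2) * h1
      + c a * c 0 * c 1 * (g.frameN ε e 0 1 a q - g.frameN ε e 1 0 a q) * hcp

end frame

lemma smoothC_add_self {V : Set M} (x : smoothC V) (h : x + x = 0) : x = 0 :=
  smoothC_ext fun q => by
    have := congrArg (evalC q) h
    rw [map_add, map_zero, add_self_eq_zero] at this
    rw [this, map_zero]

lemma evalC_three {V : Set M} (q : V) : evalC q 3 = 3 := map_ofNat _ _

/-! ### The two implications of the Goldberg–Sachs theorem in null and timelike frames -/

section frame

variable {g : LorentzMetric M} {V : Set M} {e : Fin 3 → ∀ p : M, TangentSpace 𝓘(ℝ, E3) p} {q : M}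
  {o : g.VolumeForm} {m Λ : ℝ}

/-- The equations of topological massive gravity in a frame with signs `(1, -1, 1)`. -/
noncomputable def IsOrthoFrame.nullTMG (he : g.IsOrthoFrame V ![1, -1, 1] e)
    (h : g.SolvesTMG o m Λ) (hm : m ≠ 0) : TMGFrame (smoothC V) :=
  he.tmgFrame h hm (Or.inr rfl) (fun _ => 1)
    (fun i => by match i with | 0 => simp | 1 => simp | 2 => simp) (by simp) (by simp)

/-- The equations of topological massive gravity in a frame with signs `(1, 1, -1)`. -/
noncomputable def IsOrthoFrame.timelikeTMG (he : g.IsOrthoFrame V ![1, 1, -1] e)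
    (h : g.SolvesTMG o m Λ) (hm : m ≠ 0) : TMGFrame (smoothC V) :=
  -- In the frame (e₀, i e₁, i e₂) the vector k = e₀ + i e₁ is complex null, and u = i e₂ is a
  -- multiple of the timelike unit vector.
  he.tmgFrame h hm (Or.inl rfl) ![1, Complex.I, Complex.I]
    (fun i => by match i with | 0 => simp | 1 => simp | 2 => simp)
    (fun i => by match i with | 0 => simp | 1 => simp | 2 => simp) (by simp)

lemma IsOrthoFrame.evalC_nullTMG_Γ (he : g.IsOrthoFrame V ![1, -1, 1] e) (h : g.SolvesTMG o m Λ)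
    (hm : m ≠ 0) (i j k : Fin 3) (q : V) :
    evalC q ((he.nullTMG h hm).Γ i j k) = (g.frameΓ e i j k q : ℂ) := by
  simp [nullTMG, tmgFrame]

lemma IsOrthoFrame.evalC_nullTMG_F (he : g.IsOrthoFrame V ![1, -1, 1] e) (h : g.SolvesTMG o m Λ)
    (hm : m ≠ 0) (i j : Fin 3) (q : V) :
    evalC q ((he.nullTMG h hm).F i j) = (g.frameΦ e i j q : ℂ) := by
  simp [nullTMG, tmgFrame]

lemma IsOrthoFrame.evalC_timelikeTMG_Γ (he : g.IsOrthoFrame V ![1, 1, -1] e)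
    (h : g.SolvesTMG o m Λ) (hm : m ≠ 0) (i j k : Fin 3) (q : V) :
    evalC q ((he.timelikeTMG h hm).Γ i j k) = ![1, Complex.I, Complex.I] i *
      ![1, Complex.I, Complex.I] j * ![1, Complex.I, Complex.I] k * (g.frameΓ e i j k q : ℂ) := by
  simp [timelikeTMG, tmgFrame]

lemma IsOrthoFrame.evalC_timelikeTMG_F (he : g.IsOrthoFrame V ![1, 1, -1] e)
    (h : g.SolvesTMG o m Λ) (hm : m ≠ 0) (i j : Fin 3) (q : V) :
    evalC q ((he.timelikeTMG h hm).F i j) = ![1, Complex.I, Complex.I] i *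
      ![1, Complex.I, Complex.I] j * (g.frameΦ e i j q : ℂ) := by
  simp [timelikeTMG, tmgFrame]

/-- `k = e 0 + e 1` is a geodesic without divergence: `g (∇_k k, u) = g (∇_u k, u) = 0`. -/
def IsKundtFrame (g : LorentzMetric M) (V : Set M)
    (e : Fin 3 → ∀ p : M, TangentSpace 𝓘(ℝ, E3) p) : Prop :=
  ∀ q ∈ V, g.frameΓ e 0 0 2 q + g.frameΓ e 0 1 2 q + g.frameΓ e 1 0 2 q + g.frameΓ e 1 1 2 q = 0 ∧
    g.frameΓ e 2 0 2 q + g.frameΓ e 2 1 2 q = 0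

/-- `k = e 0 + e 1` is a multiple principal null vector: `Φ (k, k) = Φ (k, u) = 0`. -/
def IsMultiplePrincipalFrame (g : LorentzMetric M) (V : Set M)
    (e : Fin 3 → ∀ p : M, TangentSpace 𝓘(ℝ, E3) p) : Prop :=
  ∀ q ∈ V, g.frameΦ e 0 0 q + 2 * g.frameΦ e 0 1 q + g.frameΦ e 1 1 q = 0 ∧
    g.frameΦ e 0 2 q + g.frameΦ e 1 2 q = 0

/-- The real null case. The identity 5 Φ₁² = 0 holds in a ring of functions; evaluated at a point it
holds in the field ℂ, where the square can be dropped. -/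
theorem IsOrthoFrame.isMultiplePrincipalFrame (he : g.IsOrthoFrame V ![1, -1, 1] e)
    (h : g.SolvesTMG o m Λ) (hm : m ≠ 0) (hk : g.IsKundtFrame V e) :
    g.IsMultiplePrincipalFrame V e := by
  have hκ : (he.nullTMG h hm).κ = 0 := smoothC_ext fun q => by
    have := (hk q q.2).1
    simp only [TMGFrame.κ, map_add, he.evalC_nullTMG_Γ, map_zero]
    exact_mod_cast this
  have hρ : (he.nullTMG h hm).ρ = 0 := smoothC_ext fun q => by
    have := (hk q q.2).2
    simp only [TMGFrame.ρ, map_add, he.evalC_nullTMG_Γ, map_zero]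
    exact_mod_cast this
  have h0 := TMGFrame.Φ₀_eq_zero smoothC_add_self hκ hρ
  have h1 := TMGFrame.Φ₁_sq_eq_zero smoothC_add_self hκ hρ
  intro q hq
  have e0 := congrArg (evalC ⟨q, hq⟩) h0
  have e1 := congrArg (evalC ⟨q, hq⟩) h1
  simp only [TMGFrame.Φ₀, TMGFrame.Φ₁, map_add, map_mul, he.evalC_nullTMG_F, map_zero,
    map_ofNat, mul_eq_zero, OfNat.ofNat_ne_zero, false_or, or_self] at e0 e1
  exact ⟨by exact_mod_cast e0, by exact_mod_cast e1⟩

/-- The alternatives in `hΦ` correspond to the types with Φ(k,l) ≠ 0, to III_r and to N_r. Each is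
required on all of `V` because the vanishing components are differentiated in the curl equations. -/
theorem IsOrthoFrame.isKundtFrame (he : g.IsOrthoFrame V ![1, -1, 1] e)
    (h : g.SolvesTMG o m Λ) (hm : m ≠ 0) (hk : g.IsMultiplePrincipalFrame V e)
    (hΦ : (∀ q ∈ V, g.frameΦ e 2 2 q ≠ 0) ∨
      (∀ q ∈ V, g.frameΦ e 2 2 q = 0 ∧ g.frameΦ e 0 2 q ≠ 0) ∨
      (∀ q ∈ V, g.frameΦ e 2 2 q = 0 ∧ g.frameΦ e 0 2 q = 0 ∧ g.frameΦ e 0 0 q ≠ 0)) :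
    g.IsKundtFrame V e := by
  have h0 : (he.nullTMG h hm).Φ₀ = 0 := smoothC_ext fun q => by
    have := (hk q q.2).1
    simp only [TMGFrame.Φ₀, map_add, map_mul, map_ofNat, he.evalC_nullTMG_F, map_zero]
    exact_mod_cast this
  have h1 : (he.nullTMG h hm).Φ₁ = 0 := smoothC_ext fun q => by
    have := (hk q q.2).2
    simp only [TMGFrame.Φ₁, map_add, he.evalC_nullTMG_F, map_zero]
    exact_mod_cast this
  have hF : ∀ i j, (∀ q ∈ V, g.frameΦ e i j q = 0) → (he.nullTMG h hm).F i j = 0 :=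
    fun i j hF => smoothC_ext fun q => by
      rw [he.evalC_nullTMG_F, hF q q.2, Complex.ofReal_zero, map_zero]
  have key : ∀ q : V, evalC q (he.nullTMG h hm).κ = 0 ∧ evalC q (he.nullTMG h hm).ρ = 0 := by
    intro q
    -- The products vanish as functions, and the nonzero factor is cancelled only after evaluation
    -- at a point.
    rcases hΦ with hS | hT | hW
    · have e1 := congrArg (evalC q) (TMGFrame.κ_mul_F₂₂ smoothC_add_self h0 h1)
      have e2 := congrArg (evalC q) (TMGFrame.ρ_mul_F₂₂ smoothC_add_self h0 h1)
      simpa [evalC_three, he.evalC_nullTMG_F, hS q q.2] using And.intro e1 e2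
    · have hS := hF 2 2 fun q hq => (hT q hq).1
      have e1 := congrArg (evalC q) (TMGFrame.κ_mul_F₀₂ smoothC_add_self h0 h1 hS)
      have e2 := congrArg (evalC q) (TMGFrame.ρ_mul_F₀₂ smoothC_add_self h0 h1 hS)
      simpa [evalC_three, he.evalC_nullTMG_F, (hT q q.2).2] using And.intro e1 e2
    · have hS := hF 2 2 fun q hq => (hW q hq).1
      have hT := hF 0 2 fun q hq => (hW q hq).2.1
      have e1 := congrArg (evalC q) (TMGFrame.κ_mul_F₀₀ smoothC_add_self h0 h1 hS hT)
      have e2 := congrArg (evalC q) (TMGFrame.ρ_mul_F₀₀ smoothC_add_self h0 h1 hS hT)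
      simpa [evalC_three, he.evalC_nullTMG_F, (hW q q.2).2.2] using And.intro e1 e2
  intro q hq
  have := key ⟨q, hq⟩
  simp only [TMGFrame.κ, TMGFrame.ρ, map_add, he.evalC_nullTMG_Γ] at this
  exact_mod_cast this

/-- `e 2` is tangent to a shear-free congruence of geodesics. -/
def IsShearFreeFrame (g : LorentzMetric M) (V : Set M)
    (e : Fin 3 → ∀ p : M, TangentSpace 𝓘(ℝ, E3) p) : Prop :=
  ∀ q ∈ V, g.frameΓ e 0 0 2 q = g.frameΓ e 1 1 2 q ∧
    g.frameΓ e 0 1 2 q + g.frameΓ e 1 0 2 q = 0 ∧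
    g.frameΓ e 2 0 2 q = 0 ∧ g.frameΓ e 2 1 2 q = 0

/-- The tracefree Ricci tensor is diagonal, with two equal eigenvalues. -/
def IsDoubleEigenFrame (g : LorentzMetric M) (V : Set M)
    (e : Fin 3 → ∀ p : M, TangentSpace 𝓘(ℝ, E3) p) : Prop :=
  ∀ q ∈ V, g.frameΦ e 0 0 q = g.frameΦ e 1 1 q ∧ g.frameΦ e 0 1 q = 0 ∧
    g.frameΦ e 0 2 q = 0 ∧ g.frameΦ e 1 2 q = 0

lemma IsOrthoFrame.evalC_timelikeTMG_κ (he : g.IsOrthoFrame V ![1, 1, -1] e)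
    (h : g.SolvesTMG o m Λ) (hm : m ≠ 0) (q : V) : evalC q (he.timelikeTMG h hm).κ
      = ⟨-(g.frameΓ e 0 1 2 q + g.frameΓ e 1 0 2 q),
          g.frameΓ e 0 0 2 q - g.frameΓ e 1 1 2 q⟩ := by
  simp only [TMGFrame.κ, map_add, he.evalC_timelikeTMG_Γ]
  apply Complex.ext <;> simp
  · ring
  · ring

lemma IsOrthoFrame.evalC_timelikeTMG_ρ (he : g.IsOrthoFrame V ![1, 1, -1] e)
    (h : g.SolvesTMG o m Λ) (hm : m ≠ 0) (q : V) : evalC q (he.timelikeTMG h hm).ρ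
      = ⟨-g.frameΓ e 2 0 2 q, -g.frameΓ e 2 1 2 q⟩ := by
  simp only [TMGFrame.ρ, map_add, he.evalC_timelikeTMG_Γ]
  apply Complex.ext <;> simp

lemma IsOrthoFrame.evalC_timelikeTMG_Φ₀ (he : g.IsOrthoFrame V ![1, 1, -1] e)
    (h : g.SolvesTMG o m Λ) (hm : m ≠ 0) (q : V) : evalC q (he.timelikeTMG h hm).Φ₀
      = ⟨g.frameΦ e 0 0 q - g.frameΦ e 1 1 q, 2 * g.frameΦ e 0 1 q⟩ := by
  simp only [TMGFrame.Φ₀, map_add, map_mul, map_ofNat, he.evalC_timelikeTMG_F]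
  apply Complex.ext <;> simp
  ring

lemma IsOrthoFrame.evalC_timelikeTMG_Φ₁ (he : g.IsOrthoFrame V ![1, 1, -1] e)
    (h : g.SolvesTMG o m Λ) (hm : m ≠ 0) (q : V) : evalC q (he.timelikeTMG h hm).Φ₁
      = ⟨-g.frameΦ e 1 2 q, g.frameΦ e 0 2 q⟩ := by
  simp only [TMGFrame.Φ₁, map_add, he.evalC_timelikeTMG_F]
  apply Complex.ext <;> simp

/-- The timelike case of the same algebra: the real and imaginary parts of κ are the two components
of the shear, and those of Φ₀ and Φ₁ are the deviations of Φ from being diagonal with a double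
eigenvalue. -/
theorem IsOrthoFrame.isDoubleEigenFrame (he : g.IsOrthoFrame V ![1, 1, -1] e)
    (h : g.SolvesTMG o m Λ) (hm : m ≠ 0) (hk : g.IsShearFreeFrame V e) :
    g.IsDoubleEigenFrame V e := by
  have hκ : (he.timelikeTMG h hm).κ = 0 := smoothC_ext fun q => by
    obtain ⟨h1, h2, -, -⟩ := hk q q.2
    rw [he.evalC_timelikeTMG_κ, h1, h2]
    apply Complex.ext <;> simp
  have hρ : (he.timelikeTMG h hm).ρ = 0 := smoothC_ext fun q => by
    obtain ⟨-, -, h1, h2⟩ := hk q q.2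
    rw [he.evalC_timelikeTMG_ρ, h1, h2]
    apply Complex.ext <;> simp
  have h0 := TMGFrame.Φ₀_eq_zero smoothC_add_self hκ hρ
  have h1 := TMGFrame.Φ₁_sq_eq_zero smoothC_add_self hκ hρ
  intro q hq
  have e0 := congrArg (evalC ⟨q, hq⟩) h0
  have e1 := congrArg (evalC ⟨q, hq⟩) h1
  simp only [map_mul, map_zero, map_ofNat, mul_eq_zero, OfNat.ofNat_ne_zero, false_or, or_self,
    he.evalC_timelikeTMG_Φ₀, he.evalC_timelikeTMG_Φ₁, Complex.ext_iff, Complex.zero_re,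
    Complex.zero_im, neg_eq_zero] at e0 e1
  exact ⟨sub_eq_zero.1 e0.1, e0.2, e1.2, e1.1⟩

theorem IsOrthoFrame.isShearFreeFrame (he : g.IsOrthoFrame V ![1, 1, -1] e)
    (h : g.SolvesTMG o m Λ) (hm : m ≠ 0) (hk : g.IsDoubleEigenFrame V e)
    (hΦ : ∀ q ∈ V, g.frameΦ e 2 2 q ≠ 0) : g.IsShearFreeFrame V e := by
  have h0 : (he.timelikeTMG h hm).Φ₀ = 0 := smoothC_ext fun q => by
    obtain ⟨h1, h2, -, -⟩ := hk q q.2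
    rw [he.evalC_timelikeTMG_Φ₀, h1, h2]
    apply Complex.ext <;> simp
  have h1 : (he.timelikeTMG h hm).Φ₁ = 0 := smoothC_ext fun q => by
    obtain ⟨-, -, h1, h2⟩ := hk q q.2
    rw [he.evalC_timelikeTMG_Φ₁, h1, h2]
    apply Complex.ext <;> simp
  intro q hq
  have e1 := congrArg (evalC ⟨q, hq⟩) (TMGFrame.κ_mul_F₂₂ smoothC_add_self h0 h1)
  have e2 := congrArg (evalC ⟨q, hq⟩) (TMGFrame.ρ_mul_F₂₂ smoothC_add_self h0 h1)
  simp [evalC_three, he.evalC_timelikeTMG_F, hΦ q hq, he.evalC_timelikeTMG_κ, he.evalC_timelikeTMG_ρ,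
    Complex.ext_iff] at e1 e2
  exact ⟨by linarith [e1.2], by linarith [e1.1], e2.1, e2.2⟩

end frame

/-! ### Completing vectors to orthonormal and null frames at a point -/

section pointwise

variable {g : LorentzMetric M} {p : M} {ε : Fin 3 → ℝ} {b : Fin 3 → TangentSpace 𝓘(ℝ, E3) p}
  {x y k l u : TangentSpace 𝓘(ℝ, E3) p}

lemma exists_ne_zero_orthogonal (g : LorentzMetric M) (x y : TangentSpace 𝓘(ℝ, E3) p) :
    ∃ u, u ≠ 0 ∧ g.val p u x = 0 ∧ g.val p u y = 0 := by
  have hfin : finrank ℝ (TangentSpace 𝓘(ℝ, E3) p) = 3 := by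
    change finrank ℝ E3 = 3; simp
  have : FiniteDimensional ℝ (TangentSpace 𝓘(ℝ, E3) p) := inferInstanceAs (FiniteDimensional ℝ E3)
  have h := LinearMap.ker_ne_bot_of_finrank_lt
    (f := (g.valBilin p x).prod (g.valBilin p y)) (by rw [hfin]; simp)
  obtain ⟨u, hu, hu0⟩ := Submodule.exists_mem_ne_zero_of_ne_bot h
  have hu' : g.valBilin p x u = 0 ∧ g.valBilin p y u = 0 := by
    simpa [Prod.ext_iff] using hu
  exact ⟨u, hu0, by rw [g.symm]; exact hu'.1, by rw [g.symm]; exact hu'.2⟩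

/-- Were `u` null, it would be orthogonal to the basis `x`, `y`, `u`, against nondegeneracy. -/
lemma val_self_ne_zero_of_orthogonal (hx : g.val p x x ≠ 0) (hy : g.val p y y ≠ 0)
    (hxy : g.val p x y = 0) (hu : u ≠ 0) (hux : g.val p u x = 0) (huy : g.val p u y = 0) :
    g.val p u u ≠ 0 := by
  intro h
  have hfin : finrank ℝ (TangentSpace 𝓘(ℝ, E3) p) = 3 := by
    change finrank ℝ E3 = 3; simp
  have hli : LinearIndependent ℝ ![x, y, u] := by
    rw [Fintype.linearIndependent_iff]
    intro c hc
    simp only [Fin.sum_univ_three, Matrix.cons_val_zero, Matrix.cons_val_one, Matrix.cons_val] at hc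
    have h0 := congrArg (fun v => g.val p v x) hc
    have h1 := congrArg (fun v => g.val p v y) hc
    simp [hux, huy, hxy, g.symm p y x, hx, hy] at h0 h1
    simp [h0, h1, hu] at hc
    intro i
    match i with
    | 0 => exact h0
    | 1 => exact h1
    | 2 => exact hc
  let B := basisOfLinearIndependentOfCardEqFinrank hli (by simp [hfin])
  apply hu
  apply g.nondegenerate p
  intro w
  have hB : ∀ i, g.val p u (B i) = 0 := by
    intro i
    simp only [B, coe_basisOfLinearIndependentOfCardEqFinrank]
    match i with
    | 0 => simpa using hux
    | 1 => simpa using huy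
    | 2 => simpa using h
  rw [← B.sum_repr w, map_sum]
  exact Finset.sum_eq_zero fun i _ => by rw [map_smul, hB, smul_zero]

lemma exists_unit (hu : g.val p u u ≠ 0) :
    ∃ (c σ : ℝ), c ≠ 0 ∧ σ ^ 2 = 1 ∧ g.val p (c • u) (c • u) = σ := by
  have h1 : 0 < |g.val p u u| := abs_pos.2 hu
  refine ⟨(Real.sqrt |g.val p u u|)⁻¹, g.val p u u / |g.val p u u|, by positivity, ?_, ?_⟩
  · rw [div_pow, sq_abs]; exact div_self (pow_ne_zero 2 hu)
  · simp only [map_smul, _root_.smul_apply, smul_eq_mul]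
    rw [← mul_assoc, ← mul_inv, Real.mul_self_sqrt h1.le, inv_mul_eq_div]

lemma exists_isOrthoTriple_of_pair {α β : ℝ} (hα : α ^ 2 = 1) (hβ : β ^ 2 = 1)
    (hx : g.val p x x = α) (hy : g.val p y y = β) (hxy : g.val p x y = 0) :
    ∃ (z : TangentSpace 𝓘(ℝ, E3) p) (γ : ℝ), g.IsOrthoTriple p ![α, β, γ] ![x, y, z] := by
  obtain ⟨u, hu, hux, huy⟩ := g.exists_ne_zero_orthogonal x y
  have h := val_self_ne_zero_of_orthogonal (g := g) (by rw [hx]; rintro rfl; norm_num at hα)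
    (by rw [hy]; rintro rfl; norm_num at hβ) hxy hu hux huy
  obtain ⟨c, γ, -, hγ, hc⟩ := exists_unit h
  refine ⟨c • u, γ, fun i => ?_, fun i j => ?_⟩
  · match i with
    | 0 => exact hα
    | 1 => exact hβ
    | 2 => exact hγ
  · match i, j with
    | 0, 0 => simpa using hx
    | 0, 1 => simpa using hxy
    | 0, 2 => simp [g.symm p x u, hux]
    | 1, 0 => simpa [g.symm p y x] using hxy
    | 1, 1 => simpa using hy
    | 1, 2 => simp [g.symm p y u, huy]
    | 2, 0 => simp [hux]
    | 2, 1 => simp [huy]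
    | 2, 2 => simpa using hc

lemma false_of_orthogonal_timelike (hx : g.val p x x = -1) (hy : g.val p y y = -1)
    (hxy : g.val p x y = 0) : False := by
  obtain ⟨s, hs⟩ := g.exists_isOrthoTriple p
  have key : ∀ v, g.val p v (s 2) = 0 → 0 ≤ g.val p v v := by
    intro v hv
    rw [hs.val_eq]
    simp [Fin.sum_univ_three, hv]
    exact add_nonneg (mul_self_nonneg _) (mul_self_nonneg _)
  -- This combination is orthogonal to the timelike vector `s 2`, yet its square is minus a sum of
  -- two squares. So both coefficients vanish and `x` itself is orthogonal to `s 2`, which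
  -- contradicts g(x,x) = -1.
  have h1 := key (g.val p y (s 2) • x - g.val p x (s 2) • y) (by simp; ring)
  simp [hx, hy, hxy, g.symm p y x] at h1
  have h2 := key x (by nlinarith [sq_nonneg (g.val p x (s 2)), sq_nonneg (g.val p y (s 2))])
  linarith

/-- Sylvester's law of inertia: two negative signs are excluded by `false_of_orthogonal_timelike`,
and three positive ones by the existence of a timelike vector. -/
lemma IsOrthoTriple.signs (hb : g.IsOrthoTriple p ε b) :
    ε = ![1, 1, -1] ∨ ε = ![1, -1, 1] ∨ ε = ![-1, 1, 1] := by
  have hi : ∀ i, ε i = 1 ∨ ε i = -1 := fun i => by simpa using hb.1 i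
  have h2 : ∀ i j, i ≠ j → ε i = -1 → ε j = -1 → False := fun i j hij h1 h2 =>
    false_of_orthogonal_timelike (g := g) (x := b i) (y := b j) (by rw [hb.2, if_pos rfl, h1])
      (by rw [hb.2, if_pos rfl, h2]) (by rw [hb.2, if_neg hij])
  have hvec : ε = ![ε 0, ε 1, ε 2] := by
    funext i; match i with | 0 => rfl | 1 => rfl | 2 => rfl
  rw [hvec]
  rcases hi 0 with h0 | h0 <;> rcases hi 1 with h1 | h1 <;> rcases hi 2 with h2' | h2'
  · exfalso
    obtain ⟨s, hs⟩ := g.exists_isOrthoTriple p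
    have h3 := hs.2 2 2
    rw [hb.val_eq] at h3
    simp [Fin.sum_univ_three, h0, h1, h2'] at h3
    nlinarith [sq_nonneg (g.val p (s 2) (b 0)), sq_nonneg (g.val p (s 2) (b 1)),
      sq_nonneg (g.val p (s 2) (b 2))]
  · simp [h0, h1, h2']
  · simp [h0, h1, h2']
  · exact (h2 1 2 (by decide) h1 h2').elim
  · simp [h0, h1, h2']
  · exact (h2 0 2 (by decide) h0 h2').elim
  · exact (h2 0 1 (by decide) h0 h1).elim
  · exact (h2 0 1 (by decide) h0 h1).elim

/-- A unit vector belongs to an orthonormal triple. -/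
lemma exists_isOrthoTriple_of_unit {α : ℝ} (hα : α ^ 2 = 1) (hx : g.val p x x = α) :
    ∃ (y z : TangentSpace 𝓘(ℝ, E3) p) (β γ : ℝ),
      g.IsOrthoTriple p ![α, β, γ] ![x, y, z] := by
  have hα0 : α ≠ 0 := by rintro rfl; norm_num at hα
  suffices h : ∃ y, g.val p x y = 0 ∧ g.val p y y ≠ 0 by
    obtain ⟨y, hxy, hy⟩ := h
    obtain ⟨c, β, -, hβ, hc⟩ := exists_unit hy
    obtain ⟨z, γ, h⟩ := exists_isOrthoTriple_of_pair hα hβ hx hc (by simp [hxy])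
    exact ⟨_, _, _, _, h⟩
  -- If all vectors orthogonal to `x` were null, polarisation would make them orthogonal to each
  -- other; a nonzero one would then be orthogonal to the whole tangent space.
  by_contra! hcon
  obtain ⟨u, hu, hux, -⟩ := g.exists_ne_zero_orthogonal x x
  apply hu
  apply g.nondegenerate
  intro w
  have hxu : g.val p x u = 0 := by rw [g.symm, hux]
  have hw : g.val p x (w - (α * g.val p x w) • x) = 0 := by
    simp [hx]; linear_combination (-g.val p x w) * hα
  have h1 := hcon _ hw
  have h2 := hcon u hxu
  have h3 := hcon (u + (w - (α * g.val p x w) • x)) (by rw [map_add, hxu, hw, add_zero])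
  rw [map_add, map_add, _root_.add_apply, _root_.add_apply, h1, h2,
    g.symm p (w - _) u] at h3
  have h4 : g.val p u (w - (α * g.val p x w) • x) = 0 := by linarith
  simpa [hux] using h4

/-- The scaling is such that k = e₀ + e₁ and l = (e₀ - e₁)/2, as in `TMGFrame`. -/
lemma IsNullFrame.isOrthoTriple (h : g.IsNullFrame p k l u) :
    g.IsOrthoTriple p ![1, -1, 1] ![(1 / 2 : ℝ) • k + l, (1 / 2 : ℝ) • k - l, u] := by
  refine ⟨fun i => ?_, fun i j => ?_⟩
  · match i with
    | 0 => simp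
    | 1 => simp
    | 2 => simp
  · match i, j with
    | 0, 0 => simp [h.kk, h.ll, h.kl, g.symm p l k]; norm_num
    | 0, 1 => simp [h.kk, h.ll, h.kl, g.symm p l k]
    | 0, 2 => simp [h.ku, h.lu]
    | 1, 0 => simp [h.kk, h.ll, h.kl, g.symm p l k]
    | 1, 1 => simp [h.kk, h.ll, h.kl, g.symm p l k]; norm_num
    | 1, 2 => simp [h.ku, h.lu]
    | 2, 0 => simp [h.ku, h.lu, g.symm p u k, g.symm p u l]
    | 2, 1 => simp [h.ku, h.lu, g.symm p u k, g.symm p u l]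
    | 2, 2 => simp [h.uu]

lemma IsNullFrame.expand (h : g.IsNullFrame p k l u) (v : TangentSpace 𝓘(ℝ, E3) p) :
    v = g.val p v l • k + g.val p v k • l + g.val p v u • u := by
  have := h.isOrthoTriple.sum_val v
  simp [Fin.sum_univ_three] at this
  conv_lhs => rw [← this]
  module

lemma exists_isNullFrame_of_pair (hk : g.val p k k = 0) (hl : g.val p l l = 0)
    (hkl : g.val p k l = 1) : ∃ u, g.IsNullFrame p k l u := by
  obtain ⟨z, γ, h⟩ := exists_isOrthoTriple_of_pair (g := g) (p := p) (α := 1) (β := -1)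
    (x := (1 / 2 : ℝ) • k + l) (y := (1 / 2 : ℝ) • k - l) (by norm_num) (by norm_num)
    (by simp [hk, hl, hkl, g.symm p l k]; norm_num)
    (by simp [hk, hl, hkl, g.symm p l k]; norm_num) (by simp [hk, hl, hkl, g.symm p l k])
  have hγ : γ = 1 := by
    rcases h.signs with h | h | h
    · have := congrFun h 1; norm_num at this
    · have := congrFun h 2; simpa using this
    · have := congrFun h 0; norm_num at this
  have h0 := h.2 2 0
  have h1 := h.2 2 1
  have h2 := h.2 2 2
  simp at h0 h1 h2
  refine ⟨z, hk, hl, hkl, ?_, ?_, by rw [h2, hγ]⟩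
  · rw [g.symm]; linarith
  · rw [g.symm]; linarith

/-- The null vector `l` with `g (k, l) = 1` in the plane of `k` and `w`. -/
lemma exists_null_partner (hk : g.val p k k = 0) (w : TangentSpace 𝓘(ℝ, E3) p)
    (hw : g.val p k w ≠ 0) : ∃ a c : ℝ, g.val p (a • w + c • k) (a • w + c • k) = 0 ∧
      g.val p k (a • w + c • k) = 1 := by
  refine ⟨(g.val p k w)⁻¹, - (g.val p w w / (2 * g.val p k w ^ 2)), ?_, ?_⟩
  · simp [hk, g.symm p w k]; field_simp; ring
  · simp [hk, hw]

lemma exists_isNullFrame (hk : g.val p k k = 0) (hk0 : k ≠ 0) : ∃ l u, g.IsNullFrame p k l u := by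
  obtain ⟨w, hw⟩ : ∃ w, g.val p k w ≠ 0 := by
    by_contra! h; exact hk0 (g.nondegenerate p k h)
  obtain ⟨a, c, h1, h2⟩ := exists_null_partner hk w hw
  obtain ⟨u, hu⟩ := exists_isNullFrame_of_pair hk h1 h2
  exact ⟨_, u, hu⟩

lemma IsNullFrame.ne_zero (h : g.IsNullFrame p k l u) : k ≠ 0 := by
  rintro rfl; simpa using h.kl

/-- For `x` orthogonal to `k` the expansion in the frame gives g(x,x) = g(x,u)². A null `x`
therefore has only a `k`-component. -/
lemma IsNullFrame.span_eq_of_orthogonal (h : g.IsNullFrame p k l u) (hx : g.val p x x = 0)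
    (hxk : g.val p x k = 0) (hx0 : x ≠ 0) : Submodule.span ℝ {x} = Submodule.span ℝ {k} := by
  have hv := h.expand x
  have hxx : g.val p x x = 2 * g.val p x l * g.val p x k + g.val p x u ^ 2 := by
    conv_lhs => rw [hv]
    simp only [map_add, map_smul, _root_.add_apply, _root_.smul_apply, smul_eq_mul, h.kk, h.ll, h.kl,
      h.ku, h.lu, h.uu, g.symm p l k, g.symm p u k, g.symm p u l]
    ring
  have hxu : g.val p x u = 0 := by
    rw [hx, hxk] at hxx; simpa using hxx.symm
  rw [hxk, hxu, zero_smul, zero_smul, add_zero, add_zero] at hv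
  have hc : g.val p x l ≠ 0 := by intro hc; rw [hc, zero_smul] at hv; exact hx0 hv
  rw [hv]
  exact Submodule.span_singleton_smul_eq (IsUnit.mk0 _ hc) k

/-- Null vectors spanning distinct lines are not orthogonal. -/
lemma exists_isNullFrame_of_span_ne (hk : g.val p k k = 0) (hk0 : k ≠ 0) (hx : g.val p x x = 0)
    (hx0 : x ≠ 0) (hne : Submodule.span ℝ {k} ≠ Submodule.span ℝ {x}) :
    ∃ (c : ℝ) (u : _), c ≠ 0 ∧ g.IsNullFrame p k (c • x) u := by
  obtain ⟨l, u, h⟩ := exists_isNullFrame hk hk0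
  have hkx : g.val p k x ≠ 0 := fun hkx =>
    hne (h.span_eq_of_orthogonal hx (by rw [g.symm, hkx]) hx0).symm
  obtain ⟨u, hu⟩ := exists_isNullFrame_of_pair (g := g) (l := (g.val p k x)⁻¹ • x) hk (by simp [hx])
    (by simp [hkx])
  exact ⟨(g.val p k x)⁻¹, u, inv_ne_zero hkx, hu⟩

end pointwise

/-! ### Smooth frames adapted to a given field -/

section frames

variable {g : LorentzMetric M} {V : Set M} {ε : Fin 3 → ℝ}
  {e : Fin 3 → ∀ p : M, TangentSpace 𝓘(ℝ, E3) p} {X Y k n : ∀ p : M, TangentSpace 𝓘(ℝ, E3) p}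
  {p q : M}

lemma IsOrthoFrame.perm (he : g.IsOrthoFrame V ε e) (σ : Equiv.Perm (Fin 3)) :
    g.IsOrthoFrame V (ε ∘ σ) (e ∘ σ) :=
  ⟨he.isOpen, fun i => he.smooth _, fun q hq => ⟨fun i => (he.ortho q hq).1 _, fun i j => by
    have := (he.ortho q hq).2 (σ i) (σ j)
    simpa [σ.injective.eq_iff] using this⟩⟩

/-- A pair of orthonormal smooth vector fields belongs to an orthonormal frame. -/
lemma exists_isOrthoFrame_of_pair (hV : IsOpen V) (hp : p ∈ V) (hX : SmoothFieldOn ∞ X V)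
    (hY : SmoothFieldOn ∞ Y V) {α β : ℝ} (hα : α ^ 2 = 1) (hβ : β ^ 2 = 1)
    (hXX : ∀ q ∈ V, g.val q (X q) (X q) = α) (hYY : ∀ q ∈ V, g.val q (Y q) (Y q) = β)
    (hXY : ∀ q ∈ V, g.val q (X q) (Y q) = 0) :
    ∃ W ⊆ V, p ∈ W ∧ ∃ γ e, g.IsOrthoFrame W ![α, β, γ] e ∧
      ∀ q ∈ W, e 0 q = X q ∧ e 1 q = Y q := by
  obtain ⟨z, γ, hz⟩ := exists_isOrthoTriple_of_pair hα hβ (hXX p hp) (hYY p hp) (hXY p hp)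
  obtain ⟨W, hW, hpW, hZ⟩ := exists_smoothFieldOn_extend p z
  obtain ⟨U, hU, hpU, e, he, -, h⟩ := exists_isOrthoFrame (p := p) (ε := ![α, β, γ]) g (hV.inter hW)
    ⟨hp, hpW⟩ (X := ![X, Y, extend E3 z]) (fun i => by
      match i with
      | 0 => exact hX.mono Set.inter_subset_left
      | 1 => exact hY.mono Set.inter_subset_left
      | 2 => exact hZ.mono Set.inter_subset_right)
    (by
      have : (fun i => (![X, Y, extend E3 z] : Fin 3 → ∀ p : M, TangentSpace 𝓘(ℝ, E3) p) i p)
          = ![X p, Y p, z] := by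
        funext i
        match i with
        | 0 => rfl
        | 1 => rfl
        | 2 => exact extend_apply_self E3 z
      rw [this]; exact hz)
  refine ⟨U, fun q hq => (hU hq).1, hpU, γ, e, he, fun q hq => ?_⟩
  have hqV := (hU hq).1
  obtain ⟨h1, h2⟩ := h q hq (hXX q hqV)
  exact ⟨h1, h2 (hYY q hqV) (by rw [g.symm]; exact hXY q hqV)⟩

/-- A unit smooth vector field belongs to an orthonormal frame. -/
lemma exists_isOrthoFrame_of_unit (hV : IsOpen V) (hp : p ∈ V) (hX : SmoothFieldOn ∞ X V)
    {α : ℝ} (hα : α ^ 2 = 1) (hXX : ∀ q ∈ V, g.val q (X q) (X q) = α) :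
    ∃ W ⊆ V, p ∈ W ∧ ∃ β γ e, g.IsOrthoFrame W ![α, β, γ] e ∧ ∀ q ∈ W, e 0 q = X q := by
  obtain ⟨y, z, β, γ, hz⟩ := exists_isOrthoTriple_of_unit hα (hXX p hp)
  obtain ⟨W, hW, hpW, hY, hZ⟩ := exists_smoothFieldOn_pair y z
  obtain ⟨U, hU, hpU, e, he, -, h⟩ := exists_isOrthoFrame (p := p) (ε := ![α, β, γ]) g (hV.inter hW)
    ⟨hp, hpW⟩ (X := ![X, extend E3 y, extend E3 z]) (fun i => by
      match i with
      | 0 => exact hX.mono Set.inter_subset_left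
      | 1 => exact hY.mono Set.inter_subset_right
      | 2 => exact hZ.mono Set.inter_subset_right)
    (by
      have : (fun i => (![X, extend E3 y, extend E3 z] :
          Fin 3 → ∀ p : M, TangentSpace 𝓘(ℝ, E3) p) i p) = ![X p, y, z] := by
        funext i
        match i with
        | 0 => rfl
        | 1 => exact extend_apply_self E3 y
        | 2 => exact extend_apply_self E3 z
      rw [this]; exact hz)
  exact ⟨U, fun q hq => (hU hq).1, hpU, β, γ, e, he, fun q hq => (h q hq (hXX q (hU hq).1)).1⟩

lemma exists_timelikeFrame (hV : IsOpen V) (hp : p ∈ V) (hn : SmoothFieldOn ∞ n V)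
    (hnn : ∀ q ∈ V, g.val q (n q) (n q) = -1) :
    ∃ W ⊆ V, p ∈ W ∧ ∃ e, g.IsOrthoFrame W ![1, 1, -1] e ∧ ∀ q ∈ W, e 2 q = n q := by
  obtain ⟨W, hWV, hpW, β, γ, e, he, h⟩ := exists_isOrthoFrame_of_unit hV hp hn (by norm_num) hnn
  have hs : (![-1, β, γ] : Fin 3 → ℝ) = ![-1, 1, 1] := by
    rcases (he.ortho p hpW).signs with h | h | h
    · have := congrFun h 0; norm_num at this
    · have := congrFun h 0; norm_num at this
    · exact h
  rw [hs] at he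
  -- The rotation moves the given field from place 0 to place 2.
  have he' := he.perm (finRotate 3)
  have hv : (![-1, 1, 1] : Fin 3 → ℝ) ∘ finRotate 3 = ![1, 1, -1] := by
    funext i; match i with | 0 => rfl | 1 => rfl | 2 => rfl
  rw [hv] at he'
  exact ⟨W, hWV, hpW, _, he', fun q hq => h q hq⟩

lemma exists_spacelikeFrame (hV : IsOpen V) (hp : p ∈ V) (hn : SmoothFieldOn ∞ n V)
    (hnn : ∀ q ∈ V, g.val q (n q) (n q) = 1) :
    ∃ W ⊆ V, p ∈ W ∧ ∃ e, g.IsOrthoFrame W ![1, -1, 1] e ∧ ∀ q ∈ W, e 2 q = n q := by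
  obtain ⟨W, hWV, hpW, β, γ, e, he, h⟩ := exists_isOrthoFrame_of_unit hV hp hn (by norm_num) hnn
  -- The permutations put the given field in place 2 and the timelike member in place 1.
  rcases (he.ortho p hpW).signs with hs | hs | hs
  · rw [hs] at he
    have he' := he.perm (finRotate 3)
    have hv : (![1, 1, -1] : Fin 3 → ℝ) ∘ finRotate 3 = ![1, -1, 1] := by
      funext i; match i with | 0 => rfl | 1 => rfl | 2 => rfl
    rw [hv] at he'
    exact ⟨W, hWV, hpW, _, he', fun q hq => h q hq⟩
  · rw [hs] at he
    have he' := he.perm (Equiv.swap 0 2)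
    have hv : (![1, -1, 1] : Fin 3 → ℝ) ∘ Equiv.swap (0 : Fin 3) 2 = ![1, -1, 1] := by
      funext i; match i with | 0 => rfl | 1 => rfl | 2 => rfl
    rw [hv] at he'
    exact ⟨W, hWV, hpW, _, he', fun q hq => h q hq⟩
  · have := congrFun hs 0; norm_num at this

/-- A null partner `l` of `k` is built smoothly from any field not orthogonal to `k` at `p`; then
`k/2 + l` and `k/2 - l` are orthonormal with signs 1, -1 and have sum `k`. -/
lemma exists_kundtFrame (hV : IsOpen V) (hp : p ∈ V) (hk : SmoothFieldOn ∞ k V)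
    (hkk : ∀ q ∈ V, g.val q (k q) (k q) = 0) (hk0 : k p ≠ 0) :
    ∃ W ⊆ V, p ∈ W ∧ ∃ e, g.IsOrthoFrame W ![1, -1, 1] e ∧ ∀ q ∈ W, e 0 q + e 1 q = k q := by
  obtain ⟨w, hw⟩ : ∃ w, g.val p (k p) w ≠ 0 := by
    by_contra! h; exact hk0 (g.nondegenerate p (k p) h)
  obtain ⟨W1, hW1, hpW1, hY⟩ := exists_smoothFieldOn_extend p w
  set Y : ∀ p : M, TangentSpace 𝓘(ℝ, E3) p := extend E3 w with hYdef
  have hYp : Y p = w := extend_apply_self E3 w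
  have hf : SmoothFnOn (fun q => g.val q (k q) (Y q)) (V ∩ W1) :=
    smoothFnOn_val g (hk.mono Set.inter_subset_left) (hY.mono Set.inter_subset_right)
  have hyy : SmoothFnOn (fun q => g.val q (Y q) (Y q)) (V ∩ W1) :=
    smoothFnOn_val g (hY.mono Set.inter_subset_right) (hY.mono Set.inter_subset_right)
  have hN : IsOpen ((V ∩ W1) ∩ {q | g.val q (k q) (Y q) ≠ 0}) :=
    hf.continuousOn.isOpen_inter_preimage (hV.inter hW1) isOpen_ne
  set N := (V ∩ W1) ∩ {q | g.val q (k q) (Y q) ≠ 0} with hNdef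
  have hNV : N ⊆ V := fun q hq => hq.1.1
  have hN0 : ∀ q ∈ N, g.val q (k q) (Y q) ≠ 0 := fun q hq => hq.2
  -- The factor `f₁` normalises g(k,l) to 1, and the multiple `f₂` of `k` cancels the square of `f₁
  -- • Y`.
  obtain ⟨f₁, hf₁⟩ : ∃ f₁ : M → ℝ, f₁ = fun q => (g.val q (k q) (Y q))⁻¹ := ⟨_, rfl⟩
  obtain ⟨f₂, hf₂⟩ : ∃ f₂ : M → ℝ, f₂ = fun q => -(1 / 2 : ℝ) * (g.val q (Y q) (Y q) *
      (f₁ q * f₁ q)) := ⟨_, rfl⟩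
  have hs₁ : SmoothFnOn f₁ N := hf₁ ▸ (hf.mono Set.inter_subset_left).inv₀ hN0
  have hs₂ : SmoothFnOn f₂ N :=
    hf₂ ▸ contMDiffOn_const.mul ((hyy.mono Set.inter_subset_left).mul (hs₁.mul hs₁))
  have hkN : SmoothFieldOn ∞ k N := hk.mono hNV
  obtain ⟨l, hl⟩ : ∃ l : ∀ p : M, TangentSpace 𝓘(ℝ, E3) p, l = f₁ • Y + f₂ • k := ⟨_, rfl⟩
  have hsl : SmoothFieldOn ∞ l N := hl ▸ SmoothFieldOn.add
    (SmoothFieldOn.smul hs₁ (hY.mono fun q hq => hq.1.2)) (SmoothFieldOn.smul hs₂ hkN)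
  have hkl : ∀ q ∈ N, g.val q (k q) (l q) = 1 := fun q hq => by
    simp [hl, hf₁, hkk q (hNV hq), hN0 q hq]
  have hll : ∀ q ∈ N, g.val q (l q) (l q) = 0 := fun q hq => by
    have := hN0 q hq
    simp [hl, hf₂, hf₁, hkk q (hNV hq), g.symm q (Y q) (k q)]
    field_simp
    ring
  have hlk : ∀ q ∈ N, g.val q (l q) (k q) = 1 := fun q hq => by rw [g.symm, hkl q hq]
  obtain ⟨W, hWN, hpW, γ, e, he, h⟩ := exists_isOrthoFrame_of_pair (g := g) (p := p) (V := N)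
    (X := (1 / 2 : ℝ) • k + l) (Y := (1 / 2 : ℝ) • k - l) (α := 1) (β := -1) hN
    ⟨⟨hp, hpW1⟩, by rw [Set.mem_ofPred_eq, hYp]; exact hw⟩
    (SmoothFieldOn.add (SmoothFieldOn.const_smul _ hkN) hsl)
    (SmoothFieldOn.sub (SmoothFieldOn.const_smul _ hkN) hsl) (by norm_num) (by norm_num)
    (fun q hq => by simp [hkk q (hNV hq), hkl q hq, hlk q hq, hll q hq]; norm_num)
    (fun q hq => by simp [hkk q (hNV hq), hkl q hq, hlk q hq, hll q hq]; norm_num)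
    (fun q hq => by simp [hkk q (hNV hq), hkl q hq, hlk q hq, hll q hq])
  have hs : (![1, -1, γ] : Fin 3 → ℝ) = ![1, -1, 1] := by
    rcases (he.ortho p hpW).signs with h | h | h
    · have := congrFun h 1; norm_num at this
    · exact h
    · have := congrFun h 0; norm_num at this
  rw [hs] at he
  refine ⟨W, hWN.trans hNV, hpW, e, he, fun q hq => ?_⟩
  rw [(h q hq).1, (h q hq).2]
  simp only [Pi.add_apply, Pi.sub_apply, Pi.smul_apply]
  module

/-! ### The congruence conditions in terms of connection coefficients -/

section conditions

variable {u : ∀ p : M, TangentSpace 𝓘(ℝ, E3) p}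

lemma IsOrthoFrame.leviCivita_eq (he : g.IsOrthoFrame V ε e) (j : Fin 3) (hX : ∀ q ∈ V, X q = e j q)
    (hq : q ∈ V) : g.leviCivita X q = g.leviCivita (e j) q :=
  leviCivita_congr he.isOpen (((he.smooth j).congr hX).diffAt he.isOpen hq)
    ((he.smooth j).diffAt he.isOpen hq) hX hq

/-- The congruence along `k = e 0 + e 1` is geodesic and divergence-free. -/
lemma IsOrthoFrame.kundt_iff (he : g.IsOrthoFrame V ![1, -1, 1] e)
    (hk : ∀ q ∈ V, k q = e 0 q + e 1 q) (hq : q ∈ V) :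
    g.divergence k q • k q - g.leviCivita k q (k q) = 0 ↔
      g.frameΓ e 0 0 2 q + g.frameΓ e 0 1 2 q + g.frameΓ e 1 0 2 q + g.frameΓ e 1 1 2 q = 0 ∧
        g.frameΓ e 2 0 2 q + g.frameΓ e 2 1 2 q = 0 := by
  have hs : SmoothFieldOn ∞ (e 0 + e 1) V := SmoothFieldOn.add (he.smooth 0) (he.smooth 1)
  have hb := he.ortho q hq
  have hL : g.leviCivita k q = g.leviCivita (e 0) q + g.leviCivita (e 1) q := by
    rw [leviCivita_congr he.isOpen ((hs.congr hk).diffAt he.isOpen hq) (hs.diffAt he.isOpen hq)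
      hk hq]
    exact g.leviCivita.isCovariantDerivativeOnUniv.add ((he.smooth 0).diffAt he.isOpen hq)
      ((he.smooth 1).diffAt he.isOpen hq)
  have hΓ : ∀ i j l, g.val q (g.leviCivita (e j) q (e i q)) (e l q) = g.frameΓ e i j l q :=
    fun _ _ _ => rfl
  have hself : ∀ i j, g.frameΓ e i j j q = 0 := fun i j => by linarith [he.Γ_anti i j j hq]
  -- With ∇_k k = a k + b l + κ u one has b = 0, since k is null, and the divergence is a + ρ. Hence
  -- the vector in question is ρ k - κ u.
  have hdiv : g.divergence k q = g.frameΓ e 0 1 0 q - g.frameΓ e 1 0 1 q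
      + (g.frameΓ e 2 0 2 q + g.frameΓ e 2 1 2 q) := by
    rw [divergence, hb.trace]
    simp [Fin.sum_univ_three, hL, hΓ, hself]
    ring
  have hval : ∀ l, g.val q (g.divergence k q • k q - g.leviCivita k q (k q)) (e l q)
      = g.divergence k q * (g.val q (e 0 q) (e l q) + g.val q (e 1 q) (e l q))
        - (g.frameΓ e 0 0 l q + g.frameΓ e 0 1 l q + g.frameΓ e 1 0 l q + g.frameΓ e 1 1 l q) := by
    intro l
    simp [hL, hk q hq, hΓ]
    ring
  have ho := hb.2
  simp only at ho
  obtain ⟨z, hz⟩ : ∃ z, z = g.divergence k q • k q - g.leviCivita k q (k q) := ⟨_, rfl⟩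
  simp only [← hz] at hval ⊢
  have h0 := hval 0
  have h1 := hval 1
  have h2 := hval 2
  simp [ho, hdiv, hself, he.Γ_anti 0 1 0 hq, he.Γ_anti 1 1 0 hq] at h0 h1 h2
  constructor
  · intro h
    rw [h] at h0 h2
    simp at h0 h2
    exact ⟨by linarith, by linarith⟩
  · rintro ⟨hκ, hρ⟩
    refine hb.ext fun i => ?_
    rw [map_zero, _root_.zero_apply]
    match i with
    | 0 => rw [h0]; linarith
    | 1 => rw [h1]; linarith
    | 2 => rw [h2]; linarith

lemma IsOrthoTriple.bilin_eq {b : Fin 3 → TangentSpace 𝓘(ℝ, E3) q} (hb : g.IsOrthoTriple q ε b)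
    (B : TangentSpace 𝓘(ℝ, E3) q →ₗ[ℝ] TangentSpace 𝓘(ℝ, E3) q →ₗ[ℝ] ℝ)
    (v w : TangentSpace 𝓘(ℝ, E3) q) :
    B v w = ∑ i, ∑ j, (ε i * g.val q v (b i)) * (ε j * g.val q w (b j)) * B (b i) (b j) := by
  conv_lhs => rw [← hb.sum_val v, ← hb.sum_val w]
  simp only [map_sum, LinearMap.sum_apply, map_smul, LinearMap.smul_apply, smul_eq_mul]
  conv_rhs => rw [Finset.sum_comm]
  refine Finset.sum_congr rfl fun i _ => ?_
  rw [Finset.mul_sum]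
  exact Finset.sum_congr rfl fun j _ => by ring

/-- The congruence along the unit timelike field `u = e 2` is geodesic and shear-free. -/
lemma IsOrthoFrame.shearFree_iff (he : g.IsOrthoFrame V ![1, 1, -1] e)
    (hu : ∀ q ∈ V, u q = e 2 q) (hq : q ∈ V) :
    (g.leviCivita u q (u q) = 0 ∧ ∀ v w : TangentSpace 𝓘(ℝ, E3) q,
        1 / 2 * (g.val q (g.leviCivita u q v) w + g.val q (g.leviCivita u q w) v)
          - 1 / 2 * (g.val q v w + g.val q (u q) v * g.val q (u q) w) * g.divergence u q
          + 1 / 2 * (g.val q (g.leviCivita u q (u q)) v * g.val q (u q) w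
            + g.val q (g.leviCivita u q (u q)) w * g.val q (u q) v) = 0) ↔
      (g.frameΓ e 0 0 2 q = g.frameΓ e 1 1 2 q ∧
        g.frameΓ e 0 1 2 q + g.frameΓ e 1 0 2 q = 0 ∧
        g.frameΓ e 2 0 2 q = 0 ∧ g.frameΓ e 2 1 2 q = 0) := by
  have hb := he.ortho q hq
  have hL := he.leviCivita_eq 2 hu hq
  have hΓ : ∀ i l, g.val q (g.leviCivita (e 2) q (e i q)) (e l q) = - g.frameΓ e i l 2 q :=
    fun i l => by rw [← he.Γ_anti i 2 l hq]; rfl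
  have hself : ∀ i, g.frameΓ e i 2 2 q = 0 := fun i => by linarith [he.Γ_anti i 2 2 hq]
  have hdiv : g.divergence u q = - g.frameΓ e 0 0 2 q - g.frameΓ e 1 1 2 q := by
    rw [divergence, hb.trace]
    simp [Fin.sum_univ_three, hL, hΓ, hself]
    ring
  have ho := hb.2
  simp only at ho
  rw [hL, hu q hq, hdiv]
  constructor
  · rintro ⟨h1, h2⟩
    have a0 := congrArg (fun v => g.val q v (e 0 q)) h1
    have a1 := congrArg (fun v => g.val q v (e 1 q)) h1
    -- A tracefree symmetric tensor on the plane of `e 0`, `e 1` has just the two components taken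
    -- here.
    have b0 := h2 (e 0 q) (e 0 q)
    have b1 := h2 (e 0 q) (e 1 q)
    simp [hΓ, ho] at a0 a1 b0 b1
    exact ⟨by linarith, by linarith, a0, a1⟩
  · rintro ⟨h1, h2, h3, h4⟩
    have h5 : g.leviCivita (e 2) q (e 2 q) = 0 := hb.ext fun i => by
      rw [map_zero, _root_.zero_apply, hΓ]
      match i with
      | 0 => rw [h3, neg_zero]
      | 1 => rw [h4, neg_zero]
      | 2 => rw [hself, neg_zero]
    refine ⟨h5, fun v w => ?_⟩
    have hB : ∀ v w, g.val q (g.leviCivita (e 2) q v) w = _ := fun v w => hb.bilin_eq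
      (LinearMap.mk₂ ℝ (fun v w => g.val q (g.leviCivita (e 2) q v) w) (by simp) (by simp)
        (by simp) (by simp)) v w
    rw [h5, hB v w, hB w v, hb.val_eq v w]
    simp [Fin.sum_univ_three, hΓ, hself, h3, h4, g.symm q (e 2 q)]
    linear_combination (1 / 2 : ℝ) * (g.val q v (e 1 q) * g.val q w (e 1 q)
        - g.val q v (e 0 q) * g.val q w (e 0 q)) * h1
      - (1 / 2 : ℝ) * (g.val q v (e 0 q) * g.val q w (e 1 q)
        + g.val q v (e 1 q) * g.val q w (e 0 q)) * h2

end conditions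

end frames

end LorentzMetric

/-! ### Binary quartics and their root patterns -/

section quartic

lemma quartic_eq_zero {p₀ p₁ p₂ p₃ p₄ : ℂ} (h : ∀ s t : ℂ, p₀ * s ^ 4 + p₁ * s ^ 3 * t
    + p₂ * s ^ 2 * t ^ 2 + p₃ * s * t ^ 3 + p₄ * t ^ 4 = 0) :
    p₀ = 0 ∧ p₁ = 0 ∧ p₂ = 0 ∧ p₃ = 0 ∧ p₄ = 0 := by
  -- Values at five distinct points of the projective line determine the coefficients.
  have h0 := h 1 0
  have h1 := h 0 1
  have h2 := h 1 1
  have h3 := h 1 (-1)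
  have h4 := h 2 1
  refine ⟨by linear_combination h0, ?_, by linear_combination (1 / 2) * (h2 + h3) - h0 - h1, ?_,
    by linear_combination h1⟩
  · linear_combination (1 / 6) * h4 - (1 / 2) * h2 - (1 / 6) * h3 - 2 * h0 + (1 / 2) * h1
  · linear_combination -(1 / 6) * h4 + h2 - (1 / 3) * h3 + 2 * h0 - (1 / 2) * h1

lemma quartic_coeffs {Q : ℂ → ℂ → ℂ} {κ₀ κ₁ κ₂ κ₃ κ₄ c : ℂ} {a b d f : ℂ × ℂ}
    (hQ : ∀ s t : ℂ, Q s t = κ₀ * s ^ 4 + κ₁ * s ^ 3 * t + κ₂ * s ^ 2 * t ^ 2 + κ₃ * s * t ^ 3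
      + κ₄ * t ^ 4)
    (h : ∀ s t, Q s t = c * (spinPair a s t * spinPair b s t * spinPair d s t * spinPair f s t)) :
    κ₀ = c * (a.1 * b.1 * d.1 * f.1) ∧
    κ₁ = c * (a.2 * b.1 * d.1 * f.1 + a.1 * b.2 * d.1 * f.1 + a.1 * b.1 * d.2 * f.1
      + a.1 * b.1 * d.1 * f.2) ∧
    κ₂ = c * (a.2 * b.2 * d.1 * f.1 + a.2 * b.1 * d.2 * f.1 + a.2 * b.1 * d.1 * f.2
      + a.1 * b.2 * d.2 * f.1 + a.1 * b.2 * d.1 * f.2 + a.1 * b.1 * d.2 * f.2) ∧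
    κ₃ = c * (a.1 * b.2 * d.2 * f.2 + a.2 * b.1 * d.2 * f.2 + a.2 * b.2 * d.1 * f.2
      + a.2 * b.2 * d.2 * f.1) ∧
    κ₄ = c * (a.2 * b.2 * d.2 * f.2) := by
  have := quartic_eq_zero (p₀ := κ₀ - c * (a.1 * b.1 * d.1 * f.1))
    (p₁ := κ₁ - c * (a.2 * b.1 * d.1 * f.1 + a.1 * b.2 * d.1 * f.1 + a.1 * b.1 * d.2 * f.1
      + a.1 * b.1 * d.1 * f.2))
    (p₂ := κ₂ - c * (a.2 * b.2 * d.1 * f.1 + a.2 * b.1 * d.2 * f.1 + a.2 * b.1 * d.1 * f.2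
      + a.1 * b.2 * d.2 * f.1 + a.1 * b.2 * d.1 * f.2 + a.1 * b.1 * d.2 * f.2))
    (p₃ := κ₃ - c * (a.1 * b.2 * d.2 * f.2 + a.2 * b.1 * d.2 * f.2 + a.2 * b.2 * d.1 * f.2
      + a.2 * b.2 * d.2 * f.1))
    (p₄ := κ₄ - c * (a.2 * b.2 * d.2 * f.2)) (fun s t => by
      have h1 := hQ s t
      have h2 := h s t
      simp only [spinPair] at h2
      linear_combination h2 - h1)
  simpa only [sub_eq_zero] using this

end quartic

section substitution

variable (x y z w : ℝ)

/-- The linear form `a` after the substitution `(s, t) ↦ (x s + y t, z s + w t)`. -/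
def spinMap (a : ℂ × ℂ) : ℂ × ℂ := (a.1 * x + a.2 * z, a.1 * y + a.2 * w)

variable {x y z w}

lemma spinPair_spinMap (a : ℂ × ℂ) (s t : ℂ) :
    spinPair (spinMap x y z w a) s t = spinPair a (x * s + y * t) (z * s + w * t) := by
  simp only [spinPair, spinMap]; ring

lemma spinConj_spinMap (a : ℂ × ℂ) :
    spinConj (spinMap x y z w a) = spinMap x y z w (spinConj a) := by
  simp [spinConj, spinMap]

lemma SpinReal.map {a : ℂ × ℂ} (h : SpinReal a) : SpinReal (spinMap x y z w a) := by
  rw [SpinReal, spinConj_spinMap, h]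

lemma SpinIndep.map {a b : ℂ × ℂ} (hd : x * w - y * z ≠ 0) (h : SpinIndep a b) :
    SpinIndep (spinMap x y z w a) (spinMap x y z w b) := by
  simp only [SpinIndep, spinMap] at h ⊢
  have hd' : (x * w - y * z : ℂ) ≠ 0 := by exact_mod_cast hd
  have : (a.1 * x + a.2 * z) * (b.1 * y + b.2 * w) - (a.1 * y + a.2 * w) * (b.1 * x + b.2 * z)
    = (x * w - y * z) * (a.1 * b.2 - a.2 * b.1) := by ring
  rw [this]
  exact mul_ne_zero hd' h

lemma spinMap_ne_zero {a : ℂ × ℂ} (hd : x * w - y * z ≠ 0) (h : a ≠ 0) :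
    spinMap x y z w a ≠ 0 := by
  intro h0
  have hd' : (x * w - y * z : ℂ) ≠ 0 := by exact_mod_cast hd
  simp only [spinMap, Prod.mk_eq_zero] at h0
  apply h
  apply Prod.ext
  · refine (mul_eq_zero.1 (?_ : (x * w - y * z : ℂ) * a.1 = 0)).resolve_left hd'
    linear_combination w * h0.1 - z * h0.2
  · refine (mul_eq_zero.1 (?_ : (x * w - y * z : ℂ) * a.2 = 0)).resolve_left hd'
    linear_combination x * h0.2 - y * h0.1

/-- The root pattern does not change under a real linear substitution. -/
lemma HasRootType.comp {Q : ℂ → ℂ → ℂ} {T : PetrovType} (hd : x * w - y * z ≠ 0)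
    (h : HasRootType Q T) : HasRootType (fun s t => Q (x * s + y * t) (z * s + w * t)) T := by
  have hi : ∀ {a b : ℂ × ℂ}, SpinIndep a b →
    SpinIndep (spinMap x y z w a) (spinMap x y z w b) := fun h => h.map hd
  have hi' : ∀ {a : ℂ × ℂ}, SpinIndep a (spinConj a) →
    SpinIndep (spinMap x y z w a) (spinConj (spinMap x y z w a)) := fun h => by
      rw [spinConj_spinMap]; exact h.map hd
  have h0 : ∀ {a : ℂ × ℂ}, a ≠ 0 → spinMap x y z w a ≠ 0 := fun h => spinMap_ne_zero hd h
  cases T with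
  | G =>
    obtain ⟨c, a, b, hc, h1, h2, h3, h4, h⟩ := h
    exact ⟨c, _, _, hc, hi' h1, hi' h2, hi h3, by rw [spinConj_spinMap]; exact hi h4,
      fun s t => by simp only [h, spinConj_spinMap, spinPair_spinMap]⟩
  | SG =>
    obtain ⟨c, a, b, d, hc, h1, h2, h3, h4, h⟩ := h
    exact ⟨c, _, _, _, hc, h1.map, h2.map, hi h3, hi' h4,
      fun s t => by simp only [h, spinConj_spinMap, spinPair_spinMap]⟩
  | II =>
    obtain ⟨c, a, d, hc, h1, h2, h3, h⟩ := h
    exact ⟨c, _, _, hc, h1.map, h0 h2, hi' h3,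
      fun s t => by simp only [h, spinConj_spinMap, spinPair_spinMap]⟩
  | D =>
    obtain ⟨c, d, hc, h1, h⟩ := h
    exact ⟨c, _, hc, hi' h1, fun s t => by simp only [h, spinConj_spinMap, spinPair_spinMap]⟩
  | Gr =>
    obtain ⟨c, a, b, d, f, hc, h1, h2, h3, h4, h5, h6, h7, h8, h9, h10, h⟩ := h
    exact ⟨c, _, _, _, _, hc, h1.map, h2.map, h3.map, h4.map, hi h5, hi h6, hi h7, hi h8, hi h9,
      hi h10, fun s t => by simp only [h, spinPair_spinMap]⟩
  | IIr =>
    obtain ⟨c, a, b, d, hc, h1, h2, h3, h4, h5, h6, h⟩ := h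
    exact ⟨c, _, _, _, hc, h1.map, h2.map, h3.map, hi h4, hi h5, hi h6,
      fun s t => by simp only [h, spinPair_spinMap]⟩
  | IIIr =>
    obtain ⟨c, a, b, hc, h1, h2, h3, h⟩ := h
    exact ⟨c, _, _, hc, h1.map, h2.map, hi h3, fun s t => by simp only [h, spinPair_spinMap]⟩
  | Nr =>
    obtain ⟨c, a, hc, h1, h2, h⟩ := h
    exact ⟨c, _, hc, h1.map, h0 h2, fun s t => by simp only [h, spinPair_spinMap]⟩
  | Dr =>
    obtain ⟨c, a, b, hc, h1, h2, h3, h⟩ := h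
    exact ⟨c, _, _, hc, h1.map, h2.map, hi h3, fun s t => by simp only [h, spinPair_spinMap]⟩
  | O => exact fun s t => h _ _

end substitution

/-! ### Quartics with a double root at (1:0) -/

section doubleRoot

/-- The conditions on the quartic `t² (κ₂ s² + κ₃ s t + κ₄ t²)` to have a given root pattern
(`II` and `IIr` are not distinguished). -/
def DoubleRootPattern (κ₂ κ₃ κ₄ : ℂ) : PetrovType → Prop
  | .II | .IIr => κ₂ ≠ 0 ∧ κ₃ ^ 2 - 4 * κ₂ * κ₄ ≠ 0
  | .Dr => κ₂ ≠ 0 ∧ κ₃ ^ 2 - 4 * κ₂ * κ₄ = 0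
  | .IIIr => κ₂ = 0 ∧ κ₃ ≠ 0
  | .Nr => κ₂ = 0 ∧ κ₃ = 0 ∧ κ₄ ≠ 0
  | .O => κ₂ = 0 ∧ κ₃ = 0 ∧ κ₄ = 0
  | _ => False

lemma spinConj_fst_ne_zero {a : ℂ × ℂ} (h : a.1 ≠ 0) : (spinConj a).1 ≠ 0 := by
  simpa [spinConj] using h

lemma SpinIndep.conj_fst_ne_zero {a : ℂ × ℂ} (h : SpinIndep a (spinConj a)) : a.1 ≠ 0 := by
  intro h0
  simp [SpinIndep, spinConj, h0] at h

lemma SpinIndep.snd_ne_zero {a b : ℂ × ℂ} (h : SpinIndep a b) (h0 : a.1 = 0) :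
    a.2 ≠ 0 ∧ b.1 ≠ 0 := by
  simp only [SpinIndep, h0, zero_mul, zero_sub, neg_ne_zero] at h
  exact ⟨left_ne_zero_of_mul h, right_ne_zero_of_mul h⟩

lemma SpinIndep.symm {a b : ℂ × ℂ} (h : SpinIndep a b) : SpinIndep b a := by
  intro h0
  apply h
  linear_combination -h0

/-- The vanishing coefficient of s⁴ forces some linear factor to vanish at (1:0), and that of s³t
forces a second one. Non-real factors cannot vanish there and independent ones cannot vanish there
together, so a repeated real factor is proportional to t. The remaining quadratic has a square of a
product of determinants as discriminant in the cases II and II_r. -/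
lemma HasRootType.doubleRootPattern {Q : ℂ → ℂ → ℂ} {κ₂ κ₃ κ₄ : ℂ} {T : PetrovType}
    (hQ : ∀ s t : ℂ, Q s t = κ₂ * s ^ 2 * t ^ 2 + κ₃ * s * t ^ 3 + κ₄ * t ^ 4)
    (h : HasRootType Q T) : DoubleRootPattern κ₂ κ₃ κ₄ T := by
  have hQ' : ∀ s t : ℂ, Q s t = 0 * s ^ 4 + 0 * s ^ 3 * t + κ₂ * s ^ 2 * t ^ 2 + κ₃ * s * t ^ 3
      + κ₄ * t ^ 4 := fun s t => by rw [hQ]; ring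
  cases T with
  | G =>
    obtain ⟨c, a, b, hc, h1, h2, h3, h4, h⟩ := h
    have hc' : (c : ℂ) ≠ 0 := by exact_mod_cast hc
    have := (quartic_coeffs hQ' h).1
    have a1 := h1.conj_fst_ne_zero
    have b1 := h2.conj_fst_ne_zero
    have a1' := spinConj_fst_ne_zero a1
    have b1' := spinConj_fst_ne_zero b1
    simp [hc', a1, b1, a1', b1'] at this
  | SG =>
    obtain ⟨c, a, b, d, hc, h1, h2, h3, h4, h⟩ := h
    have hc' : (c : ℂ) ≠ 0 := by exact_mod_cast hc
    obtain ⟨e0, e1, -⟩ := quartic_coeffs hQ' h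
    have d1 := h4.conj_fst_ne_zero
    have d1' := spinConj_fst_ne_zero d1
    simp only [zero_eq_mul, hc', mul_eq_zero, d1, d1', or_false, false_or] at e0
    rcases e0 with e0 | e0
    · obtain ⟨n1, n2⟩ := h3.snd_ne_zero e0
      simp [hc', e0, n1, n2, d1, d1'] at e1
    · obtain ⟨n1, n2⟩ := h3.symm.snd_ne_zero e0
      simp [hc', e0, n1, n2, d1, d1'] at e1
  | II =>
    obtain ⟨c, a, d, hc, h1, h2, h3, h⟩ := h
    have hc' : (c : ℂ) ≠ 0 := by exact_mod_cast hc
    obtain ⟨e0, e1, e2, e3, e4⟩ := quartic_coeffs (a := a) (b := a) (d := d) (f := spinConj d) hQ'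
      (fun s t => by rw [h, sq])
    have d1 := h3.conj_fst_ne_zero
    have d1' := spinConj_fst_ne_zero d1
    simp only [zero_eq_mul, hc', mul_eq_zero, d1, d1', or_false, false_or, or_self] at e0
    have a2 : a.2 ≠ 0 := fun h => h2 (Prod.ext e0 h)
    simp only [e0, zero_mul, add_zero, zero_add] at e2 e3
    refine ⟨by rw [e2]; simp [hc', a2, d1, d1'], ?_⟩
    have : κ₃ ^ 2 - 4 * κ₂ * κ₄
      = (c * a.2 ^ 2 * (d.1 * (spinConj d).2 - d.2 * (spinConj d).1)) ^ 2 := by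
      rw [e2, e3, e4]; ring
    rw [this]
    exact pow_ne_zero 2 (mul_ne_zero (mul_ne_zero hc' (pow_ne_zero 2 a2)) h3)
  | D =>
    obtain ⟨c, d, hc, h1, h⟩ := h
    have hc' : (c : ℂ) ≠ 0 := by exact_mod_cast hc
    obtain ⟨e0, -⟩ := quartic_coeffs (a := d) (b := d) (d := spinConj d) (f := spinConj d) hQ'
      (fun s t => by rw [h]; ring)
    have d1 := h1.conj_fst_ne_zero
    have d1' := spinConj_fst_ne_zero d1
    simp [hc', d1, d1'] at e0
  | Gr =>
    obtain ⟨c, a, b, d, f, hc, h1, h2, h3, h4, h5, h6, h7, h8, h9, h10, h⟩ := h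
    have hc' : (c : ℂ) ≠ 0 := by exact_mod_cast hc
    obtain ⟨e0, e1, -⟩ := quartic_coeffs hQ' h
    simp only [zero_eq_mul, hc', mul_eq_zero, false_or] at e0
    rcases e0 with ((e0 | e0) | e0) | e0
    · simp [hc', e0, (h5.snd_ne_zero e0).1, (h5.snd_ne_zero e0).2, (h6.snd_ne_zero e0).2,
        (h7.snd_ne_zero e0).2] at e1
    · simp [hc', e0, (h8.snd_ne_zero e0).1, (h5.symm.snd_ne_zero e0).2, (h8.snd_ne_zero e0).2,
        (h9.snd_ne_zero e0).2] at e1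
    · simp [hc', e0, (h10.snd_ne_zero e0).1, (h6.symm.snd_ne_zero e0).2, (h8.symm.snd_ne_zero e0).2,
        (h10.snd_ne_zero e0).2] at e1
    · simp [hc', e0, (h7.symm.snd_ne_zero e0).1, (h7.symm.snd_ne_zero e0).2,
        (h9.symm.snd_ne_zero e0).2, (h10.symm.snd_ne_zero e0).2] at e1
  | IIr =>
    obtain ⟨c, a, b, d, hc, h1, h2, h3, h4, h5, h6, h⟩ := h
    have hc' : (c : ℂ) ≠ 0 := by exact_mod_cast hc
    obtain ⟨e0, e1, e2, e3, e4⟩ := quartic_coeffs (a := a) (b := a) (d := b) (f := d) hQ'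
      (fun s t => by rw [h, sq])
    simp only [zero_eq_mul, hc', mul_eq_zero, false_or, or_self] at e0
    rcases e0 with (e0 | e0) | e0
    · obtain ⟨a2, b1⟩ := h4.snd_ne_zero e0
      have d1 := (h5.snd_ne_zero e0).2
      simp only [e0, zero_mul, add_zero, zero_add] at e2 e3
      refine ⟨by rw [e2]; simp [hc', a2, b1, d1], ?_⟩
      have : κ₃ ^ 2 - 4 * κ₂ * κ₄ = (c * a.2 ^ 2 * (b.1 * d.2 - b.2 * d.1)) ^ 2 := by
        rw [e2, e3, e4]; ring
      rw [this]
      exact pow_ne_zero 2 (mul_ne_zero (mul_ne_zero hc' (pow_ne_zero 2 a2)) h6)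
    · simp [hc', e0, (h6.snd_ne_zero e0).1, (h6.snd_ne_zero e0).2, (h4.symm.snd_ne_zero e0).2] at e1
    · simp [hc', e0, (h6.symm.snd_ne_zero e0).1, (h6.symm.snd_ne_zero e0).2,
        (h5.symm.snd_ne_zero e0).2] at e1
  | IIIr =>
    obtain ⟨c, a, b, hc, h1, h2, h3, h⟩ := h
    have hc' : (c : ℂ) ≠ 0 := by exact_mod_cast hc
    obtain ⟨e0, e1, e2, e3, e4⟩ := quartic_coeffs (a := a) (b := a) (d := a) (f := b) hQ'
      (fun s t => by rw [h]; ring)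
    simp only [zero_eq_mul, hc', mul_eq_zero, false_or, or_self] at e0
    rcases e0 with e0 | e0
    · obtain ⟨a2, b1⟩ := h3.snd_ne_zero e0
      exact ⟨by rw [e2]; simp [e0], by rw [e3]; simp [e0, hc', a2, b1]⟩
    · simp [hc', e0, (h3.symm.snd_ne_zero e0).1, (h3.symm.snd_ne_zero e0).2] at e1
  | Nr =>
    obtain ⟨c, a, hc, h1, h2, h⟩ := h
    have hc' : (c : ℂ) ≠ 0 := by exact_mod_cast hc
    obtain ⟨e0, e1, e2, e3, e4⟩ := quartic_coeffs (a := a) (b := a) (d := a) (f := a) hQ'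
      (fun s t => by rw [h]; ring)
    simp only [zero_eq_mul, hc', mul_eq_zero, false_or, or_self] at e0
    have a2 : a.2 ≠ 0 := fun h => h2 (Prod.ext e0 h)
    exact ⟨by rw [e2]; simp [e0], by rw [e3]; simp [e0], by rw [e4]; simp [hc', a2]⟩
  | Dr =>
    obtain ⟨c, a, b, hc, h1, h2, h3, h⟩ := h
    have hc' : (c : ℂ) ≠ 0 := by exact_mod_cast hc
    obtain ⟨e0, e1, e2, e3, e4⟩ := quartic_coeffs (a := a) (b := a) (d := b) (f := b) hQ'
      (fun s t => by rw [h]; ring)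
    simp only [zero_eq_mul, hc', mul_eq_zero, false_or, or_self, or_assoc] at e0
    rcases e0 with e0 | e0
    · obtain ⟨a2, b1⟩ := h3.snd_ne_zero e0
      simp only [e0, zero_mul, mul_zero, add_zero, zero_add] at e2 e3
      exact ⟨by rw [e2]; simp [hc', a2, b1], by rw [e2, e3, e4]; ring⟩
    · obtain ⟨b2, a1⟩ := h3.symm.snd_ne_zero e0
      simp only [e0, zero_mul, mul_zero, add_zero, zero_add] at e2 e3
      exact ⟨by rw [e2]; simp [hc', b2, a1], by rw [e2, e3, e4]; ring⟩
  | O =>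
    obtain ⟨-, -, h2, h3, h4⟩ := quartic_eq_zero (p₀ := 0) (p₁ := 0) (p₂ := κ₂) (p₃ := κ₃) (p₄ := κ₄)
      (fun s t => by rw [← hQ']; exact h s t)
    exact ⟨h2, h3, h4⟩

/-- The pair (0,1) is the linear form t. The remaining quadratic is factored by the quadratic
formula, and the sign of its discriminant separates II, D_r and II_r. -/
lemma exists_hasRootType {Q : ℂ → ℂ → ℂ} {κ₂ κ₃ κ₄ : ℝ}
    (hQ : ∀ s t : ℂ, Q s t = κ₂ * s ^ 2 * t ^ 2 + κ₃ * s * t ^ 3 + κ₄ * t ^ 4) :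
    ∃ T ∈ ({.II, .IIr, .Dr, .IIIr, .Nr, .O} : Set PetrovType), HasRootType Q T := by
  have hreal : ∀ r : ℝ, SpinReal ((1, (r : ℂ)) : ℂ × ℂ) := fun r => by simp [SpinReal, spinConj]
  have h01 : SpinReal ((0, 1) : ℂ × ℂ) := by simp [SpinReal, spinConj]
  have hind : ∀ z : ℂ, SpinIndep ((0, 1) : ℂ × ℂ) (1, z) := fun z => by simp [SpinIndep]
  by_cases h2 : κ₂ = 0
  · by_cases h3 : κ₃ = 0
    · by_cases h4 : κ₄ = 0
      · exact ⟨.O, by simp, fun s t => by rw [hQ, h2, h3, h4]; simp⟩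
      · exact ⟨.Nr, by simp, κ₄, (0, 1), h4, h01, by simp, fun s t => by
          rw [hQ, h2, h3]; simp [spinPair]⟩
    · refine ⟨.IIIr, by simp, κ₃, (0, 1), (1, ((κ₄ / κ₃ : ℝ) : ℂ)), h3, h01, hreal _, hind _,
        fun s t => ?_⟩
      have h3' : (κ₃ : ℂ) ≠ 0 := by exact_mod_cast h3
      rw [hQ, h2]
      simp only [spinPair]
      push_cast
      field_simp
      ring
  · have h2' : (κ₂ : ℂ) ≠ 0 := by exact_mod_cast h2
    rcases lt_trichotomy (κ₃ ^ 2 - 4 * κ₂ * κ₄) 0 with hd | hd | hd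
    · obtain ⟨r, hr⟩ : ∃ r, r = Real.sqrt (-(κ₃ ^ 2 - 4 * κ₂ * κ₄)) := ⟨_, rfl⟩
      have hr0 : r ≠ 0 := by rw [hr]; exact (Real.sqrt_pos.2 (by linarith)).ne'
      have hrr : r ^ 2 = -(κ₃ ^ 2 - 4 * κ₂ * κ₄) := by rw [hr]; exact Real.sq_sqrt (by linarith)
      have hrr' : (r : ℂ) ^ 2 = -(κ₃ ^ 2 - 4 * κ₂ * κ₄) := by exact_mod_cast hrr
      have hconj : spinConj ((1, (κ₃ + r * Complex.I) / (2 * κ₂)) : ℂ × ℂ)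
          = (1, (κ₃ - r * Complex.I) / (2 * κ₂)) := by
        simp [spinConj, sub_eq_add_neg, Complex.conj_ofNat]
      refine ⟨.II, by simp, κ₂, (0, 1), (1, (κ₃ + r * Complex.I) / (2 * κ₂)), h2, h01, by simp, ?_,
        fun s t => ?_⟩
      · rw [hconj]
        simp only [SpinIndep]
        rw [one_mul, mul_one, ← sub_div]
        refine div_ne_zero ?_ (mul_ne_zero two_ne_zero h2')
        ring_nf
        simp [hr0]
      · rw [hQ, hconj]
        simp only [spinPair]
        field_simp
        linear_combination (-t ^ 4) * hrr' + t ^ 4 * r ^ 2 * Complex.I_sq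
    · refine ⟨.Dr, by simp, κ₂, (0, 1), (1, ((κ₃ / (2 * κ₂) : ℝ) : ℂ)), h2, h01, hreal _, hind _,
        fun s t => ?_⟩
      have hd' : (κ₃ ^ 2 - 4 * κ₂ * κ₄ : ℂ) = 0 := by exact_mod_cast hd
      rw [hQ]
      simp only [spinPair]
      push_cast
      field_simp
      linear_combination (-t ^ 4) * hd'
    · obtain ⟨r, hr⟩ : ∃ r, r = Real.sqrt (κ₃ ^ 2 - 4 * κ₂ * κ₄) := ⟨_, rfl⟩
      have hr0 : r ≠ 0 := by rw [hr]; exact (Real.sqrt_pos.2 (by linarith)).ne'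
      have hrr : r ^ 2 = κ₃ ^ 2 - 4 * κ₂ * κ₄ := by rw [hr]; exact Real.sq_sqrt (by linarith)
      have hrr' : (r : ℂ) ^ 2 = κ₃ ^ 2 - 4 * κ₂ * κ₄ := by exact_mod_cast hrr
      refine ⟨.IIr, by simp, κ₂, (0, 1), (1, (((κ₃ + r) / (2 * κ₂) : ℝ) : ℂ)),
        (1, (((κ₃ - r) / (2 * κ₂) : ℝ) : ℂ)), h2, h01, hreal _, hreal _, hind _, hind _, ?_,
        fun s t => ?_⟩
      · simp only [SpinIndep]
        rw [one_mul, mul_one, ← Complex.ofReal_sub, Complex.ofReal_ne_zero, ← sub_div]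
        refine div_ne_zero ?_ (mul_ne_zero two_ne_zero h2)
        ring_nf
        simp [hr0]
      · rw [hQ]
        simp only [spinPair]
        push_cast
        field_simp
        linear_combination (t ^ 4) * hrr'

end doubleRoot

namespace LorentzMetric

variable {M : Type*} [TopologicalSpace M] [ChartedSpace E3 M] [IsManifold 𝓘(ℝ, E3) ∞ M]

/-! ### The action of SL(2,ℝ) on null frames and the invariance of the type -/

section petrov

variable {g : LorentzMetric M} {p : M} {k l u v k' l' u' n : TangentSpace 𝓘(ℝ, E3) p}
  {s₀ s₁ t₀ t₁ : ℝ} {T : PetrovType}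

lemma IsNullFrame.phi_uu (h : g.IsNullFrame p k l u) : g.phi p u u = - 2 * g.phi p k l := by
  have := h.isOrthoTriple.phi_trace
  simp [Fin.sum_univ_three, g.phi_symm l k] at this
  linarith

/-- Two symmetric bilinear forms that agree on a null frame are equal. -/
lemma IsNullFrame.bilin_ext (h : g.IsNullFrame p k l u)
    {B B' : TangentSpace 𝓘(ℝ, E3) p →ₗ[ℝ] TangentSpace 𝓘(ℝ, E3) p →ₗ[ℝ] ℝ}
    (hB : ∀ v w, B v w = B w v) (hB' : ∀ v w, B' v w = B' w v) (hkk : B k k = B' k k)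
    (hku : B k u = B' k u) (hkl : B k l = B' k l) (huu : B u u = B' u u) (hul : B u l = B' u l)
    (hll : B l l = B' l l) (v w : TangentSpace 𝓘(ℝ, E3) p) : B v w = B' v w := by
  rw [h.expand v, h.expand w]
  simp only [map_add, map_smul, LinearMap.add_apply, LinearMap.smul_apply, smul_eq_mul, hB u k,
    hB' u k, hB l k, hB' l k, hB l u, hB' l u, hkk, hku, hkl, huu, hul, hll]

/-- The null vector `s² k + √2 s t u - t² l`. -/
noncomputable def spinVector (k l u : TangentSpace 𝓘(ℝ, E3) p) (s t : ℝ) :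
    TangentSpace 𝓘(ℝ, E3) p :=
  s ^ 2 • k + (s * t) • (Real.sqrt 2 • u) - t ^ 2 • l

lemma IsNullFrame.sqrt_two_smul (h : g.IsNullFrame p k l u) :
    g.val p (Real.sqrt 2 • u) (Real.sqrt 2 • u) = 2 := by
  simp [h.uu]

/-- The quartic in terms of `√2 u`. -/
lemma ricciQuartic_eq (g : LorentzMetric M) (k l u : TangentSpace 𝓘(ℝ, E3) p) (s t : ℂ) :
    g.ricciQuartic p k l u s t = 1 / 2 * ((g.phi p k k : ℝ) * s ^ 4
      + 2 * (g.phi p k (Real.sqrt 2 • u) : ℝ) * s ^ 3 * t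
      + ((g.phi p (Real.sqrt 2 • u) (Real.sqrt 2 • u) : ℝ) - 2 * (g.phi p k l : ℝ)) * s ^ 2 * t ^ 2
      - 2 * (g.phi p (Real.sqrt 2 • u) l : ℝ) * s * t ^ 3 + (g.phi p l l : ℝ) * t ^ 4) := by
  simp only [ricciQuartic, ← phi_apply, Fin.sum_univ_three, Matrix.cons_val_zero,
    Matrix.cons_val_one, Matrix.cons_val, map_smul, LinearMap.smul_apply, smul_eq_mul,
    g.phi_symm l k, g.phi_symm u k, g.phi_symm l u, Complex.ofReal_mul]
  ring

lemma IsNullFrame.neg (h : g.IsNullFrame p k l u) : g.IsNullFrame p (-k) (-l) (-u) := by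
  constructor <;> simp [h.kk, h.ll, h.kl, h.ku, h.lu, h.uu]

lemma ricciQuartic_neg (g : LorentzMetric M) (k l u : TangentSpace 𝓘(ℝ, E3) p) :
    g.ricciQuartic p (-k) (-l) (-u) = g.ricciQuartic p k l u := by
  funext s t
  simp [ricciQuartic_eq]

lemma ricciQuartic_neg_right (g : LorentzMetric M) (k l u : TangentSpace 𝓘(ℝ, E3) p) (s t : ℂ) :
    g.ricciQuartic p k l (-u) s t = g.ricciQuartic p k l u s (-t) := by
  simp [ricciQuartic_eq]
  ring

/-- The action of `SL(2, ℝ)` on null frames. -/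
lemma IsNullFrame.rotate (h : g.IsNullFrame p k l u) (hd : s₀ * t₁ - s₁ * t₀ = 1) :
    ∃ u', g.IsNullFrame p (spinVector k l u s₀ t₀) (- spinVector k l u s₁ t₁) u' ∧
      ∀ s t : ℂ, g.ricciQuartic p (spinVector k l u s₀ t₀) (- spinVector k l u s₁ t₁) u' s t
        = g.ricciQuartic p k l u (s₀ * s + s₁ * t) (t₀ * s + t₁ * t) := by
  obtain ⟨z, hz⟩ : ∃ z, z = Real.sqrt 2 • u := ⟨_, rfl⟩
  have hr : Real.sqrt 2 ≠ 0 := by positivity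
  have hzz : g.val p z z = 2 := hz ▸ h.sqrt_two_smul
  have hkz : g.val p k z = 0 := by simp [hz, h.ku]
  have hlz : g.val p l z = 0 := by simp [hz, h.lu]
  -- Substituting a linear change of (s,t) into s² k + s t z - t² l, where z = √2 u, the
  -- coefficients of s², s t and -t² are the new k, √2 u and l; this is the middle one.
  obtain ⟨z', hz'⟩ : ∃ z', z' = (2 * s₀ * s₁) • k + (s₀ * t₁ + s₁ * t₀) • z
    - (2 * t₀ * t₁) • l := ⟨_, rfl⟩
  have hz'' : Real.sqrt 2 • (Real.sqrt 2)⁻¹ • z' = z' := by rw [smul_smul, mul_inv_cancel₀ hr, one_smul]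
  refine ⟨(Real.sqrt 2)⁻¹ • z', ⟨?_, ?_, ?_, ?_, ?_, ?_⟩, fun s t => ?_⟩
  · simp only [spinVector, ← hz, map_add, map_sub, map_smul, _root_.add_apply, _root_.sub_apply,
      _root_.smul_apply, smul_eq_mul, h.kk, h.kl, h.ll, hkz, hlz, hzz, g.symm p l k, g.symm p z]
    ring
  · simp only [spinVector, ← hz, map_add, map_sub, map_smul, map_neg, _root_.neg_apply,
      _root_.add_apply, _root_.sub_apply, _root_.smul_apply, smul_eq_mul, h.kk, h.kl, h.ll, hkz,
      hlz, hzz, g.symm p l k, g.symm p z]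
    ring
  · simp only [spinVector, ← hz, map_add, map_sub, map_smul, map_neg, _root_.add_apply,
      _root_.sub_apply, _root_.smul_apply, smul_eq_mul, h.kk, h.kl, h.ll, hkz, hlz, hzz,
      g.symm p l k, g.symm p z]
    linear_combination (s₀ * t₁ - s₁ * t₀ + 1) * hd
  · rw [map_smul, hz']
    simp only [spinVector, ← hz, map_add, map_sub, map_smul, _root_.add_apply, _root_.sub_apply,
      _root_.smul_apply, smul_eq_mul, h.kk, h.kl, h.ll, hkz, hlz, hzz, g.symm p l k, g.symm p z]
    ring
  · rw [map_smul, hz']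
    simp only [spinVector, ← hz, map_add, map_sub, map_smul, map_neg, _root_.neg_apply,
      _root_.add_apply, _root_.sub_apply, _root_.smul_apply, smul_eq_mul, h.kk, h.kl, h.ll, hkz,
      hlz, hzz, g.symm p l k, g.symm p z]
    ring
  · have h2 : g.val p z' z' = 2 := by
      rw [hz']
      simp only [map_add, map_sub, map_smul, _root_.add_apply, _root_.sub_apply,
        _root_.smul_apply, smul_eq_mul, h.kk, h.kl, h.ll, hkz, hlz, hzz, g.symm p l k, g.symm p z]
      linear_combination 2 * (s₀ * t₁ - s₁ * t₀ + 1) * hd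
    rw [map_smul, map_smul, _root_.smul_apply, h2, smul_eq_mul, smul_eq_mul, ← mul_assoc,
      ← mul_inv, Real.mul_self_sqrt (by norm_num)]
    norm_num
  · rw [ricciQuartic_eq, ricciQuartic_eq, hz'', hz']
    simp only [spinVector, ← hz, map_add, map_sub, map_smul, map_neg, LinearMap.neg_apply,
      LinearMap.add_apply, LinearMap.sub_apply, LinearMap.smul_apply, smul_eq_mul, g.phi_symm l k,
      g.phi_symm z k, g.phi_symm l z]
    push_cast
    ring

/-- A real null vector is, up to sign, the vector of a real spinor. -/
lemma IsNullFrame.exists_spinVector (h : g.IsNullFrame p k l u) (hv : g.val p v v = 0)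
    (hvl : 0 ≤ g.val p v l) (hvk : g.val p v k ≤ 0) : ∃ s t : ℝ, v = spinVector k l u s t := by
  have hvv : g.val p v u ^ 2 = - 2 * g.val p v l * g.val p v k := by
    have h1 := h.expand v
    have : g.val p v v = 2 * g.val p v l * g.val p v k + g.val p v u ^ 2 := by
      conv_lhs => rw [h1]
      simp only [map_add, map_smul, _root_.add_apply, _root_.smul_apply, smul_eq_mul, h.kk, h.ll,
        h.kl, h.ku, h.lu, h.uu, g.symm p l k, g.symm p u k, g.symm p u l]
      ring
    linarith
  obtain ⟨s, hs⟩ : ∃ s, s = Real.sqrt (g.val p v l) := ⟨_, rfl⟩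
  obtain ⟨t, ht⟩ : ∃ t, t = Real.sqrt (- g.val p v k) := ⟨_, rfl⟩
  have hs2 : s ^ 2 = g.val p v l := by rw [hs]; exact Real.sq_sqrt hvl
  have ht2 : t ^ 2 = - g.val p v k := by rw [ht]; exact Real.sq_sqrt (by linarith)
  have hr2 : Real.sqrt 2 ^ 2 = 2 := Real.sq_sqrt (by norm_num)
  have h2 : (g.val p v u - Real.sqrt 2 * s * t) * (g.val p v u + Real.sqrt 2 * s * t) = 0 := by
    have : (Real.sqrt 2 * s * t) ^ 2 = - 2 * g.val p v l * g.val p v k := by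
      rw [mul_pow, mul_pow, hr2, hs2, ht2]; ring
    linear_combination hvv - this
  have hex := h.expand v
  rcases mul_eq_zero.1 h2 with h3 | h3
  · refine ⟨s, t, ?_⟩
    rw [spinVector, hs2, ht2]
    refine hex.trans ?_
    rw [sub_eq_zero.1 h3]
    module
  · refine ⟨s, -t, ?_⟩
    rw [spinVector, hs2, neg_sq, ht2]
    refine hex.trans ?_
    rw [eq_neg_of_add_eq_zero_left h3]
    module

/-- After a possible change of sign of the whole frame, which does not affect the quartic, `k` comes
from a real spinor. This spinor is completed to a matrix in SL(2,ℝ). -/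
lemma HasPetrovType.exists_adapted (hT : g.HasPetrovType p T) (hk : g.val p k k = 0)
    (hk0 : k ≠ 0) : ∃ l u, g.IsNullFrame p k l u ∧ HasRootType (g.ricciQuartic p k l u) T := by
  obtain ⟨k₀, l₀, u₀, h, hQ⟩ := hT
  obtain ⟨k₁, l₁, u₁, h, hQ, s, t, rfl⟩ : ∃ k₁ l₁ u₁, g.IsNullFrame p k₁ l₁ u₁ ∧
      HasRootType (g.ricciQuartic p k₁ l₁ u₁) T ∧ ∃ s t, k = spinVector k₁ l₁ u₁ s t := by
    have hkk : g.val p k u₀ ^ 2 = - 2 * (g.val p k l₀ * g.val p k k₀) := by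
      have : g.val p k k = 2 * g.val p k l₀ * g.val p k k₀ + g.val p k u₀ ^ 2 := by
        conv_lhs => rw [h.expand k]
        simp only [map_add, map_smul, _root_.add_apply, _root_.smul_apply, smul_eq_mul, h.kk, h.ll,
          h.kl, h.ku, h.lu, h.uu, g.symm p l₀ k₀, g.symm p u₀ k₀, g.symm p u₀ l₀]
        ring
      linarith
    have hneg : g.val p k l₀ * g.val p k k₀ ≤ 0 := by nlinarith [sq_nonneg (g.val p k u₀)]
    rcases mul_nonpos_iff.1 hneg with ⟨h1, h2⟩ | ⟨h1, h2⟩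
    · exact ⟨k₀, l₀, u₀, h, hQ, h.exists_spinVector hk h1 h2⟩
    · exact ⟨-k₀, -l₀, -u₀, h.neg, by rwa [ricciQuartic_neg],
        h.neg.exists_spinVector hk (by simpa using h1) (by simpa using h2)⟩
  have hst : s ^ 2 + t ^ 2 ≠ 0 := by
    intro h0
    have hs : s = 0 := by nlinarith [sq_nonneg s, sq_nonneg t]
    have ht : t = 0 := by nlinarith [sq_nonneg s, sq_nonneg t]
    exact hk0 (by simp [spinVector, hs, ht])
  -- The second column (-t, s)/(s² + t²) gives determinant 1.
  have hd : s * (s / (s ^ 2 + t ^ 2)) - (-t / (s ^ 2 + t ^ 2)) * t = 1 := by field_simp; ring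
  obtain ⟨u', h', hQ'⟩ := h.rotate hd
  refine ⟨_, u', h', ?_⟩
  have := hQ.comp (x := s) (y := -t / (s ^ 2 + t ^ 2)) (z := t) (w := s / (s ^ 2 + t ^ 2))
    (by rw [hd]; exact one_ne_zero)
  convert this using 3 with s' t'
  exact hQ' s' t'

/-- The Petrov type can be computed in every null frame. -/
lemma HasPetrovType.hasRootType (hT : g.HasPetrovType p T) (h : g.IsNullFrame p k l u) :
    HasRootType (g.ricciQuartic p k l u) T := by
  obtain ⟨l₀, u₀, h₀, hQ⟩ := hT.exists_adapted h.kk h.ne_zero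
  have hex := h₀.expand l
  rw [g.symm p l k, h.kl, one_smul] at hex
  -- Null frames with the same first vector `k` differ by a null rotation, with parameter `z`, and
  -- by the sign of `u`; the latter amounts to t ↦ -t in the quartic.
  obtain ⟨z, hz⟩ : ∃ z, z = - g.val p l u₀ / Real.sqrt 2 := ⟨_, rfl⟩
  have hr : Real.sqrt 2 ≠ 0 := by positivity
  have hr2 : Real.sqrt 2 ^ 2 = 2 := Real.sq_sqrt (by norm_num)
  have hzu : g.val p l u₀ = - z * Real.sqrt 2 := by rw [hz]; field_simp
  have hll : 2 * g.val p l l₀ + g.val p l u₀ ^ 2 = 0 := by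
    rw [← h.ll]
    conv_rhs => rw [hex]
    simp only [map_add, map_smul, _root_.add_apply, _root_.smul_apply, smul_eq_mul, h₀.kk, h₀.ll,
      h₀.kl, h₀.ku, h₀.lu, h₀.uu, g.symm p l₀ k, g.symm p u₀ k, g.symm p u₀ l₀]
    ring
  have hl : l = - spinVector k l₀ u₀ z 1 := by
    have : g.val p l l₀ = - z ^ 2 := by
      rw [hzu, mul_pow, hr2] at hll; linarith
    rw [spinVector]
    refine hex.trans ?_
    rw [this, hzu]
    module
  have hk : k = spinVector k l₀ u₀ 1 0 := by simp [spinVector]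
  obtain ⟨u', h', hQ'⟩ := h₀.rotate (s₀ := 1) (t₀ := 0) (s₁ := z) (t₁ := 1) (by norm_num)
  rw [← hk, ← hl] at h' hQ'
  have hQ'' : HasRootType (g.ricciQuartic p k l u') T := by
    have := hQ.comp (x := 1) (y := z) (z := 0) (w := 1) (by norm_num)
    convert this using 3 with s t
    exact hQ' s t
  have hu := h'.expand u
  rw [g.symm p u l, h.lu, g.symm p u k, h.ku, zero_smul, zero_smul, zero_add, zero_add] at hu
  have huu := h.uu
  conv_lhs at huu => rw [hu]
  have huu' : g.val p u u' * g.val p u u' = 1 := by simpa [h'.uu] using huu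
  rcases mul_self_eq_one_iff.1 huu' with huu | huu
  · rw [huu, one_smul] at hu
    rwa [hu]
  · rw [huu, neg_one_smul] at hu
    rw [hu]
    have := hQ''.comp (x := 1) (y := 0) (z := 0) (w := -1) (by norm_num)
    convert this using 3 with s t
    rw [ricciQuartic_neg_right]
    simp

end petrov

end LorentzMetric

/-! ### Quartics that are squares of quadratic forms -/

section quadratic

lemma SpinReal.exists_real {z : ℂ × ℂ} (h : SpinReal z) :
    ∃ z₁ z₂ : ℝ, z = ((z₁ : ℂ), (z₂ : ℂ)) := by
  have := Prod.ext_iff.1 h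
  exact ⟨z.1.re, z.2.re, Prod.ext (Complex.conj_eq_iff_re.1 this.1).symm
    (Complex.conj_eq_iff_re.1 this.2).symm⟩

/-- For D the quadratic form is a product of two conjugate factors and is definite; for D_r it is a
product of independent real factors and is indefinite. The sign σ records this difference. -/
lemma HasRootType.exists_quadratic {Q : ℂ → ℂ → ℂ} {T : PetrovType} {σ : ℝ} (h : HasRootType Q T)
    (hT : T = .D ∧ σ = -1 ∨ T = .Dr ∧ σ = 1) : ∃ c α β δ : ℝ, c ≠ 0 ∧ 0 < σ * (β ^ 2 - α * δ) ∧
      ∀ s t, Q s t = c * (α * s ^ 2 + 2 * β * s * t + δ * t ^ 2) ^ 2 := by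
  rcases hT with ⟨rfl, rfl⟩ | ⟨rfl, rfl⟩
  · obtain ⟨c, x, hc, hx, h⟩ := h
    obtain ⟨a, b⟩ := x
    obtain ⟨a₁, a₂⟩ := a
    obtain ⟨b₁, b₂⟩ := b
    have ha : (⟨a₁, a₂⟩ : ℂ) = a₁ + a₂ * Complex.I := Complex.mk_eq_add_mul_I _ _
    have hb : (⟨b₁, b₂⟩ : ℂ) = b₁ + b₂ * Complex.I := Complex.mk_eq_add_mul_I _ _
    refine ⟨c, a₁ ^ 2 + a₂ ^ 2, a₁ * b₁ + a₂ * b₂, b₁ ^ 2 + b₂ ^ 2, hc, ?_, fun s t => ?_⟩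
    · have h0 : a₁ * b₂ - a₂ * b₁ ≠ 0 := by
        intro h0
        apply hx
        simp only [spinConj, ha, hb, map_add, map_mul, Complex.conj_ofReal, Complex.conj_I]
        have h0' : (a₁ * b₂ - a₂ * b₁ : ℂ) = 0 := by exact_mod_cast h0
        linear_combination (-2 * Complex.I) * h0'
      have := sq_pos_of_ne_zero h0
      nlinarith
    · rw [h, ← mul_pow]
      congr 2
      simp only [spinPair, spinConj, ha, hb, map_add, map_mul, Complex.conj_ofReal, Complex.conj_I]
      push_cast
      linear_combination (-(a₂ * s + b₂ * t) ^ 2) * Complex.I_sq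
  · obtain ⟨c, a, b, hc, ha, hb, hab, h⟩ := h
    obtain ⟨a₁, a₂, rfl⟩ := ha.exists_real
    obtain ⟨b₁, b₂, rfl⟩ := hb.exists_real
    refine ⟨c, a₁ * b₁, (a₁ * b₂ + a₂ * b₁) / 2, a₂ * b₂, hc, ?_, fun s t => ?_⟩
    · have h0 : a₁ * b₂ - a₂ * b₁ ≠ 0 := by
        intro h0
        apply hab
        simp only
        exact_mod_cast h0
      have := sq_pos_of_ne_zero h0
      nlinarith
    · rw [h, ← mul_pow]
      congr 2
      simp only [spinPair]
      push_cast
      ring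

lemma not_spinIndep_of_not {a b x : ℂ × ℂ} (ha : ¬ SpinIndep a x) (hb : ¬ SpinIndep b x)
    (hx : x ≠ 0) : ¬ SpinIndep a b := by
  simp only [SpinIndep, not_not] at *
  by_cases h : x.1 = 0
  · have h2 : x.2 ≠ 0 := fun h2 => hx (Prod.ext h h2)
    rw [h, mul_zero, sub_zero, mul_eq_zero, or_iff_left h2] at ha hb
    rw [ha, hb]; ring
  · apply mul_left_cancel₀ h
    linear_combination b.1 * ha - a.1 * hb

/-- The root pattern `D` excludes all other patterns. -/
lemma HasRootType.eq_D {Q : ℂ → ℂ → ℂ} {T : PetrovType} {c : ℝ} {x : ℂ × ℂ} (hc : c ≠ 0)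
    (hx : SpinIndep x (spinConj x))
    (hQ : ∀ s t, Q s t = c * (spinPair x s t ^ 2 * spinPair (spinConj x) s t ^ 2))
    (h : HasRootType Q T) : T = .D := by
  have hc' : (c : ℂ) ≠ 0 := by exact_mod_cast hc
  have hx0 : x ≠ 0 := by rintro rfl; simp [SpinIndep] at hx
  have hx0' : spinConj x ≠ 0 := by
    intro h0; rw [h0] at hx; simp [SpinIndep] at hx
  have conj_conj : ∀ a, spinConj (spinConj a) = a := fun a => by simp [spinConj]
  have conj_not : ∀ {a b}, ¬ SpinIndep a b → ¬ SpinIndep (spinConj a) (spinConj b) := by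
    intro a b h
    simp only [SpinIndep, not_not, spinConj] at h ⊢
    rw [← map_mul, ← map_mul, ← map_sub, h, map_zero]
  -- The point (-a.2, a.1) is the zero of the form `a`; a zero of the quartic makes `a` proportional
  -- to `x` or to its conjugate.
  have root : ∀ a : ℂ × ℂ, Q (-a.2) a.1 = 0 → ¬ SpinIndep a x ∨ ¬ SpinIndep a (spinConj x) := by
    intro a ha
    rw [hQ, mul_eq_zero, or_iff_right hc', mul_eq_zero, pow_eq_zero_iff two_ne_zero,
      pow_eq_zero_iff two_ne_zero] at ha
    refine ha.imp (fun h => ?_) (fun h => ?_)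
    · simp only [SpinIndep, not_not, spinPair] at h ⊢
      linear_combination h
    · simp only [SpinIndep, not_not, spinPair] at h ⊢
      linear_combination h
  have self : ∀ a : ℂ × ℂ, spinPair a (-a.2) a.1 = 0 := fun a => by simp only [spinPair]; ring
  -- A real form proportional to one of `x`, x̄ is proportional to the other by conjugation, but
  -- these two are independent.
  have noReal : ∀ a : ℂ × ℂ, SpinReal a → a ≠ 0 → Q (-a.2) a.1 ≠ 0 := by
    intro a ha ha0 h0
    have hs : ∀ {b c : ℂ × ℂ}, ¬ SpinIndep b c → ¬ SpinIndep c b := fun h h' => h h'.symm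
    rcases root a h0 with h1 | h1
    · have h2 := conj_not h1
      rw [ha] at h2
      exact not_spinIndep_of_not (hs h1) (hs h2) ha0 hx
    · have h2 := conj_not h1
      rw [ha, conj_conj] at h2
      exact not_spinIndep_of_not (hs h2) (hs h1) ha0 hx
  have ne : ∀ {a b : ℂ × ℂ}, SpinIndep a b → a ≠ 0 := by
    rintro a b h rfl; simp [SpinIndep] at h
  cases T with
  | G =>
    obtain ⟨c', a, b, -, h1, h2, h3, h4, h⟩ := h
    have ra := root a (by rw [h, self]; ring)
    have ra' := root (spinConj a) (by rw [h, self]; ring)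
    have rb := root b (by rw [h, self]; ring)
    have h5 : SpinIndep (spinConj a) b := by
      by_contra h5
      exact conj_not h5 (by rwa [conj_conj])
    -- Pigeonhole: of the pairwise independent forms `a`, its conjugate and `b`, two would be
    -- proportional to the same one of `x`, x̄.
    rcases ra with ra | ra <;> rcases ra' with ra' | ra' <;> rcases rb with rb | rb
    · exact (not_spinIndep_of_not ra ra' hx0 h1).elim
    · exact (not_spinIndep_of_not ra ra' hx0 h1).elim
    · exact (not_spinIndep_of_not ra rb hx0 h3).elim
    · exact (not_spinIndep_of_not ra' rb hx0' h5).elim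
    · exact (not_spinIndep_of_not ra' rb hx0 h5).elim
    · exact (not_spinIndep_of_not ra rb hx0' h3).elim
    · exact (not_spinIndep_of_not ra ra' hx0' h1).elim
    · exact (not_spinIndep_of_not ra ra' hx0' h1).elim
  | SG =>
    obtain ⟨c', a, b, d, -, h1, h2, h3, h4, h⟩ := h
    exact (noReal a h1 (ne h3) (by rw [h, self]; ring)).elim
  | II =>
    obtain ⟨c', a, d, -, h1, h2, h3, h⟩ := h
    exact (noReal a h1 h2 (by rw [h, self]; ring)).elim
  | D => rfl
  | Gr =>
    obtain ⟨c', a, b, d, f, -, h1, h2, h3, h4, h5, h6, h7, h8, h9, h10, h⟩ := h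
    exact (noReal a h1 (ne h5) (by rw [h, self]; ring)).elim
  | IIr =>
    obtain ⟨c', a, b, d, -, h1, h2, h3, h4, h5, h6, h⟩ := h
    exact (noReal a h1 (ne h4) (by rw [h, self]; ring)).elim
  | IIIr =>
    obtain ⟨c', a, b, -, h1, h2, h3, h⟩ := h
    exact (noReal a h1 (ne h3) (by rw [h, self]; ring)).elim
  | Nr =>
    obtain ⟨c', a, -, h1, h2, h⟩ := h
    exact (noReal a h1 h2 (by rw [h, self]; ring)).elim
  | Dr =>
    obtain ⟨c', a, b, -, h1, h2, h3, h⟩ := h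
    exact (noReal a h1 (ne h3) (by rw [h, self]; ring)).elim
  | O =>
    have hreal : SpinReal ((1, 0) : ℂ × ℂ) := by simp [SpinReal, spinConj]
    exact (noReal (1, 0) hreal (by simp) (h _ _)).elim

end quadratic

namespace LorentzMetric

variable {M : Type*} [TopologicalSpace M] [ChartedSpace E3 M] [IsManifold 𝓘(ℝ, E3) ∞ M]

/-! ### Petrov types and multiple principal null directions -/

section types

variable {g : LorentzMetric M} {p : M} {k l u k' n : TangentSpace 𝓘(ℝ, E3) p} {T : PetrovType}
  {σ lam : ℝ}

lemma ricciQuartic_coeffs (g : LorentzMetric M) {κ₀ κ₁ κ₂ κ₃ κ₄ : ℂ}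
    (h : ∀ s t : ℂ, g.ricciQuartic p k l u s t = κ₀ * s ^ 4 + κ₁ * s ^ 3 * t + κ₂ * s ^ 2 * t ^ 2
      + κ₃ * s * t ^ 3 + κ₄ * t ^ 4) :
    (g.phi p k k : ℂ) = 2 * κ₀ ∧ (g.phi p k (Real.sqrt 2 • u) : ℂ) = κ₁ ∧
      ((g.phi p (Real.sqrt 2 • u) (Real.sqrt 2 • u) : ℝ) - 2 * (g.phi p k l : ℝ) : ℂ) = 2 * κ₂ ∧
      (g.phi p (Real.sqrt 2 • u) l : ℂ) = - κ₃ ∧ (g.phi p l l : ℂ) = 2 * κ₄ := by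
  obtain ⟨h0, h1, h2, h3, h4⟩ := quartic_eq_zero (p₀ := (g.phi p k k : ℂ) / 2 - κ₀)
    (p₁ := (g.phi p k (Real.sqrt 2 • u) : ℂ) - κ₁)
    (p₂ := ((g.phi p (Real.sqrt 2 • u) (Real.sqrt 2 • u) : ℝ) - 2 * (g.phi p k l : ℝ) : ℂ) / 2 - κ₂)
    (p₃ := - (g.phi p (Real.sqrt 2 • u) l : ℂ) - κ₃) (p₄ := (g.phi p l l : ℂ) / 2 - κ₄)
    (fun s t => by
      have := h s t
      rw [ricciQuartic_eq] at this
      linear_combination this)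
  exact ⟨by linear_combination 2 * h0, by linear_combination h1, by linear_combination 2 * h2,
    by linear_combination -h3, by linear_combination 2 * h4⟩

lemma IsNullFrame.isMultiplePrincipal (h : g.IsNullFrame p k l u) (hkk : g.phi p k k = 0)
    (hku : g.phi p k u = 0) : g.IsMultiplePrincipal p k := by
  refine ⟨h.ne_zero, h.kk, g.phi p k l, fun w => ?_⟩
  rw [← phi_apply]
  conv_lhs => rw [h.expand w]
  simp [hkk, hku, g.symm p w k, mul_comm]

lemma IsMultiplePrincipal.phi_eq (hk : g.IsMultiplePrincipal p k) (h : g.IsNullFrame p k l u) :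
    g.phi p k k = 0 ∧ g.phi p k u = 0 := by
  obtain ⟨-, -, c, hc⟩ := hk
  simp only [phi_apply, hc, h.kk, h.ku, mul_zero, and_self]

lemma IsMultiplePrincipal.smul (hk : g.IsMultiplePrincipal p k) {c : ℝ} (hc : c ≠ 0) :
    g.IsMultiplePrincipal p (c • k) := by
  obtain ⟨h0, h1, d, hd⟩ := hk
  refine ⟨smul_ne_zero hc h0, by simp [h1], d, fun w => ?_⟩
  simp only [← phi_apply] at hd ⊢
  simp [hd]
  ring

lemma IsMultiplePrincipal.ricciQuartic_eq (hk : g.IsMultiplePrincipal p k)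
    (h : g.IsNullFrame p k l u) (s t : ℂ) : g.ricciQuartic p k l u s t
      = ((- 3 * g.phi p k l : ℝ) : ℂ) * s ^ 2 * t ^ 2
        + ((- (Real.sqrt 2 * g.phi p u l) : ℝ) : ℂ) * s * t ^ 3
        + ((g.phi p l l / 2 : ℝ) : ℂ) * t ^ 4 := by
  obtain ⟨h0, h1⟩ := hk.phi_eq h
  have hr2 : Real.sqrt 2 * Real.sqrt 2 = 2 := Real.mul_self_sqrt (by norm_num)
  rw [LorentzMetric.ricciQuartic_eq]
  simp only [map_smul, LinearMap.smul_apply, smul_eq_mul, h0, h1, h.phi_uu, ← mul_assoc, hr2]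
  push_cast
  ring

lemma IsMultiplePrincipal.exists_hasPetrovType (hk : g.IsMultiplePrincipal p k) :
    ∃ T ∈ ({.II, .IIr, .Dr, .IIIr, .Nr, .O} : Set PetrovType), g.HasPetrovType p T := by
  obtain ⟨l, u, h⟩ := exists_isNullFrame hk.2.1 hk.1
  obtain ⟨T, hT, hQ⟩ := exists_hasRootType (hk.ricciQuartic_eq h)
  exact ⟨T, hT, k, l, u, h, hQ⟩

/-- In a frame starting with `k` the quartic is t² times the quadratic with coefficients -3 Φ(k,l),
-√2 Φ(u,l), Φ(l,l)/2. Its discriminant is twice Φ(u,l)² + 3 Φ(k,l) Φ(l,l). -/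
lemma HasPetrovType.of_isMultiplePrincipal (hT : g.HasPetrovType p T)
    (hk : g.IsMultiplePrincipal p k) (h : g.IsNullFrame p k l u) :
    ((T = .II ∨ T = .IIr) ∧ g.phi p k l ≠ 0 ∧
        g.phi p u l ^ 2 + 3 * g.phi p k l * g.phi p l l ≠ 0) ∨
      (T = .Dr ∧ g.phi p k l ≠ 0) ∨
      (T = .IIIr ∧ g.phi p k l = 0 ∧ g.phi p u l ≠ 0) ∨
      (T = .Nr ∧ g.phi p k l = 0 ∧ g.phi p u l = 0 ∧ g.phi p l l ≠ 0) ∨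
      (T = .O ∧ g.phi p k l = 0 ∧ g.phi p u l = 0 ∧ g.phi p l l = 0) := by
  have hd := (hT.hasRootType h).doubleRootPattern (hk.ricciQuartic_eq h)
  have h2 : ((- 3 * g.phi p k l : ℝ) : ℂ) = 0 ↔ g.phi p k l = 0 := by
    rw [Complex.ofReal_eq_zero]; simp
  have h3 : ((- (Real.sqrt 2 * g.phi p u l) : ℝ) : ℂ) = 0 ↔ g.phi p u l = 0 := by
    rw [Complex.ofReal_eq_zero]; simp
  have h4 : ((g.phi p l l / 2 : ℝ) : ℂ) = 0 ↔ g.phi p l l = 0 := by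
    rw [Complex.ofReal_eq_zero]; simp
  have h5 : ((- (Real.sqrt 2 * g.phi p u l) : ℝ) : ℂ) ^ 2 - 4 * ((- 3 * g.phi p k l : ℝ) : ℂ)
      * ((g.phi p l l / 2 : ℝ) : ℂ) = 0 ↔
      g.phi p u l ^ 2 + 3 * g.phi p k l * g.phi p l l = 0 := by
    have : (Real.sqrt 2) ^ 2 = 2 := Real.sq_sqrt (by norm_num)
    have e : ((- (Real.sqrt 2 * g.phi p u l) : ℝ) : ℂ) ^ 2 - 4 * ((- 3 * g.phi p k l : ℝ) : ℂ)
      * ((g.phi p l l / 2 : ℝ) : ℂ)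
        = ((2 * (g.phi p u l ^ 2 + 3 * g.phi p k l * g.phi p l l) : ℝ) : ℂ) := by
      rw [← Complex.ofReal_pow, neg_sq, mul_pow, this]
      push_cast
      ring
    rw [e, Complex.ofReal_eq_zero]
    simp
  cases T <;> simp only [DoubleRootPattern, ne_eq, h2, h3, h4, h5] at hd <;> simp [hd]

/-- Two multiple principal null directions exist only for the types `Dr` and `O`. -/
lemma HasPetrovType.of_two (hT : g.HasPetrovType p T) (hk : g.IsMultiplePrincipal p k)
    (hk' : g.IsMultiplePrincipal p k') (hne : Submodule.span ℝ {k} ≠ Submodule.span ℝ {k'}) :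
    T = .Dr ∨ T = .O := by
  obtain ⟨c, u, hc, h⟩ := exists_isNullFrame_of_span_ne hk.2.1 hk.1 hk'.2.1 hk'.1 hne
  obtain ⟨-, -, d, hd⟩ := hk'.smul hc
  have h1 : g.phi p (c • k') (c • k') = 0 := by rw [phi_apply, hd, h.ll, mul_zero]
  have h2 : g.phi p u (c • k') = 0 := by rw [phi_symm, phi_apply, hd, h.lu, mul_zero]
  rcases hT.of_isMultiplePrincipal hk h with ⟨-, -, h3⟩ | ⟨h3, -⟩ | ⟨-, -, h3⟩ | ⟨-, -, -, h3⟩ |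
    ⟨h3, -⟩
  · rw [h1, h2] at h3; simp at h3
  · exact Or.inl h3
  · exact (h3 h2).elim
  · exact (h3 h1).elim
  · exact Or.inr h3

lemma HasPetrovType.eq_O (hT : g.HasPetrovType p T) (h0 : ∀ v w, g.phi p v w = 0) : T = .O := by
  obtain ⟨k, l, u, h, -⟩ := id hT
  have hk := h.isMultiplePrincipal (h0 _ _) (h0 _ _)
  rcases hT.of_isMultiplePrincipal hk h with ⟨-, h3, -⟩ | ⟨-, h3⟩ | ⟨-, -, h3⟩ | ⟨-, -, -, h3⟩ |
    ⟨h3, -⟩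
  · exact (h3 (h0 _ _)).elim
  · exact (h3 (h0 _ _)).elim
  · exact (h3 (h0 _ _)).elim
  · exact (h3 (h0 _ _)).elim
  · exact h3

/-- The five patterns share a repeated real factor. Once its root is moved to (1:0), the
coefficients of s⁴ and s³t vanish, that is, Φ(k,k) = Φ(k,u) = 0. -/
lemma HasPetrovType.exists_isMultiplePrincipal (hT : g.HasPetrovType p T)
    (h5 : T ∈ ({.II, .IIr, .Dr, .IIIr, .Nr} : Set PetrovType)) :
    ∃ k, g.IsMultiplePrincipal p k := by
  obtain ⟨k, l, u, h, hQ⟩ := hT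
  obtain ⟨c, a, b, d, ha, ha0, hQ⟩ : ∃ (c : ℂ) (a b d : ℂ × ℂ), SpinReal a ∧ a ≠ 0 ∧
      ∀ s t, g.ricciQuartic p k l u s t
        = c * (spinPair a s t * spinPair a s t * spinPair b s t * spinPair d s t) := by
    have ne : ∀ {a b : ℂ × ℂ}, SpinIndep a b → a ≠ 0 := by
      rintro a b h rfl; simp [SpinIndep] at h
    rcases h5 with rfl | rfl | rfl | rfl | rfl
    · obtain ⟨c, a, d, -, h1, h2, -, h⟩ := hQ
      exact ⟨c, a, d, spinConj d, h1, h2, fun s t => by rw [h]; ring⟩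
    · obtain ⟨c, a, b, d, -, h1, -, -, h4, -, -, h⟩ := hQ
      exact ⟨c, a, b, d, h1, ne h4, fun s t => by rw [h]; ring⟩
    · obtain ⟨c, a, b, -, h1, -, h3, h⟩ := hQ
      exact ⟨c, a, b, b, h1, ne h3, fun s t => by rw [h]; ring⟩
    · obtain ⟨c, a, b, -, h1, -, h3, h⟩ := hQ
      exact ⟨c, a, a, b, h1, ne h3, fun s t => by rw [h]; ring⟩
    · obtain ⟨c, a, -, h1, h2, h⟩ := hQ
      exact ⟨c, a, a, a, h1, h2, fun s t => by rw [h]; ring⟩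
  obtain ⟨a₁, a₂, rfl⟩ := ha.exists_real
  have hst : a₁ ^ 2 + a₂ ^ 2 ≠ 0 := by
    intro h0
    have h1 : a₁ = 0 := by nlinarith [sq_nonneg a₁, sq_nonneg a₂]
    have h2 : a₂ = 0 := by nlinarith [sq_nonneg a₁, sq_nonneg a₂]
    exact ha0 (by simp [h1, h2])
  -- The first column is the root of the repeated factor. The second has determinant 1 with it and
  -- makes the factor equal to t.
  obtain ⟨u', h', hQ'⟩ := h.rotate (s₀ := a₂) (t₀ := -a₁) (s₁ := a₁ / (a₁ ^ 2 + a₂ ^ 2))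
    (t₁ := a₂ / (a₁ ^ 2 + a₂ ^ 2)) (by field_simp; ring)
  have key : ∀ s t : ℂ, spinPair ((a₁ : ℂ), (a₂ : ℂ)) ((a₂ : ℝ) * s + (a₁ / (a₁ ^ 2 + a₂ ^ 2) : ℝ) * t)
      ((-a₁ : ℝ) * s + (a₂ / (a₁ ^ 2 + a₂ ^ 2) : ℝ) * t) = t := by
    intro s t
    have hst' : (a₁ ^ 2 + a₂ ^ 2 : ℂ) ≠ 0 := by exact_mod_cast hst
    simp only [spinPair]
    push_cast
    field_simp
    ring
  obtain ⟨b', hb'⟩ : ∃ b', b' =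
    spinMap a₂ (a₁ / (a₁ ^ 2 + a₂ ^ 2)) (-a₁) (a₂ / (a₁ ^ 2 + a₂ ^ 2)) b := ⟨_, rfl⟩
  obtain ⟨d', hd'⟩ : ∃ d', d' =
    spinMap a₂ (a₁ / (a₁ ^ 2 + a₂ ^ 2)) (-a₁) (a₂ / (a₁ ^ 2 + a₂ ^ 2)) d := ⟨_, rfl⟩
  have hco := g.ricciQuartic_coeffs (κ₀ := 0) (κ₁ := 0) (κ₂ := c * (b'.1 * d'.1))
    (κ₃ := c * (b'.1 * d'.2 + b'.2 * d'.1)) (κ₄ := c * (b'.2 * d'.2)) (fun s t => by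
      rw [hQ' s t, hQ, key, ← spinPair_spinMap, ← spinPair_spinMap, ← hb', ← hd']
      simp only [spinPair]
      ring)
  refine ⟨_, h'.isMultiplePrincipal ?_ ?_⟩
  · simpa using hco.1
  · simpa using hco.2.1

end types

/-- `Φ = lam (g - 3 σ n ⊗ n)` for a vector `n` with `g (n, n) = σ`. -/
structure IsDoubleEigen (g : LorentzMetric M) (p : M) (σ lam : ℝ)
    (n : TangentSpace 𝓘(ℝ, E3) p) : Prop where
  nn : g.val p n n = σ
  phi : ∀ v w, g.phi p v w = lam * (g.val p v w - 3 * σ * g.val p n v * g.val p n w)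

/-! ### The types D and D_r as double eigenvalues of Φ -/

section types

variable {g : LorentzMetric M} {p : M} {k l u k' n : TangentSpace 𝓘(ℝ, E3) p} {T : PetrovType}
  {σ lam : ℝ}

lemma IsDoubleEigen.smul (h : g.IsDoubleEigen p σ lam n) {r : ℝ} (hr : r ^ 2 = 1) :
    g.IsDoubleEigen p σ lam (r • n) := by
  refine ⟨?_, fun v w => ?_⟩
  · simp only [map_smul, _root_.smul_apply, smul_eq_mul, h.nn]
    linear_combination σ * hr
  · simp only [map_smul, _root_.smul_apply, smul_eq_mul, h.phi]
    linear_combination (3 * lam * σ * g.val p n v * g.val p n w) * hr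

/-- A real quadratic form in (s,t) is g(v, ξ) for a unique real vector v. If the quartic is c g(v,
ξ)², then Φ is 2c times the tracefree part of v ⊗ v, and the sign of the discriminant is that of
g(v,v). -/
lemma HasPetrovType.exists_isDoubleEigen (hT : g.HasPetrovType p T)
    (hσ : T = .D ∧ σ = -1 ∨ T = .Dr ∧ σ = 1) :
    ∃ n lam, lam ≠ 0 ∧ g.IsDoubleEigen p σ lam n := by
  obtain ⟨k, l, u, h, hQ⟩ := hT
  obtain ⟨c, α, β, δ, hc, hσd, hQ⟩ := hQ.exists_quadratic hσ
  have hσ2 : σ ^ 2 = 1 := by rcases hσ with ⟨-, rfl⟩ | ⟨-, rfl⟩ <;> norm_num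
  obtain ⟨e0, e1, e2, e3, e4⟩ := g.ricciQuartic_coeffs (κ₀ := c * α ^ 2) (κ₁ := 4 * c * α * β)
    (κ₂ := c * (2 * α * δ + 4 * β ^ 2)) (κ₃ := 4 * c * β * δ) (κ₄ := c * δ ^ 2)
    (fun s t => by rw [hQ]; ring)
  have hr : Real.sqrt 2 ≠ 0 := by positivity
  have hr2 : Real.sqrt 2 ^ 2 = 2 := Real.sq_sqrt (by norm_num)
  have hr2' : Real.sqrt 2 * Real.sqrt 2 = 2 := Real.mul_self_sqrt (by norm_num)
  have huu := h.phi_uu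
  have f0 : g.phi p k k = 2 * (c * α ^ 2) := by exact_mod_cast e0
  have f1 : g.phi p k (Real.sqrt 2 • u) = 4 * c * α * β := by exact_mod_cast e1
  have f2 : g.phi p (Real.sqrt 2 • u) (Real.sqrt 2 • u) - 2 * g.phi p k l
      = 2 * (c * (2 * α * δ + 4 * β ^ 2)) := by exact_mod_cast e2
  have f3 : g.phi p (Real.sqrt 2 • u) l = - (4 * c * β * δ) := by exact_mod_cast e3
  have f4 : g.phi p l l = 2 * (c * δ ^ 2) := by exact_mod_cast e4
  simp only [map_smul, LinearMap.smul_apply, smul_eq_mul, ← mul_assoc, hr2'] at f1 f2 f3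
  -- Chosen so that g(v, ξ) = α s² + 2 β s t + δ t² for ξ = s² k + √2 s t u - t² l.
  obtain ⟨v, hv⟩ : ∃ v, v = α • l + (Real.sqrt 2 * β) • u - δ • k := ⟨_, rfl⟩
  have vk : g.val p v k = α := by simp [hv, g.symm p l k, g.symm p u k, h.kk, h.kl, h.ku]
  have vl : g.val p v l = - δ := by simp [hv, g.symm p u l, h.ll, h.kl, h.lu]
  have vu : g.val p v u = Real.sqrt 2 * β := by simp [hv, h.ku, h.lu, h.uu]
  have vv : g.val p v v = 2 * (β ^ 2 - α * δ) := by
    conv_lhs => rw [show g.val p v v = g.val p v (α • l + (Real.sqrt 2 * β) • u - δ • k) by rw [← hv]]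
    simp only [map_sub, map_add, map_smul, smul_eq_mul, vk, vl, vu]
    linear_combination β ^ 2 * hr2
  have main : ∀ x y, g.phi p x y = 2 * c * (g.val p v x * g.val p v y
      - 1 / 3 * g.val p v v * g.val p x y) := by
    refine h.bilin_ext (B' := LinearMap.mk₂ ℝ (fun x y => 2 * c * (g.val p v x * g.val p v y
      - 1 / 3 * g.val p v v * g.val p x y)) (fun _ _ _ => by simp; ring) (fun _ _ _ => by simp; ring)
      (fun _ _ _ => by simp; ring) (fun _ _ _ => by simp; ring)) g.phi_symm
      (fun x y => by simp only [LinearMap.mk₂_apply]; rw [g.symm p x y]; ring) ?_ ?_ ?_ ?_ ?_ ?_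
    all_goals simp only [LinearMap.mk₂_apply, vk, vl, vu, vv, h.kk, h.ku, h.kl, h.uu, h.ll,
      g.symm p u l, h.lu]
    · linear_combination f0
    · apply mul_left_cancel₀ hr
      linear_combination f1 - 2 * c * α * β * hr2
    · linear_combination (-1 / 6 : ℝ) * f2 + (1 / 3 : ℝ) * huu
    · linear_combination (1 / 3 : ℝ) * f2 + (1 / 3 : ℝ) * huu - 2 * c * β ^ 2 * hr2
    · apply mul_left_cancel₀ hr
      linear_combination f3 + 2 * c * β * δ * hr2
    · linear_combination f4
  have hpos : 0 < σ * g.val p v v := by rw [vv]; linarith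
  obtain ⟨r, hr0, hrr⟩ : ∃ r : ℝ, 0 < r ∧ r ^ 2 = σ * g.val p v v :=
    ⟨Real.sqrt (σ * g.val p v v), Real.sqrt_pos.2 hpos, Real.sq_sqrt hpos.le⟩
  have hvv : g.val p v v = σ * r ^ 2 := by rw [hrr]; linear_combination (- g.val p v v) * hσ2
  have hrn : r ≠ 0 := hr0.ne'
  have hσ0 : σ ≠ 0 := by rintro rfl; norm_num at hσ2
  refine ⟨r⁻¹ • v, - (2 / 3) * c * σ * r ^ 2, by positivity, ?_, fun x y => ?_⟩
  · simp only [map_smul, _root_.smul_apply, smul_eq_mul, hvv]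
    field_simp
  · rw [main, hvv]
    simp only [map_smul, _root_.smul_apply, smul_eq_mul]
    field_simp
    linear_combination (-3 * g.val p v x * g.val p v y) * hσ2

/-- In a null frame with `n` in the plane of `k` and `l` the quartic is 3/2 lam (s² + t²/2)². -/
lemma IsDoubleEigen.exists_ricciQuartic (h : g.IsDoubleEigen p (-1) lam n) :
    ∃ k l u, g.IsNullFrame p k l u ∧ ∃ x, SpinIndep x (spinConj x) ∧
      ∀ s t, g.ricciQuartic p k l u s t
        = (3 / 2 * lam : ℝ) * (spinPair x s t ^ 2 * spinPair (spinConj x) s t ^ 2) := by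
  obtain ⟨y, z, β, γ, hb⟩ := exists_isOrthoTriple_of_unit (by norm_num) h.nn
  have hβγ : β = 1 ∧ γ = 1 := by
    rcases hb.signs with h | h | h
    · have := congrFun h 0; norm_num at this
    · have := congrFun h 0; norm_num at this
    · exact ⟨by simpa using congrFun h 1, by simpa using congrFun h 2⟩
  obtain ⟨rfl, rfl⟩ := hβγ
  have b00 := hb.2 0 0
  have b01 := hb.2 0 1
  have b02 := hb.2 0 2
  have b11 := hb.2 1 1
  have b12 := hb.2 1 2
  have b22 := hb.2 2 2
  simp at b00 b01 b02 b11 b12 b22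
  have hf : g.IsNullFrame p (y + n) ((1 / 2 : ℝ) • (y - n)) z := by
    constructor <;> simp [b00, b01, b02, b11, b12, b22, g.symm p y n] <;> norm_num
  have hr2 : (Real.sqrt 2 : ℂ) ^ 2 = 2 := by
    rw [← Complex.ofReal_pow, Real.sq_sqrt (by norm_num)]; norm_num
  have hr : (Real.sqrt 2 : ℂ) ≠ 0 := by
    intro h0; rw [h0] at hr2; norm_num at hr2
  refine ⟨_, _, _, hf, (1, Complex.I / Real.sqrt 2), ?_, fun s t => ?_⟩
  · simp only [SpinIndep, spinConj, map_one, map_div₀, Complex.conj_I, Complex.conj_ofReal]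
    rw [one_mul, mul_one, ← sub_div]
    exact div_ne_zero (by rw [← neg_add', neg_ne_zero, ← two_mul]; simp) hr
  · rw [ricciQuartic_eq]
    simp only [h.phi]
    simp only [map_add, map_sub, map_smul, _root_.add_apply, _root_.sub_apply,
      _root_.smul_apply, smul_eq_mul, b00, b01, b02, b11, b12, b22, g.symm p y n, g.symm p z, spinPair,
      spinConj, map_one, map_div₀, Complex.conj_I, Complex.conj_ofReal]
    rw [← mul_pow]
    have : (1 * s + Complex.I / (Real.sqrt 2 : ℂ) * t) * (1 * s + -Complex.I / (Real.sqrt 2 : ℂ) * t)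
        = s ^ 2 + t ^ 2 / 2 := by
      field_simp
      rw [hr2]
      linear_combination (- 2 * t ^ 2) * Complex.I_sq + s ^ 2 * 2 * hr2
    rw [this]
    have hr2' : Real.sqrt 2 * (Real.sqrt 2 * (1 : ℝ)) = 2 := by
      rw [mul_one]; exact Real.mul_self_sqrt (by norm_num)
    simp only [hr2']
    push_cast
    ring

lemma IsDoubleEigen.exists_hasPetrovType (h : g.IsDoubleEigen p (-1) lam n) :
    ∃ T ∈ ({.D, .O} : Set PetrovType), g.HasPetrovType p T := by
  obtain ⟨k, l, u, hf, x, hx, hQ⟩ := h.exists_ricciQuartic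
  by_cases h0 : lam = 0
  · exact ⟨.O, by simp, k, l, u, hf, fun s t => by rw [hQ, h0]; simp⟩
  · exact ⟨.D, by simp, k, l, u, hf, _, x, by simpa using h0, hx, hQ⟩

lemma HasPetrovType.of_isDoubleEigen (hT : g.HasPetrovType p T)
    (h : g.IsDoubleEigen p (-1) lam n) : T = .D ∨ T = .O := by
  by_cases h0 : lam = 0
  · exact Or.inr (hT.eq_O fun v w => by rw [h.phi, h0, zero_mul])
  · obtain ⟨k, l, u, hf, x, hx, hQ⟩ := h.exists_ricciQuartic
    exact Or.inl ((hT.hasRootType hf).eq_D (by simpa using h0) hx hQ)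

/-- Here Φ(k, ·) = lam (g(k, ·) - 3 g(n,k) g(n, ·)). If g(n,k) ≠ 0, proportionality to g(k, ·) would
make the unit vector `n` a multiple of the null vector `k`. -/
lemma IsDoubleEigen.isMultiplePrincipal_iff (h : g.IsDoubleEigen p 1 lam n) (hl : lam ≠ 0)
    (hk : g.val p k k = 0) (hk0 : k ≠ 0) : g.IsMultiplePrincipal p k ↔ g.val p n k = 0 := by
  constructor
  · rintro ⟨-, -, c, hc⟩
    simp only [← phi_apply, h.phi] at hc
    by_contra hnk
    have h1 := hc n
    rw [h.nn, g.symm p k n] at h1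
    have hc2 : c = - 2 * lam := mul_right_cancel₀ hnk (by linear_combination -h1)
    have h2 : ∀ w, g.val p k w = g.val p n k * g.val p n w := fun w =>
      mul_left_cancel₀ (mul_ne_zero three_ne_zero hl) (by
        have := hc w; rw [hc2] at this; linear_combination this)
    have h3 := h2 k
    rw [hk] at h3
    exact hnk (by simpa using h3)
  · intro hnk
    refine ⟨hk0, hk, lam, fun w => ?_⟩
    rw [← phi_apply, h.phi, hnk]
    ring

end types

/-! ### Φ as an endomorphism and its invariants -/

/-- The tracefree Ricci tensor as an endomorphism of the tangent space. -/
noncomputable def phiOp (g : LorentzMetric M) (p : M) :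
    TangentSpace 𝓘(ℝ, E3) p →ₗ[ℝ] TangentSpace 𝓘(ℝ, E3) p :=
  (g.sharp p).toLinearMap ∘ₗ g.phi p

/-- The eigenvalue `lam` of `Φ` if its eigenvalues are `lam, lam, - 2 lam`. -/
noncomputable def phiEigenvalue (g : LorentzMetric M) (p : M) : ℝ :=
  - LinearMap.trace ℝ _ (g.phiOp p ∘ₗ g.phiOp p ∘ₗ g.phiOp p)
    / LinearMap.trace ℝ _ (g.phiOp p ∘ₗ g.phiOp p)

section pointwise

variable {g : LorentzMetric M} {p : M} {k l u v w n : TangentSpace 𝓘(ℝ, E3) p} {T : PetrovType}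
  {σ lam : ℝ}

lemma val_phiOp (g : LorentzMetric M) (v w : TangentSpace 𝓘(ℝ, E3) p) :
    g.val p (g.phiOp p v) w = g.phi p v w := g.val_sharp p _ _

lemma ext_val (g : LorentzMetric M) (h : ∀ x, g.val p v x = g.val p w x) : v = w := by
  rw [← sub_eq_zero]
  exact g.nondegenerate p _ fun x => by rw [map_sub, _root_.sub_apply, h, sub_self]

lemma IsNullFrame.trace (h : g.IsNullFrame p k l u)
    (L : TangentSpace 𝓘(ℝ, E3) p →ₗ[ℝ] TangentSpace 𝓘(ℝ, E3) p) :
    LinearMap.trace ℝ _ L = g.val p (L k) l + g.val p (L l) k + g.val p (L u) u := by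
  rw [h.isOrthoTriple.trace]
  simp [Fin.sum_univ_three]
  ring

lemma IsMultiplePrincipal.phiOp_eq (hk : g.IsMultiplePrincipal p k)
    (h : g.IsNullFrame p k l u) : g.phiOp p k = g.phi p k l • k ∧
    g.phiOp p u = g.phi p u l • k - (2 * g.phi p k l) • u ∧
    g.phiOp p l = g.phi p l l • k + g.phi p k l • l + g.phi p u l • u := by
  obtain ⟨h0, h1⟩ := hk.phi_eq h
  have h2 := h.phi_uu
  refine ⟨?_, ?_, ?_⟩
  · rw [h.expand (g.phiOp p k)]
    simp [val_phiOp, h0, h1]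
  · rw [h.expand (g.phiOp p u)]
    simp only [val_phiOp, h2, g.phi_symm u k, h1]
    module
  · rw [h.expand (g.phiOp p l)]
    simp only [val_phiOp, g.phi_symm l k, g.phi_symm l u]

/-- By `phiOp_eq` the endomorphism is triangular in the basis k, u, l, with diagonal C, -2C, C for C
= Φ(k,l). -/
lemma IsMultiplePrincipal.trace_sq (hk : g.IsMultiplePrincipal p k)
    (h : g.IsNullFrame p k l u) :
    LinearMap.trace ℝ _ (g.phiOp p ∘ₗ g.phiOp p) = 6 * g.phi p k l ^ 2 := by
  obtain ⟨h0, h1, h2⟩ := hk.phiOp_eq h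
  rw [h.trace]
  simp [h0, h1, h2, h.kk, h.ku, h.kl, h.uu, g.symm p l k, g.symm p u k]
  ring

lemma IsMultiplePrincipal.trace_cube (hk : g.IsMultiplePrincipal p k)
    (h : g.IsNullFrame p k l u) :
    LinearMap.trace ℝ _ (g.phiOp p ∘ₗ g.phiOp p ∘ₗ g.phiOp p) = - 6 * g.phi p k l ^ 3 := by
  obtain ⟨h0, h1, h2⟩ := hk.phiOp_eq h
  rw [h.trace]
  simp [h0, h1, h2, h.kk, h.ku, h.kl, h.uu, g.symm p l k, g.symm p u k]
  ring

lemma IsMultiplePrincipal.phiEigenvalue (hk : g.IsMultiplePrincipal p k)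
    (h : g.IsNullFrame p k l u) : g.phiEigenvalue p = g.phi p k l := by
  rw [LorentzMetric.phiEigenvalue, hk.trace_sq h, hk.trace_cube h]
  -- For C = 0 the quotient 0/0 has the value 0, which is again C.
  by_cases h0 : g.phi p k l = 0
  · simp [h0]
  · field_simp

/-- The operator (Φ - C)(Φ + 2C) would vanish if Φ were diagonalisable. It kills `k` and `u` and
maps `l` to a multiple of `k`; this recovers the direction of `k` from Φ. -/
lemma IsMultiplePrincipal.phiOp_quadratic (hk : g.IsMultiplePrincipal p k)
    (h : g.IsNullFrame p k l u) (v : TangentSpace 𝓘(ℝ, E3) p) :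
    g.phiOp p (g.phiOp p v) + g.phi p k l • g.phiOp p v - (2 * g.phi p k l ^ 2) • v
      = ((g.phi p u l ^ 2 + 3 * g.phi p k l * g.phi p l l) * g.val p k v) • k := by
  obtain ⟨h0, h1, h2⟩ := hk.phiOp_eq h
  rw [g.symm p k v]
  conv_lhs => rw [h.expand v]
  simp only [map_add, map_sub, map_smul, h0, h1, h2]
  module

lemma HasPetrovType.phiOp_quadratic (hT : g.HasPetrovType p T) (hk : g.IsMultiplePrincipal p k)
    (h3 : T = .II ∨ T = .IIr ∨ T = .IIIr) : ∃ d ≠ 0, ∀ v,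
      g.phiOp p (g.phiOp p v) + g.phiEigenvalue p • g.phiOp p v - (2 * g.phiEigenvalue p ^ 2) • v
        = (d * g.val p k v) • k := by
  obtain ⟨l, u, h⟩ := exists_isNullFrame hk.2.1 hk.1
  refine ⟨g.phi p u l ^ 2 + 3 * g.phi p k l * g.phi p l l, ?_, fun v => ?_⟩
  · rcases hT.of_isMultiplePrincipal hk h with ⟨-, -, h'⟩ | ⟨h', -⟩ | ⟨-, h', h''⟩ | ⟨h', -⟩ |
      ⟨h', -⟩
    · exact h'
    · simp [h'] at h3
    · simpa [h'] using h''
    · simp [h'] at h3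
    · simp [h'] at h3
  · rw [hk.phiEigenvalue h]
    exact hk.phiOp_quadratic h v

lemma HasPetrovType.phiOp_linear (hT : g.HasPetrovType p .Nr) (hk : g.IsMultiplePrincipal p k) :
    ∃ d ≠ 0, ∀ v, g.phiOp p v = (d * g.val p k v) • k := by
  obtain ⟨l, u, h⟩ := exists_isNullFrame hk.2.1 hk.1
  obtain ⟨h0, h1, h2⟩ := hk.phiOp_eq h
  rcases hT.of_isMultiplePrincipal hk h with ⟨h', -⟩ | ⟨h', -⟩ | ⟨h', -⟩ | ⟨-, hC, ht, hW⟩ | ⟨h', -⟩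
  · simp at h'
  · simp at h'
  · simp at h'
  · refine ⟨_, hW, fun v => ?_⟩
    rw [g.symm p k v]
    conv_lhs => rw [h.expand v]
    simp only [map_add, map_smul, h0, h1, h2, hC, ht]
    module
  · simp at h'

lemma HasPetrovType.phiEigenvalue_eq_zero (hT : g.HasPetrovType p .IIIr)
    (hk : g.IsMultiplePrincipal p k) : g.phiEigenvalue p = 0 := by
  obtain ⟨l, u, h⟩ := exists_isNullFrame hk.2.1 hk.1
  rw [hk.phiEigenvalue h]
  rcases hT.of_isMultiplePrincipal hk h with ⟨h', -⟩ | ⟨h', -⟩ | ⟨-, h', -⟩ | ⟨-, h', -⟩ | ⟨-, h', -⟩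
  · simp at h'
  · simp at h'
  all_goals exact h'

lemma HasPetrovType.trace_sq_ne_zero (hT : g.HasPetrovType p T)
    (hk : g.IsMultiplePrincipal p k) (h2 : T = .II ∨ T = .IIr) :
    LinearMap.trace ℝ _ (g.phiOp p ∘ₗ g.phiOp p) ≠ 0 := by
  obtain ⟨l, u, h⟩ := exists_isNullFrame hk.2.1 hk.1
  rw [hk.trace_sq h]
  have : g.phi p k l ≠ 0 := by
    rcases hT.of_isMultiplePrincipal hk h with ⟨-, h', -⟩ | ⟨-, h'⟩ | ⟨h', -⟩ | ⟨h', -⟩ | ⟨h', -⟩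
    · exact h'
    · exact h'
    all_goals simp [h'] at h2
  positivity

lemma IsDoubleEigen.phiOp_eq (h : g.IsDoubleEigen p σ lam n) (v : TangentSpace 𝓘(ℝ, E3) p) :
    g.phiOp p v = lam • v - (3 * σ * lam * g.val p n v) • n := g.ext_val fun x => by
  rw [val_phiOp, h.phi]
  simp
  ring

lemma IsDoubleEigen.trace (h : g.IsDoubleEigen p σ lam n) (hσ : σ ^ 2 = 1) :
    LinearMap.trace ℝ _ (g.phiOp p ∘ₗ g.phiOp p) = 6 * lam ^ 2 ∧
      LinearMap.trace ℝ _ (g.phiOp p ∘ₗ g.phiOp p ∘ₗ g.phiOp p) = - 6 * lam ^ 3 := by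
  obtain ⟨y, z, β, γ, hb⟩ := exists_isOrthoTriple_of_unit hσ h.nn
  have hβ : β ^ 2 = 1 := hb.1 1
  have hγ : γ ^ 2 = 1 := hb.1 2
  have b01 := hb.2 0 1
  have b02 := hb.2 0 2
  have b11 := hb.2 1 1
  have b22 := hb.2 2 2
  simp at b01 b02 b11 b22
  have hn : g.phiOp p n = (- 2 * lam) • n := by
    rw [h.phiOp_eq, h.nn, show 3 * σ * lam * σ = 3 * lam by linear_combination 3 * lam * hσ]
    module
  have hy : g.phiOp p y = lam • y := by simp [h.phiOp_eq, b01]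
  have hz : g.phiOp p z = lam • z := by simp [h.phiOp_eq, b02]
  rw [hb.trace, hb.trace]
  simp only [Fin.sum_univ_three, Matrix.cons_val_zero, Matrix.cons_val_one, Matrix.cons_val,
    LinearMap.comp_apply, hn, hy, hz, map_smul, _root_.smul_apply, smul_eq_mul, h.nn, b11, b22]
  constructor
  · linear_combination 4 * lam ^ 2 * hσ + lam ^ 2 * hβ + lam ^ 2 * hγ
  · linear_combination -8 * lam ^ 3 * hσ + lam ^ 3 * hβ + lam ^ 3 * hγ

lemma IsDoubleEigen.phiEigenvalue (h : g.IsDoubleEigen p σ lam n) (hσ : σ ^ 2 = 1) :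
    g.phiEigenvalue p = lam := by
  rw [LorentzMetric.phiEigenvalue, (h.trace hσ).1, (h.trace hσ).2]
  by_cases h0 : lam = 0
  · simp [h0]
  · field_simp

end pointwise

/-! ### Smoothness of the principal directions -/

section smooth

variable {g : LorentzMetric M} {V : Set M} {ε : Fin 3 → ℝ}
  {e : Fin 3 → ∀ p : M, TangentSpace 𝓘(ℝ, E3) p} {X Y k n : ∀ p : M, TangentSpace 𝓘(ℝ, E3) p}
  {p q : M} {T : PetrovType} {σ : ℝ} {lam : M → ℝ}

lemma IsOrthoFrame.smoothFieldOn_phiOp (he : g.IsOrthoFrame V ε e) (hX : SmoothFieldOn ∞ X V) :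
    SmoothFieldOn ∞ (fun q => g.phiOp q (X q)) V :=
  he.smoothFieldOn fun i => by
    simp only [val_phiOp]
    exact he.smoothFnOn_phi hX (he.smooth i)

lemma IsOrthoFrame.smoothFnOn_trace_sq (he : g.IsOrthoFrame V ε e) :
    SmoothFnOn (fun q => LinearMap.trace ℝ _ (g.phiOp q ∘ₗ g.phiOp q)) V := by
  have h : ∀ i, SmoothFnOn (fun q => ε i * g.phi q (g.phiOp q (e i q)) (e i q)) V := fun i =>
    contMDiffOn_const.mul (he.smoothFnOn_phi (he.smoothFieldOn_phiOp (he.smooth i)) (he.smooth i))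
  refine (((h 0).add (h 1)).add (h 2)).congr fun q hq => ?_
  rw [(he.ortho q hq).trace, Fin.sum_univ_three]
  simp only [LinearMap.comp_apply, val_phiOp]
  rfl

lemma IsOrthoFrame.smoothFnOn_trace_cube (he : g.IsOrthoFrame V ε e) :
    SmoothFnOn (fun q => LinearMap.trace ℝ _ (g.phiOp q ∘ₗ g.phiOp q ∘ₗ g.phiOp q)) V := by
  have h : ∀ i, SmoothFnOn
      (fun q => ε i * g.phi q (g.phiOp q (g.phiOp q (e i q))) (e i q)) V := fun i =>
    contMDiffOn_const.mul (he.smoothFnOn_phi (he.smoothFieldOn_phiOp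
      (he.smoothFieldOn_phiOp (he.smooth i))) (he.smooth i))
  refine (((h 0).add (h 1)).add (h 2)).congr fun q hq => ?_
  rw [(he.ortho q hq).trace, Fin.sum_univ_three]
  simp only [LinearMap.comp_apply, val_phiOp]
  rfl

lemma IsOrthoFrame.smoothFnOn_phiEigenvalue (he : g.IsOrthoFrame V ε e)
    (h : ∀ q ∈ V, LinearMap.trace ℝ _ (g.phiOp q ∘ₗ g.phiOp q) ≠ 0) :
    SmoothFnOn g.phiEigenvalue V :=
  he.smoothFnOn_trace_cube.neg.div₀ he.smoothFnOn_trace_sq h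

/-- A smooth field that is proportional to `k` and does not vanish at `p` spans the same lines as
`k` near `p`. -/
lemma exists_smooth_of_proportional (hV : IsOpen V) (hp : p ∈ V) (hY : SmoothFieldOn ∞ Y V)
    (hYk : ∀ q ∈ V, ∃ d : ℝ, Y q = d • k q) (hYp : Y p ≠ 0) (g : LorentzMetric M) :
    ∃ W ⊆ V, IsOpen W ∧ p ∈ W ∧ SmoothFieldOn ∞ Y W ∧ ∀ q ∈ W, ∃ d : ℝ, d ≠ 0 ∧ Y q = d • k q := by
  obtain ⟨w, hw⟩ : ∃ w, g.val p (Y p) w ≠ 0 := by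
    by_contra! h; exact hYp (g.nondegenerate p (Y p) h)
  obtain ⟨W, hW, hpW, hZ⟩ := exists_smoothFieldOn_extend p w
  have hs := smoothFnOn_val g (hY.mono (Set.inter_subset_left (t := W))) (hZ.mono (Set.inter_subset_right (s := V)))
  have hO := hs.continuousOn.isOpen_inter_preimage (hV.inter hW) isOpen_compl_singleton (t := {0}ᶜ)
  refine ⟨_, fun q hq => hq.1.1, hO, ⟨⟨hp, hpW⟩, ?_⟩, hY.mono fun q hq => hq.1.1, fun q hq => ?_⟩
  · simpa [extend_apply_self] using hw
  · obtain ⟨d, hd⟩ := hYk q hq.1.1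
    refine ⟨d, ?_, hd⟩
    rintro rfl
    have := hq.2
    simp [hd] at this

/-- For the types `II`, `IIr`, `IIIr` and `Nr` the multiple principal null direction is smooth. -/
lemma exists_smooth_multiplePrincipal (hV : IsOpen V) (hp : p ∈ V)
    (hT : ∀ q ∈ V, g.HasPetrovType q T) (hk : ∀ q ∈ V, g.IsMultiplePrincipal q (k q))
    (h4 : T = .II ∨ T = .IIr ∨ T = .IIIr ∨ T = .Nr) :
    ∃ W ⊆ V, IsOpen W ∧ p ∈ W ∧ ∃ Y, SmoothFieldOn ∞ Y W ∧
      ∀ q ∈ W, ∃ d : ℝ, d ≠ 0 ∧ Y q = d • k q := by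
  obtain ⟨b, hb⟩ := g.exists_isOrthoTriple p
  obtain ⟨V₁, hp₁, e, he, -⟩ := exists_isOrthoFrame_extend g hb
  -- The operators that project onto `k` have a nonzero image on `v` precisely because g(k,v) ≠ 0.
  obtain ⟨v, hv⟩ : ∃ v, g.val p (k p) v ≠ 0 := by
    by_contra! h; exact (hk p hp).1 (g.nondegenerate p (k p) h)
  obtain ⟨V₂, hV₂, hp₂, hX⟩ := exists_smoothFieldOn_extend p v
  obtain ⟨X, hXdef⟩ : ∃ X : ∀ q : M, TangentSpace 𝓘(ℝ, E3) q, X = extend E3 v := ⟨_, rfl⟩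
  have hXp : X p = v := by rw [hXdef, extend_apply_self]
  rw [← hXdef] at hX
  have hO : IsOpen (V ∩ V₁ ∩ V₂) := (hV.inter he.isOpen).inter hV₂
  have he' := he.mono hO fun q hq => hq.1.2
  have hX' : SmoothFieldOn ∞ X (V ∩ V₁ ∩ V₂) := hX.mono Set.inter_subset_right
  have hFX := he'.smoothFieldOn_phiOp hX'
  by_cases hN : T = .Nr
  · subst hN
    obtain ⟨W, hWV, hW, hpW, hY, h⟩ := exists_smooth_of_proportional hO ⟨⟨hp, hp₁⟩, hp₂⟩ hFX
      (k := k) (fun q hq => by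
        obtain ⟨d, -, hd⟩ := (hT q hq.1.1).phiOp_linear (hk q hq.1.1)
        exact ⟨_, hd _⟩) (by
        obtain ⟨d, hd0, hd⟩ := (hT p hp).phiOp_linear (hk p hp)
        rw [hd, hXp]
        exact smul_ne_zero (mul_ne_zero hd0 hv) (hk p hp).1) g
    exact ⟨W, fun q hq => (hWV hq).1.1, hW, hpW, _, hY, h⟩
  · have h3 : T = .II ∨ T = .IIr ∨ T = .IIIr := by tauto
    -- For II and II_r the eigenvalue is a quotient with nonzero denominator; for III_r it is
    -- identically zero.
    have hl : SmoothFnOn g.phiEigenvalue (V ∩ V₁ ∩ V₂) := by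
      by_cases h2 : T = .II ∨ T = .IIr
      · exact he'.smoothFnOn_phiEigenvalue fun q hq =>
          (hT q hq.1.1).trace_sq_ne_zero (hk q hq.1.1) h2
      · obtain rfl : T = .IIIr := by tauto
        exact (contMDiffOn_const (c := (0 : ℝ))).congr fun q hq =>
          (hT q hq.1.1).phiEigenvalue_eq_zero (hk q hq.1.1)
    have hl2 : SmoothFnOn (fun q => 2 * g.phiEigenvalue q ^ 2) (V ∩ V₁ ∩ V₂) :=
      contMDiffOn_const.mul (hl.pow 2)
    have hY := SmoothFieldOn.sub (SmoothFieldOn.add (he'.smoothFieldOn_phiOp hFX)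
      (SmoothFieldOn.smul hl hFX)) (SmoothFieldOn.smul hl2 hX')
    obtain ⟨W, hWV, hW, hpW, hY, h⟩ := exists_smooth_of_proportional hO ⟨⟨hp, hp₁⟩, hp₂⟩ hY
      (k := k) (fun q hq => by
        obtain ⟨d, -, hd⟩ := (hT q hq.1.1).phiOp_quadratic (hk q hq.1.1) h3
        exact ⟨_, hd _⟩) (by
        obtain ⟨d, hd0, hd⟩ := (hT p hp).phiOp_quadratic (hk p hp) h3
        refine ne_of_eq_of_ne (hd (X p)) ?_
        rw [hXp]
        exact smul_ne_zero (mul_ne_zero hd0 hv) (hk p hp).1) g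
    exact ⟨W, fun q hq => (hWV hq).1.1, hW, hpW, _, hY, h⟩

/-- The unit eigenvector of the simple eigenvalue is smooth up to sign. -/
lemma exists_smooth_isDoubleEigen (hV : IsOpen V) (hp : p ∈ V) (hσ : σ ^ 2 = 1)
    (hn : ∀ q ∈ V, g.IsDoubleEigen q σ (lam q) (n q)) (hl0 : ∀ q ∈ V, lam q ≠ 0) :
    ∃ W ⊆ V, IsOpen W ∧ p ∈ W ∧ ∃ Y, SmoothFieldOn ∞ Y W ∧
      ∀ q ∈ W, ∃ r : ℝ, r ^ 2 = 1 ∧ Y q = r • n q := by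
  obtain ⟨b, hb⟩ := g.exists_isOrthoTriple p
  obtain ⟨V₁, hp₁, e, he, -⟩ := exists_isOrthoFrame_extend g hb
  obtain ⟨V₂, hV₂, hp₂, hX⟩ := exists_smoothFieldOn_extend p (n p)
  obtain ⟨X, hXdef⟩ : ∃ X : ∀ q : M, TangentSpace 𝓘(ℝ, E3) q, X = extend E3 (n p) := ⟨_, rfl⟩
  have hXp : X p = n p := by rw [hXdef, extend_apply_self]
  rw [← hXdef] at hX
  have hO : IsOpen (V ∩ V₁ ∩ V₂) := (hV.inter he.isOpen).inter hV₂
  have he' := he.mono hO fun q hq => hq.1.2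
  have hX' : SmoothFieldOn ∞ X (V ∩ V₁ ∩ V₂) := hX.mono Set.inter_subset_right
  have hl : SmoothFnOn g.phiEigenvalue (V ∩ V₁ ∩ V₂) := he'.smoothFnOn_phiEigenvalue fun q hq => by
    rw [((hn q hq.1.1).trace hσ).1]
    have := hl0 q hq.1.1
    positivity
  -- The operator Φ - lam has the line of `n` as image. Applied to an extension of `n p` it gives a
  -- smooth field along `n` that does not vanish at `p`.
  have hY := SmoothFieldOn.sub (he'.smoothFieldOn_phiOp hX') (SmoothFieldOn.smul hl hX')
  obtain ⟨Y, hYdef⟩ : ∃ Y, Y = (fun q => g.phiOp q (X q)) - g.phiEigenvalue • X := ⟨_, rfl⟩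
  rw [← hYdef] at hY
  have hYn : ∀ q ∈ V ∩ V₁ ∩ V₂, Y q = (- (3 * σ * lam q * g.val q (n q) (X q))) • n q := by
    intro q hq
    have hq' := hn q hq.1.1
    rw [hYdef]
    change g.phiOp q (X q) - g.phiEigenvalue q • X q = _
    rw [hq'.phiEigenvalue hσ, hq'.phiOp_eq]
    module
  have hpp : p ∈ V ∩ V₁ ∩ V₂ := ⟨⟨hp, hp₁⟩, hp₂⟩
  have hσ0 : σ ≠ 0 := by rintro rfl; norm_num at hσ
  obtain ⟨W, hWV, hW, hpW, f, hf, h⟩ := exists_normalised g hO hY hpp hσ (by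
    rw [hYn p hpp, hXp]
    simp only [map_smul, _root_.smul_apply, smul_eq_mul, (hn p hp).nn]
    have := hl0 p hp
    have h1 : 0 < (3 * σ * lam p * σ * σ) ^ 2 := by positivity
    linarith)
  refine ⟨W, fun q hq => (hWV hq).1.1, hW, hpW, f • Y, SmoothFieldOn.smul hf (hY.mono hWV),
    fun q hq => ⟨f q * (- (3 * σ * lam q * g.val q (n q) (X q))), ?_, ?_⟩⟩
  · have h1 := (h q hq).2.1
    have h2 : (f • Y) q = (f q * (- (3 * σ * lam q * g.val q (n q) (X q)))) • n q := by
      rw [Pi.smul_apply', hYn q (hWV hq), smul_smul]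
    rw [h2] at h1
    simp only [map_smul, _root_.smul_apply, smul_eq_mul, (hn q (hWV hq).1.1).nn] at h1
    apply mul_right_cancel₀ hσ0
    linear_combination h1
  · rw [Pi.smul_apply', hYn q (hWV hq), smul_smul]

end smooth

/-! ### Congruences and types, locally and globally -/

section congruences

variable {g : LorentzMetric M} {o : g.VolumeForm} {m Λ : ℝ} {U V : Set M}
  {e : Fin 3 → ∀ p : M, TangentSpace 𝓘(ℝ, E3) p} {k n : ∀ p : M, TangentSpace 𝓘(ℝ, E3) p}
  {L L₁ L₂ : ∀ p : M, Submodule ℝ (TangentSpace 𝓘(ℝ, E3) p)} {p q : M} {T : PetrovType}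
  {lam : M → ℝ}

lemma IsOrthoFrame.isNullFrame (he : g.IsOrthoFrame V ![1, -1, 1] e) (hq : q ∈ V) :
    g.IsNullFrame q (e 0 q + e 1 q) ((1 / 2 : ℝ) • (e 0 q - e 1 q)) (e 2 q) := by
  have hb := (he.ortho q hq).2
  simp only at hb
  constructor <;> simp [hb] <;> norm_num

lemma IsOrthoFrame.isMultiplePrincipalFrame_iff (he : g.IsOrthoFrame V ![1, -1, 1] e) :
    g.IsMultiplePrincipalFrame V e ↔ ∀ q ∈ V, g.IsMultiplePrincipal q (e 0 q + e 1 q) := by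
  have hkk : ∀ q, g.phi q (e 0 q + e 1 q) (e 0 q + e 1 q)
      = g.frameΦ e 0 0 q + 2 * g.frameΦ e 0 1 q + g.frameΦ e 1 1 q := fun q => by
    simp only [map_add, LinearMap.add_apply, frameΦ, g.phi_symm (e 1 q) (e 0 q)]
    ring
  have hku : ∀ q, g.phi q (e 0 q + e 1 q) (e 2 q) = g.frameΦ e 0 2 q + g.frameΦ e 1 2 q :=
    fun q => by simp only [map_add, LinearMap.add_apply, frameΦ]
  refine ⟨fun h q hq => (he.isNullFrame hq).isMultiplePrincipal ?_ ?_, fun h q hq => ?_⟩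
  · rw [hkk]; exact (h q hq).1
  · rw [hku]; exact (h q hq).2
  · rw [← hkk, ← hku]; exact (h q hq).phi_eq (he.isNullFrame hq)

/-- The tangents to a divergence-free congruence of null geodesics are multiple principal. -/
theorem IsKundtCongruence.exists_isMultiplePrincipal (h : g.IsKundtCongruence U L)
    (hTMG : g.SolvesTMG o m Λ) (hm : m ≠ 0) (hp : p ∈ U) :
    ∃ k, g.IsMultiplePrincipal p k ∧ L p = Submodule.span ℝ {k} := by
  obtain ⟨V, hV, hpV, -, k, hk, hkV⟩ := h p hp
  obtain ⟨W, hWV, hpW, e, he, hek⟩ :=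
    exists_kundtFrame hV hpV hk (fun q hq => (hkV q hq).2.2.1) (hkV p hpV).1
  have hF : g.IsKundtFrame W e := fun q hq =>
    (he.kundt_iff (fun q hq => (hek q hq).symm) hq).1 (hkV q (hWV hq)).2.2.2
  have := he.isMultiplePrincipalFrame_iff.1 (he.isMultiplePrincipalFrame hTMG hm hF) p hpW
  rw [hek p hpW] at this
  exact ⟨_, this, (hkV p hpV).2.1⟩

/-- A smooth field of multiple principal null vectors is tangent to a divergence-free congruence of
null geodesics. -/
theorem kundt_of_isMultiplePrincipal (hTMG : g.SolvesTMG o m Λ) (hm : m ≠ 0) (hV : IsOpen V)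
    (hk : SmoothFieldOn ∞ k V) (hkV : ∀ q ∈ V, g.IsMultiplePrincipal q (k q)) (hO : T ≠ .O)
    (hT : ∀ q ∈ V, g.HasPetrovType q T) (hp : p ∈ V) :
    g.divergence k p • k p - g.leviCivita k p (k p) = 0 := by
  obtain ⟨W, hWV, hpW, e, he, hek⟩ :=
    exists_kundtFrame hV hp hk (fun q hq => (hkV q hq).2.1) (hkV p hp).1
  have hkW : ∀ q ∈ W, g.IsMultiplePrincipal q (e 0 q + e 1 q) := fun q hq => by
    rw [hek q hq]; exact hkV q (hWV hq)
  refine (he.kundt_iff (fun q hq => (hek q hq).symm) hpW).2 (he.isKundtFrame hTMG hm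
    (he.isMultiplePrincipalFrame_iff.2 hkW) ?_ p hpW)
  -- The components that `isKundtFrame` distinguishes, in terms of the null frame: -2 Φ(k,l), Φ(u,l)
  -- and Φ(k,l) + Φ(l,l).
  have h22 : ∀ q ∈ W, g.frameΦ e 2 2 q
      = - 2 * g.phi q (e 0 q + e 1 q) ((1 / 2 : ℝ) • (e 0 q - e 1 q)) := fun q hq =>
    (he.isNullFrame hq).phi_uu
  have h02 : ∀ q ∈ W, g.frameΦ e 0 2 q = g.phi q (e 2 q) ((1 / 2 : ℝ) • (e 0 q - e 1 q)) := by
    intro q hq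
    have h1 := ((hkW q hq).phi_eq (he.isNullFrame hq)).2
    simp only [map_add, LinearMap.add_apply] at h1
    simp only [map_sub, map_smul, LinearMap.sub_apply, LinearMap.smul_apply, smul_eq_mul, frameΦ,
      g.phi_symm (e 2 q)]
    linarith
  have h00 : ∀ q ∈ W, g.frameΦ e 0 0 q
      = g.phi q (e 0 q + e 1 q) ((1 / 2 : ℝ) • (e 0 q - e 1 q))
        + g.phi q ((1 / 2 : ℝ) • (e 0 q - e 1 q)) ((1 / 2 : ℝ) • (e 0 q - e 1 q)) := by
    intro q hq
    have h1 := ((hkW q hq).phi_eq (he.isNullFrame hq)).1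
    simp only [map_add, LinearMap.add_apply, g.phi_symm (e 1 q) (e 0 q)] at h1
    simp only [map_add, map_sub, map_smul, smul_eq_mul, LinearMap.add_apply, LinearMap.sub_apply,
      LinearMap.smul_apply, frameΦ, g.phi_symm (e 1 q) (e 0 q)]
    linarith
  have hcases := fun q (hq : q ∈ W) =>
    (hT q (hWV hq)).of_isMultiplePrincipal (hkW q hq) (he.isNullFrame hq)
  by_cases hS : T = .II ∨ T = .IIr ∨ T = .Dr
  · refine Or.inl fun q hq => ?_
    rw [h22 q hq]
    refine mul_ne_zero (by norm_num) ?_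
    rcases hcases q hq with ⟨-, h, -⟩ | ⟨-, h⟩ | ⟨h, -⟩ | ⟨h, -⟩ | ⟨h, -⟩
    · exact h
    · exact h
    all_goals simp [h] at hS
  · by_cases h3 : T = .IIIr
    · refine Or.inr (Or.inl fun q hq => ?_)
      rw [h22 q hq, h02 q hq]
      rcases hcases q hq with ⟨h | h, -⟩ | ⟨h, -⟩ | ⟨-, h, h'⟩ | ⟨h, -⟩ | ⟨h, -⟩
      · simp [h3] at h
      · simp [h3] at h
      · simp [h3] at h
      · exact ⟨by rw [h, mul_zero], h'⟩
      · simp [h3] at h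
      · simp [h3] at h
    · refine Or.inr (Or.inr fun q hq => ?_)
      rw [h22 q hq, h02 q hq, h00 q hq]
      rcases hcases q hq with ⟨h | h, -⟩ | ⟨h, -⟩ | ⟨h, -⟩ | ⟨-, h, h', h''⟩ | ⟨h, -⟩
      · simp [h] at hS
      · simp [h] at hS
      · simp [h] at hS
      · exact (h3 h).elim
      · exact ⟨by rw [h, mul_zero], h', by rwa [h, zero_add]⟩
      · exact (hO h).elim

lemma isKundtCongruence_of_isMultiplePrincipal (hTMG : g.SolvesTMG o m Λ) (hm : m ≠ 0)
    (hO : T ≠ .O) (hT : ∀ q, g.HasPetrovType q T)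
    (h : ∀ p ∈ U, ∃ V ⊆ U, IsOpen V ∧ p ∈ V ∧ ∃ k, SmoothFieldOn ∞ k V ∧
      ∀ q ∈ V, L q = Submodule.span ℝ {k q} ∧ g.IsMultiplePrincipal q (k q)) :
    g.IsKundtCongruence U L := by
  intro p hp
  obtain ⟨V, hVU, hV, hpV, k, hk, hkV⟩ := h p hp
  exact ⟨V, hV, hpV, hVU, k, hk, fun q hq => ⟨(hkV q hq).2.1, (hkV q hq).1, (hkV q hq).2.2.1,
    kundt_of_isMultiplePrincipal hTMG hm hV hk (fun q hq => (hkV q hq).2) hO (fun q _ => hT q) hq⟩⟩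

/-- The types that admit a divergence-free congruence of null geodesics. -/
lemma IsKundtCongruence.type_mem (h : g.IsKundtCongruence U L) (hTMG : g.SolvesTMG o m Λ)
    (hm : m ≠ 0) (hp : p ∈ U) (hT : g.HasPetrovType p T) (hO : T ≠ .O) :
    T ∈ ({.II, .IIr, .Dr, .IIIr, .Nr} : Set PetrovType) := by
  obtain ⟨k, hk, -⟩ := h.exists_isMultiplePrincipal hTMG hm hp
  obtain ⟨l, u, hf⟩ := exists_isNullFrame hk.2.1 hk.1
  rcases hT.of_isMultiplePrincipal hk hf with ⟨h | h, -⟩ | ⟨h, -⟩ | ⟨h, -⟩ | ⟨h, -⟩ | ⟨h, -⟩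
  · simp [h]
  · simp [h]
  · simp [h]
  · simp [h]
  · simp [h]
  · exact (hO h).elim

lemma IsKundtCongruence.type_of_ne (h₁ : g.IsKundtCongruence U L₁) (h₂ : g.IsKundtCongruence U L₂)
    (hTMG : g.SolvesTMG o m Λ) (hm : m ≠ 0) (hp : p ∈ U) (hne : L₁ p ≠ L₂ p)
    (hT : g.HasPetrovType p T) : T = .Dr ∨ T = .O := by
  obtain ⟨k, hk, hL₁⟩ := h₁.exists_isMultiplePrincipal hTMG hm hp
  obtain ⟨k', hk', hL₂⟩ := h₂.exists_isMultiplePrincipal hTMG hm hp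
  exact hT.of_two hk hk' (by rwa [← hL₁, ← hL₂])

/-- Existence of the congruence for the types with one multiple principal null direction. -/
theorem exists_isKundtCongruence (hTMG : g.SolvesTMG o m Λ) (hm : m ≠ 0)
    (hT : ∀ q, g.HasPetrovType q T) (h4 : T = .II ∨ T = .IIr ∨ T = .IIIr ∨ T = .Nr) :
    ∃ L, g.IsKundtCongruence Set.univ L := by
  have hO : T ≠ .O := by rintro rfl; simp at h4
  -- The vectors are chosen point by point without continuity; the smooth local fields below span
  -- the same lines.
  choose k hk using fun q => (hT q).exists_isMultiplePrincipal (by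
    rcases h4 with rfl | rfl | rfl | rfl <;> simp)
  refine ⟨fun q => Submodule.span ℝ {k q},
    isKundtCongruence_of_isMultiplePrincipal hTMG hm hO hT fun p _ => ?_⟩
  obtain ⟨W, -, hW, hpW, Y, hY, h⟩ := exists_smooth_multiplePrincipal (g := g) (k := k) isOpen_univ
    (Set.mem_univ p) (fun q _ => hT q) (fun q _ => hk q) h4
  refine ⟨W, Set.subset_univ _, hW, hpW, Y, hY, fun q hq => ?_⟩
  obtain ⟨d, hd, hYq⟩ := h q hq
  rw [hYq]
  exact ⟨(Submodule.span_singleton_smul_eq (IsUnit.mk0 _ hd) _).symm, (hk q).smul hd⟩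

/-- For type `Dr` there is locally an orthonormal frame adapted to the two multiple principal null
directions. -/
lemma exists_adaptedFrame (hT : ∀ q, g.HasPetrovType q .Dr) (p : M) :
    ∃ W, p ∈ W ∧ ∃ e, g.IsOrthoFrame W ![1, -1, 1] e ∧
      ∀ q ∈ W, ∃ lam ≠ 0, g.IsDoubleEigen q 1 lam (e 2 q) := by
  choose n lam hlam hn using fun q => (hT q).exists_isDoubleEigen (σ := 1) (Or.inr ⟨rfl, rfl⟩)
  obtain ⟨W, -, hW, hpW, Y, hY, h⟩ := exists_smooth_isDoubleEigen (g := g) isOpen_univ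
    (Set.mem_univ p) (by norm_num) (fun q _ => hn q) (fun q _ => hlam q)
  have hYn : ∀ q ∈ W, g.IsDoubleEigen q 1 (lam q) (Y q) := fun q hq => by
    obtain ⟨r, hr, hYq⟩ := h q hq
    rw [hYq]
    exact (hn q).smul hr
  obtain ⟨W', hW', hpW', e, he, he2⟩ := exists_spacelikeFrame hW hpW hY fun q hq => (hYn q hq).nn
  exact ⟨W', hpW', e, he, fun q hq => ⟨lam q, hlam q, by rw [he2 q hq]; exact hYn q (hW' hq)⟩⟩

lemma span_eq_of_null_orthogonal {x y : TangentSpace 𝓘(ℝ, E3) q} (hx : g.val q x x = 0)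
    (hx0 : x ≠ 0) (hy : g.val q y y = 0) (hy0 : y ≠ 0) (hxy : g.val q x y = 0) :
    Submodule.span ℝ {x} = Submodule.span ℝ {y} := by
  obtain ⟨l, u, h⟩ := exists_isNullFrame hy hy0
  exact h.span_eq_of_orthogonal hx hxy hx0

section adapted

variable {W : Set M} {σ : ℝ}

lemma IsOrthoFrame.null_of_sign (he : g.IsOrthoFrame W ![1, -1, 1] e) (hσ : σ ^ 2 = 1)
    (hq : q ∈ W) : g.val q (e 0 q + σ • e 1 q) (e 0 q + σ • e 1 q) = 0 ∧
      g.val q (e 0 q + σ • e 1 q) (e 0 q - σ • e 1 q) = 2 ∧ e 0 q + σ • e 1 q ≠ 0 := by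
  have hb := (he.ortho q hq).2
  simp only at hb
  have h2 : g.val q (e 0 q + σ • e 1 q) (e 0 q - σ • e 1 q) = 2 := by
    simp [hb]; linear_combination hσ
  refine ⟨by simp [hb]; linear_combination -hσ, h2, fun h0 => ?_⟩
  rw [h0] at h2
  simp at h2

lemma IsOrthoFrame.span_ne (he : g.IsOrthoFrame W ![1, -1, 1] e) (hσ : σ ^ 2 = 1) (hq : q ∈ W) :
    Submodule.span ℝ {e 0 q + σ • e 1 q} ≠ Submodule.span ℝ {e 0 q + (-σ) • e 1 q} := by
  obtain ⟨h1, h2, h3⟩ := he.null_of_sign hσ hq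
  intro h
  have := h ▸ Submodule.mem_span_singleton_self (R := ℝ) (e 0 q + (-σ) • e 1 q)
  obtain ⟨c, hc⟩ := Submodule.mem_span_singleton.1 this
  rw [neg_smul, ← sub_eq_add_neg] at hc
  rw [← hc, map_smul, h1] at h2
  simp at h2

lemma IsOrthoFrame.isMultiplePrincipal_of_sign (he : g.IsOrthoFrame W ![1, -1, 1] e)
    (hσ : σ ^ 2 = 1) (hq : q ∈ W) {lam : ℝ} (hlam : lam ≠ 0)
    (h : g.IsDoubleEigen q 1 lam (e 2 q)) : g.IsMultiplePrincipal q (e 0 q + σ • e 1 q) := by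
  obtain ⟨h1, -, h3⟩ := he.null_of_sign hσ hq
  have hb := (he.ortho q hq).2
  simp only at hb
  exact (h.isMultiplePrincipal_iff hlam h1 h3).2 (by simp [hb])

lemma IsOrthoFrame.smoothFieldOn_of_sign (he : g.IsOrthoFrame W ![1, -1, 1] e) (σ : ℝ) :
    SmoothFieldOn ∞ (fun q => e 0 q + σ • e 1 q) W :=
  SmoothFieldOn.add (he.smooth 0) (SmoothFieldOn.const_smul σ (he.smooth 1))

/-- The product of the inner products of a multiple principal null vector with the two null
vectors of the frame vanishes. -/
lemma IsOrthoFrame.mul_eq_zero (he : g.IsOrthoFrame W ![1, -1, 1] e) (hσ : σ ^ 2 = 1) (hq : q ∈ W)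
    {lam : ℝ} (hlam : lam ≠ 0) (h : g.IsDoubleEigen q 1 lam (e 2 q))
    {x : TangentSpace 𝓘(ℝ, E3) q} (hx : g.IsMultiplePrincipal q x) :
    g.val q x (e 0 q + σ • e 1 q) * g.val q x (e 0 q + (-σ) • e 1 q) = 0 := by
  have h2 := (h.isMultiplePrincipal_iff hlam hx.2.1 hx.1).1 hx
  have h0 := (he.ortho q hq).val_eq x x
  rw [hx.2.1] at h0
  simp only [Fin.sum_univ_three, Matrix.cons_val_zero, Matrix.cons_val_one, Matrix.cons_val] at h0
  rw [g.symm q x (e 2 q), h2] at h0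
  simp only [map_add, map_smul, smul_eq_mul]
  linear_combination -h0 - g.val q x (e 1 q) ^ 2 * hσ

/-- At type D_r there are only two multiple principal null lines, the null lines orthogonal to `e
2`. -/
lemma IsOrthoFrame.span_eq_of_ne (he : g.IsOrthoFrame W ![1, -1, 1] e) (hσ : σ ^ 2 = 1)
    (hq : q ∈ W) {lam : ℝ} (hlam : lam ≠ 0) (h : g.IsDoubleEigen q 1 lam (e 2 q))
    {x : TangentSpace 𝓘(ℝ, E3) q} (hx : g.IsMultiplePrincipal q x)
    (hne : Submodule.span ℝ {x} ≠ Submodule.span ℝ {e 0 q + σ • e 1 q}) :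
    Submodule.span ℝ {x} = Submodule.span ℝ {e 0 q + (-σ) • e 1 q} := by
  have hσ' : (-σ) ^ 2 = 1 := by rw [neg_sq, hσ]
  obtain ⟨h1, -, h3⟩ := he.null_of_sign hσ hq
  obtain ⟨h1', -, h3'⟩ := he.null_of_sign hσ' hq
  rcases _root_.mul_eq_zero.1 (he.mul_eq_zero hσ hq hlam h hx) with h0 | h0
  · exact (hne (span_eq_of_null_orthogonal hx.2.1 hx.1 h1 h3 h0)).elim
  · exact span_eq_of_null_orthogonal hx.2.1 hx.1 h1' h3' h0

end adapted

/-- Local existence of two congruences for type `Dr`. -/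
theorem exists_two_isKundtCongruence (hTMG : g.SolvesTMG o m Λ) (hm : m ≠ 0)
    (hT : ∀ q, g.HasPetrovType q .Dr) (p : M) :
    ∃ U : Set M, IsOpen U ∧ p ∈ U ∧ ∃ L₁ L₂, g.IsKundtCongruence U L₁ ∧
      g.IsKundtCongruence U L₂ ∧ ∀ q ∈ U, L₁ q ≠ L₂ q := by
  obtain ⟨W, hpW, e, he, h⟩ := exists_adaptedFrame hT p
  have key : ∀ σ : ℝ, σ ^ 2 = 1 →
      g.IsKundtCongruence W (fun q => Submodule.span ℝ {e 0 q + σ • e 1 q}) := fun σ hσ =>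
    isKundtCongruence_of_isMultiplePrincipal hTMG hm (by simp) hT fun q hq =>
      ⟨W, subset_rfl, he.isOpen, hq, _, he.smoothFieldOn_of_sign σ, fun q hq => ⟨rfl, by
        obtain ⟨lam, hlam, hn⟩ := h q hq
        exact he.isMultiplePrincipal_of_sign hσ hq hlam hn⟩⟩
  exact ⟨W, he.isOpen, hpW, _, _, key 1 (by norm_num), key (-1) (by norm_num),
    fun q hq => he.span_ne (by norm_num) hq⟩

lemma continuousOn_val {X Y : ∀ p : M, TangentSpace 𝓘(ℝ, E3) p} (hX : SmoothFieldOn 0 X V)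
    (hY : SmoothFieldOn 0 Y V) : ContinuousOn (fun q => g.val q (X q) (Y q)) V := by
  have : ContMDiffOn 𝓘(ℝ, E3) (𝓘(ℝ, E3).prod 𝓘(ℝ)) 0
      (fun m ↦ TotalSpace.mk' ℝ (E := Bundle.Trivial M ℝ) m (g.val m (X m) (Y m))) V := by
    apply ContMDiffOn.clm_bundle_apply₂ (F₁ := E3) (F₂ := E3)
    · exact (g.contMDiff.of_le (by simp)).contMDiffOn
    · exact hX
    · exact hY
  intro x hx
  have := this x hx
  rw [contMDiffWithinAt_totalSpace] at this
  exact this.2.continuousWithinAt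

/-- A continuous field of multiple principal null lines is locally spanned by one of the two null
vectors of an adapted frame. -/
lemma exists_sign_of_lineField (hT : ∀ q, g.HasPetrovType q .Dr)
    (hL : ∀ p, ∃ V : Set M, IsOpen V ∧ p ∈ V ∧ ∃ k : ∀ q : M, TangentSpace 𝓘(ℝ, E3) q,
      SmoothFieldOn 0 k V ∧ ∀ q ∈ V, L q = Submodule.span ℝ {k q} ∧ g.IsMultiplePrincipal q (k q))
    (p : M) : ∃ W, p ∈ W ∧ ∃ e, g.IsOrthoFrame W ![1, -1, 1] e ∧
      (∀ q ∈ W, ∃ lam ≠ 0, g.IsDoubleEigen q 1 lam (e 2 q)) ∧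
      ∃ σ : ℝ, σ ^ 2 = 1 ∧ ∀ q ∈ W, L q = Submodule.span ℝ {e 0 q + σ • e 1 q} := by
  obtain ⟨W, hpW, e, he, h⟩ := exists_adaptedFrame hT p
  obtain ⟨V, hV, hpV, k, hk, hkV⟩ := hL p
  -- The product in `mul_eq_zero` vanishes everywhere. If one factor is nonzero at `p` it stays
  -- nonzero nearby by continuity, so the other factor vanishes there and fixes the line.
  obtain ⟨σ, hσ, hσp⟩ : ∃ σ : ℝ, σ ^ 2 = 1 ∧ g.val p (k p) (e 0 p + (-σ) • e 1 p) ≠ 0 := by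
    by_contra! hcon
    have h1 := hcon 1 (by norm_num)
    have h2 := hcon (-1) (by norm_num)
    obtain ⟨a1, -, a3⟩ := he.null_of_sign (σ := 1) (by norm_num) hpW
    obtain ⟨b1, -, b3⟩ := he.null_of_sign (σ := -1) (by norm_num) hpW
    have hkp := (hkV p hpV).2
    rw [neg_neg] at h2
    exact he.span_ne (σ := 1) (by norm_num) hpW
      ((span_eq_of_null_orthogonal hkp.2.1 hkp.1 a1 a3 h2).symm.trans
        (span_eq_of_null_orthogonal hkp.2.1 hkp.1 b1 b3 h1))
  have hc := continuousOn_val (g := g) (hk.mono (Set.inter_subset_left (t := W)))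
    (((he.smoothFieldOn_of_sign (-σ)).of_le (by simp)).mono (Set.inter_subset_right (s := V)))
  have hO := hc.isOpen_inter_preimage (hV.inter he.isOpen) isOpen_compl_singleton (t := {0}ᶜ)
  refine ⟨_, (⟨⟨hpV, hpW⟩, hσp⟩ : p ∈ (V ∩ W) ∩ _), e, he.mono hO fun q hq => hq.1.2, fun q hq => h q hq.1.2, σ, hσ,
    fun q hq => ?_⟩
  obtain ⟨lam, hlam, hn⟩ := h q hq.1.2
  obtain ⟨hLq, hkq⟩ := hkV q hq.1.1
  obtain ⟨h1, -, h3⟩ := he.null_of_sign hσ hq.1.2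
  rw [hLq]
  exact span_eq_of_null_orthogonal hkq.2.1 hkq.1 h1 h3
    ((_root_.mul_eq_zero.1 (he.mul_eq_zero hσ hq.1.2 hlam hn hkq)).resolve_right hq.2)

/-- Global existence of two congruences for type `Dr`. -/
theorem exists_two_isKundtCongruence_univ (hTMG : g.SolvesTMG o m Λ) (hm : m ≠ 0)
    (hT : ∀ q, g.HasPetrovType q .Dr) (hL : g.HasMultiplePrincipalLineField) :
    ∃ L₁ L₂, g.IsKundtCongruence Set.univ L₁ ∧ g.IsKundtCongruence Set.univ L₂ ∧
      ∀ p, L₁ p ≠ L₂ p := by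
  obtain ⟨L, hL⟩ := hL
  have hloc := exists_sign_of_lineField hT hL
  -- The second congruence consists of the other principal line at each point. It is smooth because
  -- locally the two lines belong to opposite signs in one frame.
  have hx : ∀ q, ∃ x, g.IsMultiplePrincipal q x ∧ Submodule.span ℝ {x} ≠ L q := by
    intro q
    obtain ⟨W, hqW, e, he, h, σ, hσ, hLW⟩ := hloc q
    obtain ⟨lam, hlam, hn⟩ := h q hqW
    refine ⟨_, he.isMultiplePrincipal_of_sign (σ := -σ) (by rw [neg_sq, hσ]) hqW hlam hn, ?_⟩
    rw [hLW q hqW]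
    exact (he.span_ne hσ hqW).symm
  choose x hx hxL using hx
  refine ⟨L, fun q => Submodule.span ℝ {x q}, ?_, ?_, fun q => (hxL q).symm⟩
  · refine isKundtCongruence_of_isMultiplePrincipal hTMG hm (by simp) hT fun p _ => ?_
    obtain ⟨W, hpW, e, he, h, σ, hσ, hLW⟩ := hloc p
    refine ⟨W, Set.subset_univ _, he.isOpen, hpW, _, he.smoothFieldOn_of_sign σ,
      fun q hq => ⟨hLW q hq, ?_⟩⟩
    obtain ⟨lam, hlam, hn⟩ := h q hq
    exact he.isMultiplePrincipal_of_sign hσ hq hlam hn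
  · refine isKundtCongruence_of_isMultiplePrincipal hTMG hm (by simp) hT fun p _ => ?_
    obtain ⟨W, hpW, e, he, h, σ, hσ, hLW⟩ := hloc p
    refine ⟨W, Set.subset_univ _, he.isOpen, hpW, _, he.smoothFieldOn_of_sign (-σ), fun q hq => ?_⟩
    obtain ⟨lam, hlam, hn⟩ := h q hq
    exact ⟨he.span_eq_of_ne hσ hq hlam hn (hx q) (by rw [← hLW q hq]; exact hxL q),
      he.isMultiplePrincipal_of_sign (by rw [neg_sq, hσ]) hq hlam hn⟩

/-- The tangents to a shear-free congruence of timelike geodesics are eigenvectors of `Φ`. -/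
theorem IsShearFreeTimelikeGeodesicCongruence.exists_isDoubleEigen
    (h : g.IsShearFreeTimelikeGeodesicCongruence U L) (hTMG : g.SolvesTMG o m Λ) (hm : m ≠ 0)
    (hp : p ∈ U) : ∃ n lam, g.IsDoubleEigen p (-1) lam n := by
  obtain ⟨V, hV, hpV, -, u, hu, huV⟩ := h p hp
  obtain ⟨W, hWV, hpW, e, he, heu⟩ := exists_timelikeFrame hV hpV hu fun q hq => (huV q hq).2.1
  have hF : g.IsShearFreeFrame W e := fun q hq =>
    (he.shearFree_iff (fun q hq => (heu q hq).symm) hq).1 (huV q (hWV hq)).2.2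
  obtain ⟨h1, h2, h3, h4⟩ := he.isDoubleEigenFrame hTMG hm hF p hpW
  have hb := he.ortho p hpW
  have ho := hb.2
  have htr := hb.phi_trace
  simp only [Fin.sum_univ_three, Matrix.cons_val_zero, Matrix.cons_val_one, Matrix.cons_val] at htr
  simp only [frameΦ] at h1 h2 h3 h4
  refine ⟨e 2 p, g.phi p (e 0 p) (e 0 p), by simp [ho], fun v w => ?_⟩
  rw [hb.bilin_eq (g.phi p) v w, hb.val_eq v w, g.symm p (e 2 p) v, g.symm p (e 2 p) w]
  simp only [Fin.sum_univ_three, Matrix.cons_val_zero, Matrix.cons_val_one, Matrix.cons_val,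
    g.phi_symm (e 1 p) (e 0 p), g.phi_symm (e 2 p), h2, h3, h4]
  linear_combination (-(g.val p v (e 2 p) * g.val p w (e 2 p))) * htr
    + (-(g.val p v (e 1 p) * g.val p w (e 1 p)) - g.val p v (e 2 p) * g.val p w (e 2 p)) * h1

/-- Existence of the timelike congruence for type `D`. -/
theorem exists_isShearFreeTimelikeGeodesicCongruence (hTMG : g.SolvesTMG o m Λ) (hm : m ≠ 0)
    (hT : ∀ q, g.HasPetrovType q .D) :
    ∃ L, g.IsShearFreeTimelikeGeodesicCongruence Set.univ L := by
  choose n lam hlam hn using fun q => (hT q).exists_isDoubleEigen (σ := -1) (Or.inl ⟨rfl, rfl⟩)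
  -- The sign of `n` is arbitrary at each point, but its line is not affected; hence no time
  -- orientation is needed for a global congruence.
  refine ⟨fun q => Submodule.span ℝ {n q}, fun p _ => ?_⟩
  obtain ⟨W, -, hW, hpW, Y, hY, h⟩ := exists_smooth_isDoubleEigen (g := g) isOpen_univ
    (Set.mem_univ p) (by norm_num) (fun q _ => hn q) (fun q _ => hlam q)
  have hYn : ∀ q ∈ W, g.IsDoubleEigen q (-1) (lam q) (Y q) := fun q hq => by
    obtain ⟨r, hr, hYq⟩ := h q hq
    rw [hYq]
    exact (hn q).smul hr
  obtain ⟨V, hVW, hpV, e, he, heY⟩ := exists_timelikeFrame hW hpW hY fun q hq => (hYn q hq).nn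
  have hen : ∀ q ∈ V, g.IsDoubleEigen q (-1) (lam q) (e 2 q) := fun q hq => by
    rw [heY q hq]; exact hYn q (hVW hq)
  have hF : g.IsDoubleEigenFrame V e := fun q hq => by
    have ho := (he.ortho q hq).2
    simp only at ho
    simp [frameΦ, (hen q hq).phi, ho]
  have hS := he.isShearFreeFrame hTMG hm hF fun q hq => by
    have ho := (he.ortho q hq).2
    simp only at ho
    have := hlam q
    simp [frameΦ, (hen q hq).phi, ho, this]
    norm_num
  refine ⟨V, he.isOpen, hpV, Set.subset_univ _, Y, hY.mono hVW, fun q hq => ⟨?_, (hYn q (hVW hq)).nn,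
    (he.shearFree_iff (fun q hq => (heY q hq).symm) hq).2 (hS q hq)⟩⟩
  obtain ⟨r, hr, hYq⟩ := h q (hVW hq)
  rw [hYq]
  exact (Submodule.span_singleton_smul_eq (IsUnit.mk0 _ (by rintro rfl; norm_num at hr)) _).symm

end congruences

end LorentzMetric

/-! ### The theorem -/

theorem mainTheorem2 {M : Type*} [TopologicalSpace M] [T2Space M] [SecondCountableTopology M]
    [Nonempty M] [ChartedSpace E3 M] [IsManifold 𝓘(ℝ, E3) ∞ M]
    (g : LorentzMetric M) (e : g.VolumeForm) (m Λ : ℝ) (hm : m ≠ 0) (hTMG : g.SolvesTMG e m Λ) :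
    (∀ (U : Set M) (L : ∀ p : M, Submodule ℝ (TangentSpace 𝓘(ℝ, E3) p)),
      IsOpen U → g.IsKundtCongruence U L → ∀ p ∈ U,
        ∃ T ∈ ({.II, .IIr, .Dr, .IIIr, .Nr, .O} : Set PetrovType), g.HasPetrovType p T) ∧
    (∀ (U : Set M) (L₁ L₂ : ∀ p : M, Submodule ℝ (TangentSpace 𝓘(ℝ, E3) p)),
      IsOpen U → g.IsKundtCongruence U L₁ → g.IsKundtCongruence U L₂ → ∀ p ∈ U, L₁ p ≠ L₂ p →
        ∃ T ∈ ({.Dr, .O} : Set PetrovType), g.HasPetrovType p T) ∧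
    (∀ (U : Set M) (L : ∀ p : M, Submodule ℝ (TangentSpace 𝓘(ℝ, E3) p)),
      IsOpen U → g.IsShearFreeTimelikeGeodesicCongruence U L → ∀ p ∈ U,
        ∃ T ∈ ({.D, .O} : Set PetrovType), g.HasPetrovType p T) ∧
    ∀ T : PetrovType, T ≠ .O → (∀ p, g.HasPetrovType p T) →
      ((∀ p, ∃ U : Set M, IsOpen U ∧ p ∈ U ∧ ∃ L, g.IsKundtCongruence U L) ↔
        T ∈ ({.II, .IIr, .Dr, .IIIr, .Nr} : Set PetrovType)) ∧
      ((∀ p, ∃ U : Set M, IsOpen U ∧ p ∈ U ∧ ∃ L₁ L₂, g.IsKundtCongruence U L₁ ∧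
          g.IsKundtCongruence U L₂ ∧ ∀ q ∈ U, L₁ q ≠ L₂ q) ↔ T = .Dr) ∧
      ((∃ L, g.IsShearFreeTimelikeGeodesicCongruence Set.univ L) ↔ T = .D) ∧
      ((T = .Dr → g.HasMultiplePrincipalLineField) →
        ((∃ L, g.IsKundtCongruence Set.univ L) ↔
          T ∈ ({.II, .IIr, .Dr, .IIIr, .Nr} : Set PetrovType)) ∧
        ((∃ L₁ L₂, g.IsKundtCongruence Set.univ L₁ ∧ g.IsKundtCongruence Set.univ L₂ ∧
          ∀ p, L₁ p ≠ L₂ p) ↔ T = .Dr)) := by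
  refine ⟨fun U L hU h p hp => ?_, fun U L₁ L₂ hU h₁ h₂ p hp hne => ?_, fun U L hU h p hp => ?_,
    fun T hO hT => ?_⟩
  · obtain ⟨k, hk, -⟩ := h.exists_isMultiplePrincipal hTMG hm hp
    exact hk.exists_hasPetrovType
  · obtain ⟨k, hk, -⟩ := h₁.exists_isMultiplePrincipal hTMG hm hp
    obtain ⟨T, -, hT⟩ := hk.exists_hasPetrovType
    exact ⟨T, h₁.type_of_ne h₂ hTMG hm hp hne hT, hT⟩
  · obtain ⟨n, lam, hn⟩ := h.exists_isDoubleEigen hTMG hm hp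
    exact hn.exists_hasPetrovType
  -- Since the type is constant, a congruence near a single point already decides it.
  obtain ⟨p₀⟩ := ‹Nonempty M›
  have hmem : ∀ {U L}, g.IsKundtCongruence U L → ∀ {p}, p ∈ U →
      T ∈ ({.II, .IIr, .Dr, .IIIr, .Nr} : Set PetrovType) := fun h p hp =>
    h.type_mem hTMG hm hp (hT p) hO
  have htwo : ∀ {U L₁ L₂}, g.IsKundtCongruence U L₁ → g.IsKundtCongruence U L₂ → ∀ {p}, p ∈ U →
      L₁ p ≠ L₂ p → T = .Dr := fun h₁ h₂ p hp hne =>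
    (h₁.type_of_ne h₂ hTMG hm hp hne (hT p)).resolve_right hO
  have hone : T ∈ ({.II, .IIr, .Dr, .IIIr, .Nr} : Set PetrovType) → T ≠ .Dr →
      ∃ L, g.IsKundtCongruence Set.univ L := fun h hDr =>
    LorentzMetric.exists_isKundtCongruence hTMG hm hT (by
      rcases h with h | h | h | h | h
      · exact Or.inl h
      · exact Or.inr (Or.inl h)
      · exact (hDr h).elim
      · exact Or.inr (Or.inr (Or.inl h))
      · exact Or.inr (Or.inr (Or.inr h)))
  refine ⟨⟨fun h => ?_, fun h p => ?_⟩, ⟨fun h => ?_, ?_⟩, ⟨?_, ?_⟩,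
    fun hL => ⟨⟨?_, fun h => ?_⟩, ⟨?_, ?_⟩⟩⟩
  · obtain ⟨U, -, hp, L, hK⟩ := h p₀
    exact hmem hK hp
  · by_cases hDr : T = .Dr
    · subst hDr
      obtain ⟨U, hU, hp, L₁, -, h₁, -⟩ := LorentzMetric.exists_two_isKundtCongruence hTMG hm hT p
      exact ⟨U, hU, hp, L₁, h₁⟩
    · exact ⟨Set.univ, isOpen_univ, Set.mem_univ p, hone h hDr⟩
  · obtain ⟨U, -, hp, L₁, L₂, h₁, h₂, hne⟩ := h p₀
    exact htwo h₁ h₂ hp (hne p₀ hp)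
  · rintro rfl
    exact LorentzMetric.exists_two_isKundtCongruence hTMG hm hT
  · rintro ⟨L, h⟩
    obtain ⟨n, lam, hn⟩ := h.exists_isDoubleEigen hTMG hm (Set.mem_univ p₀)
    exact ((hT p₀).of_isDoubleEigen hn).resolve_right hO
  · rintro rfl
    exact LorentzMetric.exists_isShearFreeTimelikeGeodesicCongruence hTMG hm hT
  · rintro ⟨L, h⟩
    exact hmem h (Set.mem_univ p₀)
  · by_cases hDr : T = .Dr
    · subst hDr
      obtain ⟨L₁, -, h₁, -⟩ := LorentzMetric.exists_two_isKundtCongruence_univ hTMG hm hT (hL rfl)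
      exact ⟨L₁, h₁⟩
    · exact hone h hDr
  · rintro ⟨L₁, L₂, h₁, h₂, hne⟩
    exact htwo h₁ h₂ (Set.mem_univ p₀) (hne p₀)
  · rintro rfl
    exact LorentzMetric.exists_two_isKundtCongruence_univ hTMG hm hT (hL rfl)
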